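/- Let $\ell>1$ be an odd integer and let $q\in\mathbb{C}$ be a primitive $\ell$-th root of unity. For a $2\times 2$ matrix $M$ over a $\mathbb{C}$-algebra put $M_1=M\otimes \mathrm{Id}$, $M_2=\mathrm{Id}\otimes M$, $\det_q(M)=M_{11}M_{22}-q^2M_{12}M_{21}$, and let $$R=\begin{bmatrix} q&0&0&0\\0&1&0&0\\0&q-q^{-1}&1&0\\0&0&0&q\end{bmatrix},\qquad R_{21}=\begin{bmatrix} q&0&0&0\\0&1&q-q^{-1}&0\\0&0&1&0\\0&0&0&q\end{bmatrix}.$$ Let $\mathcal{O}_q^+(\mathrm{GL}_2)$ be the $\mathbb{C}$-algebra generated by the entries of $L=\begin{bmatrix}a&b\\c&d\end{bmatrix}$ with relations $R_{21}L_1RL_2=L_2R_{21}L_1R$; let $\mathcal{O}_q(\mathrm{GL}_2)$ (the reflection equation algebra) be its localization at $\det_q=\det_q(L)$, and let $\mathcal{O}_q(BB^-)=\mathcal{O}_q(\mathrm{GL}_2)[d^{-1}]$. Let $\mathcal{D}_q^+(\mathrm{GL}_2)$ be the $\mathbb{C}$-algebra generated by the entries of $X=(x_{ij})$ and $D=(\partial_{ij})$,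 $i,j\in\{1,2\}$, with relations $R_{21}X_1RX_2=X_2R_{21}X_1R$, $R_{21}D_1RD_2=D_2R_{21}D_1R$ and $R_{21}D_1RX_2=X_2R_{21}D_1R_{21}^{-1}$, and let $\mathcal{D}_q(\mathrm{GL}_2)$ be its localization at $\det_q(X)\det_q(D)$. Let $B$ and $B^-$ be the groups of invertible upper and lower triangular complex $2\times 2$ matrices, and let $BB^-\subset \mathrm{GL}_2$ be the big Bruhat cell; $\mathcal{O}(V)$ denotes the algebra of regular functions on $V$. (1) There is a unique central element $z$ of $\mathcal{O}_q(\mathrm{GL}_2)$ such that $\det_q^\ell=z d^\ell-b^\ell c^\ell$. The subalgebra $\mathcal{O}_q^{(\ell)}(\mathrm{GL}_2)$ of $\mathcal{O}_q(\mathrm{GL}_2)$ generated by $z,b^\ell,c^\ell,d^\ell$ and $\det_q^{-\ell}$ is central, and there is an algebra isomorphism $\mathcal{O}(\mathrm{GL}_2)\cong\mathcal{O}_q^{(\ell)}(\mathrm{GL}_2)$ that takes the four matrix entries of $\mathrm{GL}_2$ to the corresponding entries of $\begin{bmatrix}z&b^\ell\\c^\ell&d^\ell\end{bmatrix}$. The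 algebra $\mathcal{O}_q^{(\ell)}(\mathrm{GL}_2)$ embeds into $\mathcal{O}_q(BB^-)$, the subalgebra $\mathcal{O}_q^{(\ell)}(\mathrm{GL}_2)[(d^\ell)^{-1}]$ of $\mathcal{O}_q(BB^-)$ generated by its image and $d^{-\ell}$ is central in $\mathcal{O}_q(BB^-)$, and there is an algebra isomorphism $\mathcal{O}(BB^-)\cong\mathcal{O}_q^{(\ell)}(\mathrm{GL}_2)[(d^\ell)^{-1}]$ given by the same formula on matrix entries. (2) There are unique central elements $v,w$ of $\mathcal{D}_q(\mathrm{GL}_2)$ such that $\det_q(X)^\ell=v x_{22}^\ell-x_{12}^\ell x_{21}^\ell$ and $\det_q(D)^\ell=w\partial_{22}^\ell-\partial_{12}^\ell\partial_{21}^\ell$. The subalgebra of $\mathcal{D}_q(\mathrm{GL}_2)$ generated by $v,x_{12}^\ell,x_{21}^\ell,x_{22}^\ell,w,\partial_{12}^\ell,\partial_{21}^\ell,\partial_{22}^\ell$ and $(\det_q(X)\det_q(D))^{-\ell}$ is central, and there is an algebra isomorphism from $\mathcal{O}(\mathrm{GL}_2\times\mathrm{GL}_2)$ onto it that takes the matrix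 entries of the first factor to the corresponding entries of $\begin{bmatrix}v&x_{12}^\ell\\x_{21}^\ell&x_{22}^\ell\end{bmatrix}$ and those of the second factor to the corresponding entries of $\begin{bmatrix}w&\partial_{12}^\ell\\\partial_{21}^\ell&\partial_{22}^\ell\end{bmatrix}$. -/

import Mathlib

open scoped Kronecker Pointwise

/-! ### Inverting an element of a (noncommutative) algebra -/

/-- The relations of the universal algebra under `A` in which `s` becomes invertible: the symbols
`some a` multiply and add as in `A`, and `none` is a two-sided inverse of `some s`. -/
inductive InvRel (A : Type) [Ring A] [Algebra ℂ A] (s : A) :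
    FreeAlgebra ℂ (Option A) → FreeAlgebra ℂ (Option A) → Prop
  | scalar (r : ℂ) : InvRel A s (FreeAlgebra.ι ℂ (some (algebraMap ℂ A r)))
      (algebraMap ℂ (FreeAlgebra ℂ (Option A)) r)
  | add (a b : A) : InvRel A s (FreeAlgebra.ι ℂ (some (a + b)))
      (FreeAlgebra.ι ℂ (some a) + FreeAlgebra.ι ℂ (some b))
  | mul (a b : A) : InvRel A s (FreeAlgebra.ι ℂ (some (a * b)))
      (FreeAlgebra.ι ℂ (some a) * FreeAlgebra.ι ℂ (some b))
  | left_inv : InvRel A s (FreeAlgebra.ι ℂ none * FreeAlgebra.ι ℂ (some s)) 1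
  | right_inv : InvRel A s (FreeAlgebra.ι ℂ (some s) * FreeAlgebra.ι ℂ none) 1

/-- The localization `A[s⁻¹]` of a `ℂ`-algebra at an element `s`, i.e. the universal algebra under
`A` in which `s` is invertible (it is the Ore localization whenever the powers of `s` satisfy the
Ore condition). See `LocAt.existsUnique_lift` for the universal property. -/
def LocAt (A : Type) [Ring A] [Algebra ℂ A] (s : A) : Type := RingQuot (InvRel A s)

namespace LocAt

variable {A : Type} [Ring A] [Algebra ℂ A]

noncomputable instance (s : A) : Ring (LocAt A s) := inferInstanceAs (Ring (RingQuot (InvRel A s)))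

noncomputable instance (s : A) : Algebra ℂ (LocAt A s) :=
  inferInstanceAs (Algebra ℂ (RingQuot (InvRel A s)))

/-- The quotient map of the presentation. -/
noncomputable def mk (s : A) : FreeAlgebra ℂ (Option A) →ₐ[ℂ] LocAt A s :=
  RingQuot.mkAlgHom ℂ (InvRel A s)

theorem mk_rel (s : A) {x y : FreeAlgebra ℂ (Option A)} (h : InvRel A s x y) :
    mk s x = mk s y :=
  RingQuot.mkAlgHom_rel ℂ h

/-- The canonical homomorphism `A → A[s⁻¹]`. -/
noncomputable def of (s : A) : A →ₐ[ℂ] LocAt A s :=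
  AlgHom.ofLinearMap
    { toFun := fun a => mk s (FreeAlgebra.ι ℂ (some a))
      map_add' := fun a b => by rw [mk_rel s (InvRel.add a b), map_add]
      map_smul' := fun r a => by
        rw [Algebra.smul_def, mk_rel s (InvRel.mul _ a), map_mul, mk_rel s (InvRel.scalar r),
          AlgHom.commutes, RingHom.id_apply, Algebra.smul_def] }
    (by
      change mk s (FreeAlgebra.ι ℂ (some (1 : A))) = 1
      have h := mk_rel s (InvRel.scalar (A := A) (s := s) 1)
      rwa [map_one, map_one, map_one] at h)
    (fun a b => by
      change mk s (FreeAlgebra.ι ℂ (some (a * b))) = _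
      rw [mk_rel s (InvRel.mul a b), map_mul]; rfl)

/-- The element `s⁻¹` of `A[s⁻¹]`. -/
noncomputable def inv (s : A) : LocAt A s := mk s (FreeAlgebra.ι ℂ none)

theorem inv_mul (s : A) : inv s * of s s = 1 := by
  have h := mk_rel s (InvRel.left_inv (A := A) (s := s))
  rwa [map_mul, map_one] at h

theorem mul_inv (s : A) : of s s * inv s = 1 := by
  have h := mk_rel s (InvRel.right_inv (A := A) (s := s))
  rwa [map_mul, map_one] at h

/-- The universal property of the localization. -/
theorem existsUnique_lift (s : A) {B : Type} [Ring B] [Algebra ℂ B] (f : A →ₐ[ℂ] B)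
    (hf : IsUnit (f s)) : ∃! F : LocAt A s →ₐ[ℂ] B, F.comp (of s) = f := by
  obtain ⟨u, hu⟩ := hf
  let F₀ : FreeAlgebra ℂ (Option A) →ₐ[ℂ] B :=
    FreeAlgebra.lift ℂ (fun o => o.elim (↑u⁻¹ : B) f)
  have hF₀ : ∀ ⦃x y⦄, InvRel A s x y → F₀ x = F₀ y := by
    intro x y h
    cases h <;> simp [F₀, ← hu]
  refine ⟨RingQuot.liftAlgHom ℂ ⟨F₀, hF₀⟩, ?_, ?_⟩
  · ext a
    change RingQuot.liftAlgHom ℂ ⟨F₀, hF₀⟩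
      (RingQuot.mkAlgHom ℂ (InvRel A s) (FreeAlgebra.ι ℂ (some a))) = f a
    rw [RingQuot.liftAlgHom_mkAlgHom_apply]
    simp [F₀]
  · intro G hG
    apply RingQuot.ringQuot_ext'
    apply FreeAlgebra.hom_ext
    funext o
    refine Eq.trans (?_ : G (mk s (FreeAlgebra.ι ℂ o)) = F₀ (FreeAlgebra.ι ℂ o))
      (RingQuot.liftAlgHom_mkAlgHom_apply ℂ F₀ hF₀ _).symm
    cases o with
    | some a =>
      have : G (of s a) = f a := DFunLike.congr_fun hG a
      exact Eq.trans this (by simp [F₀])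
    | none =>
      have h1 : G (inv s) * f s = 1 := by
        have : G (of s s) = f s := DFunLike.congr_fun hG s
        rw [← this, ← map_mul, inv_mul, map_one]
      have h2 : G (inv s) = (↑u⁻¹ : B) := by
        rw [← hu] at h1
        exact (Units.mul_eq_one_iff_eq_inv).mp h1
      exact Eq.trans h2 (by simp [F₀])

end LocAt

/-! ### The algebras `O_q(GL₂)`, `O_q(BB⁻)` and `D_q(GL₂)` -/

/-- The `R`-matrix on `ℂ² ⊗ ℂ²`, in the lexicographically ordered basis `e₁⊗e₁, e₁⊗e₂, e₂⊗e₁,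
e₂⊗e₂`. -/
noncomputable def rMat (q : ℂ) : Matrix (Fin 2 × Fin 2) (Fin 2 × Fin 2) ℂ :=
  Matrix.submatrix
    (!![q, 0, 0, 0;
        0, 1, 0, 0;
        0, q - q⁻¹, 1, 0;
        0, 0, 0, q] : Matrix (Fin (2 * 2)) (Fin (2 * 2)) ℂ) finProdFinEquiv finProdFinEquiv

/-- The flipped `R`-matrix `R₂₁`. -/
noncomputable def rMat21 (q : ℂ) : Matrix (Fin 2 × Fin 2) (Fin 2 × Fin 2) ℂ :=
  Matrix.submatrix
    (!![q, 0, 0, 0;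
        0, 1, q - q⁻¹, 0;
        0, 0, 1, 0;
        0, 0, 0, q] : Matrix (Fin (2 * 2)) (Fin (2 * 2)) ℂ) finProdFinEquiv finProdFinEquiv

section
variable {A : Type} [Ring A] [Algebra ℂ A]

/-- A scalar matrix regarded as a matrix over `A`. -/
def scal (M : Matrix (Fin 2 × Fin 2) (Fin 2 × Fin 2) ℂ) :
    Matrix (Fin 2 × Fin 2) (Fin 2 × Fin 2) A :=
  M.map (algebraMap ℂ A)

/-- `M₁ = M ⊗ Id`. -/
def leg1 (M : Matrix (Fin 2) (Fin 2) A) : Matrix (Fin 2 × Fin 2) (Fin 2 × Fin 2) A :=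
  M ⊗ₖ (1 : Matrix (Fin 2) (Fin 2) A)

/-- `M₂ = Id ⊗ M`. -/
def leg2 (M : Matrix (Fin 2) (Fin 2) A) : Matrix (Fin 2 × Fin 2) (Fin 2 × Fin 2) A :=
  (1 : Matrix (Fin 2) (Fin 2) A) ⊗ₖ M

/-- The left side `R₂₁ M₁ R N₂` of the reflection-type equations. -/
noncomputable def reflL (q : ℂ) (M N : Matrix (Fin 2) (Fin 2) A) :
    Matrix (Fin 2 × Fin 2) (Fin 2 × Fin 2) A :=
  scal (rMat21 q) * leg1 M * scal (rMat q) * leg2 N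

/-- The right side `N₂ R₂₁ M₁ R` of the reflection equation. -/
noncomputable def reflR (q : ℂ) (M N : Matrix (Fin 2) (Fin 2) A) :
    Matrix (Fin 2 × Fin 2) (Fin 2 × Fin 2) A :=
  leg2 N * scal (rMat21 q) * leg1 M * scal (rMat q)

/-- The right side `N₂ R₂₁ M₁ R₂₁⁻¹` of the cross relation. -/
noncomputable def crossR (q : ℂ) (M N : Matrix (Fin 2) (Fin 2) A) :
    Matrix (Fin 2 × Fin 2) (Fin 2 × Fin 2) A :=
  leg2 N * scal (rMat21 q) * leg1 M * scal (rMat21 q)⁻¹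

/-- The quantum determinant `ad - q² bc` of the matrix with rows `(a, b)` and `(c, d)`. -/
def qdet (q : ℂ) (M : Matrix (Fin 2) (Fin 2) A) : A :=
  M 0 0 * M 1 1 - q ^ 2 • (M 0 1 * M 1 0)

end

/-- The defining relations of `O_q⁺(GL₂)`: the entries of `R₂₁ L₁ R L₂ = L₂ R₂₁ L₁ R`. -/
inductive OqRel (q : ℂ) :
    FreeAlgebra ℂ (Fin 2 × Fin 2) → FreeAlgebra ℂ (Fin 2 × Fin 2) → Prop
  | refl (i j : Fin 2 × Fin 2) :
      OqRel q (reflL q (Matrix.of fun s t => FreeAlgebra.ι ℂ (s, t))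
          (Matrix.of fun s t => FreeAlgebra.ι ℂ (s, t)) i j)
        (reflR q (Matrix.of fun s t => FreeAlgebra.ι ℂ (s, t))
          (Matrix.of fun s t => FreeAlgebra.ι ℂ (s, t)) i j)

/-- The algebra `O_q⁺(GL₂)`. -/
def OqPlus (q : ℂ) : Type := RingQuot (OqRel q)

noncomputable instance (q : ℂ) : Ring (OqPlus q) := inferInstanceAs (Ring (RingQuot (OqRel q)))

noncomputable instance (q : ℂ) : Algebra ℂ (OqPlus q) :=
  inferInstanceAs (Algebra ℂ (RingQuot (OqRel q)))

/-- The matrix `L` of generators of `O_q⁺(GL₂)`. -/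
noncomputable def OqPlus.L (q : ℂ) : Matrix (Fin 2) (Fin 2) (OqPlus q) :=
  Matrix.of fun i j => RingQuot.mkAlgHom ℂ (OqRel q) (FreeAlgebra.ι ℂ (i, j))

/-- The reflection equation algebra `O_q(GL₂)`, the localization of `O_q⁺(GL₂)` at the quantum
determinant. -/
abbrev OqGL2 (q : ℂ) : Type := LocAt (OqPlus q) (qdet q (OqPlus.L q))

/-- The matrix `L` with rows `(a, b)` and `(c, d)`, over `O_q(GL₂)`. -/
noncomputable def OqGL2.L (q : ℂ) : Matrix (Fin 2) (Fin 2) (OqGL2 q) :=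
  (OqPlus.L q).map (LocAt.of _)

/-- The element `det_q⁻¹` of `O_q(GL₂)`. -/
noncomputable def OqGL2.detInv (q : ℂ) : OqGL2 q := LocAt.inv _

/-- The algebra `O_q(BB⁻) = O_q(GL₂)[d⁻¹]`. -/
abbrev OqBB (q : ℂ) : Type := LocAt (OqGL2 q) (OqGL2.L q 1 1)

/-- The canonical map `O_q(GL₂) → O_q(BB⁻)`. -/
noncomputable def OqBB.of (q : ℂ) : OqGL2 q →ₐ[ℂ] OqBB q := LocAt.of _

/-- The element `d⁻¹` of `O_q(BB⁻)`. -/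
noncomputable def OqBB.dInv (q : ℂ) : OqBB q := LocAt.inv _

/-- Index set of the generators of `D_q⁺(GL₂)`: `Sum.inl (i, j)` stands for `x_{ij}` and
`Sum.inr (i, j)` for `∂_{ij}`. -/
abbrev DqGen : Type := (Fin 2 × Fin 2) ⊕ (Fin 2 × Fin 2)

/-- The matrix `X` over the free algebra. -/
noncomputable def freeX : Matrix (Fin 2) (Fin 2) (FreeAlgebra ℂ DqGen) :=
  Matrix.of fun i j => FreeAlgebra.ι ℂ (Sum.inl (i, j))

/-- The matrix `D` over the free algebra. -/
noncomputable def freeD : Matrix (Fin 2) (Fin 2) (FreeAlgebra ℂ DqGen) :=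
  Matrix.of fun i j => FreeAlgebra.ι ℂ (Sum.inr (i, j))

/-- The defining relations of `D_q⁺(GL₂)`: the entries of `R₂₁ X₁ R X₂ = X₂ R₂₁ X₁ R`,
`R₂₁ D₁ R D₂ = D₂ R₂₁ D₁ R` and `R₂₁ D₁ R X₂ = X₂ R₂₁ D₁ R₂₁⁻¹`. -/
inductive DqRel (q : ℂ) : FreeAlgebra ℂ DqGen → FreeAlgebra ℂ DqGen → Prop
  | xx (i j : Fin 2 × Fin 2) : DqRel q (reflL q freeX freeX i j) (reflR q freeX freeX i j)
  | dd (i j : Fin 2 × Fin 2) : DqRel q (reflL q freeD freeD i j) (reflR q freeD freeD i j)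
  | dx (i j : Fin 2 × Fin 2) : DqRel q (reflL q freeD freeX i j) (crossR q freeD freeX i j)

/-- The algebra `D_q⁺(GL₂)`. -/
def DqPlus (q : ℂ) : Type := RingQuot (DqRel q)

noncomputable instance (q : ℂ) : Ring (DqPlus q) := inferInstanceAs (Ring (RingQuot (DqRel q)))

noncomputable instance (q : ℂ) : Algebra ℂ (DqPlus q) :=
  inferInstanceAs (Algebra ℂ (RingQuot (DqRel q)))

/-- The matrix `X` over `D_q⁺(GL₂)`. -/
noncomputable def DqPlus.X (q : ℂ) : Matrix (Fin 2) (Fin 2) (DqPlus q) :=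
  freeX.map (RingQuot.mkAlgHom ℂ (DqRel q))

/-- The matrix `D` over `D_q⁺(GL₂)`. -/
noncomputable def DqPlus.D (q : ℂ) : Matrix (Fin 2) (Fin 2) (DqPlus q) :=
  freeD.map (RingQuot.mkAlgHom ℂ (DqRel q))

/-- The algebra `D_q(GL₂)`, the localization of `D_q⁺(GL₂)` at `det_q(X) det_q(D)`. -/
abbrev DqGL2 (q : ℂ) : Type :=
  LocAt (DqPlus q) (qdet q (DqPlus.X q) * qdet q (DqPlus.D q))

/-- The matrix `X` over `D_q(GL₂)`. -/
noncomputable def DqGL2.X (q : ℂ) : Matrix (Fin 2) (Fin 2) (DqGL2 q) :=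
  (DqPlus.X q).map (LocAt.of _)

/-- The matrix `D` over `D_q(GL₂)`. -/
noncomputable def DqGL2.D (q : ℂ) : Matrix (Fin 2) (Fin 2) (DqGL2 q) :=
  (DqPlus.D q).map (LocAt.of _)

/-- The element `(det_q(X) det_q(D))⁻¹` of `D_q(GL₂)`. -/
noncomputable def DqGL2.detInv (q : ℂ) : DqGL2 q := LocAt.inv _

/-! ### The `ℓ`-th power subalgebras -/

section
variable {A : Type} [Ring A] [Algebra ℂ A]

/-- `z` is a central element with `det_q(M)^ℓ = z d^ℓ - b^ℓ c^ℓ`, where `M` has rows `(a, b)` and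
`(c, d)`. -/
def IsFrobCorner (q : ℂ) (ℓ : ℕ) (M : Matrix (Fin 2) (Fin 2) A) (z : A) : Prop :=
  z ∈ Subalgebra.center ℂ A ∧
    qdet q M ^ ℓ = z * M 1 1 ^ ℓ - M 0 1 ^ ℓ * M 1 0 ^ ℓ

/-- The matrix `M^{(ℓ)}` with rows `(z, b^ℓ)` and `(c^ℓ, d^ℓ)`. -/
def frobMat (ℓ : ℕ) (M : Matrix (Fin 2) (Fin 2) A) (z : A) : Matrix (Fin 2) (Fin 2) A :=
  !![z, M 0 1 ^ ℓ; M 1 0 ^ ℓ, M 1 1 ^ ℓ]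

end

/-- The subalgebra of `O_q(GL₂)` generated by `z, b^ℓ, c^ℓ, d^ℓ` and `det_q^{-ℓ}`. -/
noncomputable def OqEll (q : ℂ) (ℓ : ℕ) (z : OqGL2 q) : Subalgebra ℂ (OqGL2 q) :=
  Algebra.adjoin ℂ
    (Set.range (fun p : Fin 2 × Fin 2 => frobMat ℓ (OqGL2.L q) z p.1 p.2) ∪
      {OqGL2.detInv q ^ ℓ})

/-- The subalgebra of `O_q(BB⁻)` generated by the image of `OqEll q ℓ z` and `d^{-ℓ}`. -/
noncomputable def OqEllBB (q : ℂ) (ℓ : ℕ) (z : OqGL2 q) : Subalgebra ℂ (OqBB q) :=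
  Algebra.adjoin ℂ
    (((OqEll q ℓ z).map (OqBB.of q) : Set (OqBB q)) ∪ {OqBB.dInv q ^ ℓ})

/-- The subalgebra of `D_q(GL₂)` generated by `v, x₁₂^ℓ, x₂₁^ℓ, x₂₂^ℓ, w, ∂₁₂^ℓ, ∂₂₁^ℓ, ∂₂₂^ℓ`
and `(det_q(X) det_q(D))^{-ℓ}`. -/
noncomputable def DqEll (q : ℂ) (ℓ : ℕ) (v w : DqGL2 q) : Subalgebra ℂ (DqGL2 q) :=
  Algebra.adjoin ℂ
    (Set.range (fun p : Fin 2 × Fin 2 => frobMat ℓ (DqGL2.X q) v p.1 p.2) ∪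
      Set.range (fun p : Fin 2 × Fin 2 => frobMat ℓ (DqGL2.D q) w p.1 p.2) ∪
      {DqGL2.detInv q ^ ℓ})

/-! ### Coordinate algebras of the classical varieties -/

/-- The algebra of regular functions on a set `V` of points that is placed in affine space by
coordinates `x`: the functions that are, near each point (in the Zariski topology), a quotient of
two polynomials in the coordinates. -/
def regularFunctions {σ V : Type} (x : V → σ → ℂ) : Subalgebra ℂ (V → ℂ) where
  carrier := {f | ∀ p : V, ∃ g h : MvPolynomial σ ℂ, MvPolynomial.eval (x p) h ≠ 0 ∧
    ∀ p' : V, MvPolynomial.eval (x p') h ≠ 0 →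
      f p' = MvPolynomial.eval (x p') g / MvPolynomial.eval (x p') h}
  mul_mem' := by
    intro f₁ f₂ h₁ h₂ p
    obtain ⟨g₁, k₁, hp₁, e₁⟩ := h₁ p
    obtain ⟨g₂, k₂, hp₂, e₂⟩ := h₂ p
    refine ⟨g₁ * g₂, k₁ * k₂, by rw [map_mul]; exact mul_ne_zero hp₁ hp₂, fun p' hp' => ?_⟩
    rw [map_mul] at hp'
    rw [Pi.mul_apply, e₁ p' (left_ne_zero_of_mul hp'), e₂ p' (right_ne_zero_of_mul hp'),
      map_mul, map_mul, div_mul_div_comm]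
  add_mem' := by
    intro f₁ f₂ h₁ h₂ p
    obtain ⟨g₁, k₁, hp₁, e₁⟩ := h₁ p
    obtain ⟨g₂, k₂, hp₂, e₂⟩ := h₂ p
    refine ⟨g₁ * k₂ + k₁ * g₂, k₁ * k₂, by rw [map_mul]; exact mul_ne_zero hp₁ hp₂,
      fun p' hp' => ?_⟩
    rw [map_mul] at hp'
    have n₁ := left_ne_zero_of_mul hp'
    have n₂ := right_ne_zero_of_mul hp'
    rw [Pi.add_apply, e₁ p' n₁, e₂ p' n₂, map_add, map_mul, map_mul, map_mul,
      div_add_div _ _ n₁ n₂]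
  algebraMap_mem' := by
    intro r p
    refine ⟨MvPolynomial.C r, 1, by simp, fun p' _ => ?_⟩
    simp

/-- The coordinate functions, as regular functions. -/
def coordFn {σ V : Type} (x : V → σ → ℂ) (s : σ) : regularFunctions x :=
  ⟨fun p => x p s, fun _ => ⟨MvPolynomial.X s, 1, by simp, fun p' _ => by simp⟩⟩

/-- The matrix entries as coordinates on `GL₂(ℂ)`. -/
def glCoord (g : GL (Fin 2) ℂ) : Fin 2 × Fin 2 → ℂ := fun p => (g : Matrix (Fin 2) (Fin 2) ℂ) p.1 p.2

/-- The Borel subgroup `B` of upper triangular matrices. -/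
def borelUp : Set (GL (Fin 2) ℂ) := {g | (g : Matrix (Fin 2) (Fin 2) ℂ) 1 0 = 0}

/-- The opposite Borel subgroup `B⁻` of lower triangular matrices. -/
def borelLow : Set (GL (Fin 2) ℂ) := {g | (g : Matrix (Fin 2) (Fin 2) ℂ) 0 1 = 0}

/-- The matrix entries as coordinates on the big Bruhat cell `BB⁻`, the set of all products of an
element of `B` with an element of `B⁻`. -/
def bbCoord (g : ↥(borelUp * borelLow)) : Fin 2 × Fin 2 → ℂ := glCoord g

/-- The matrix entries as coordinates on `GL₂(ℂ) × GL₂(ℂ)`. -/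
def glglCoord (g : GL (Fin 2) ℂ × GL (Fin 2) ℂ) : (Fin 2 × Fin 2) ⊕ (Fin 2 × Fin 2) → ℂ :=
  Sum.elim (glCoord g.1) (glCoord g.2)

/-! ### Regular functions on a principal open subset of affine space -/

section Geometry
open MvPolynomial

variable {σ V : Type}

/-! Put s = q². Since ℓ is odd, s is again a primitive ℓ-th root of unity, and the matrix equations
amount to rules for reordering the entries in which only s occurs (`reflL_eq_reflR_iff`,
`reflL_eq_crossR_iff`).

In the reflection equation algebra t = a + s⁻¹d and det_q are central and bc = s⁻¹(td − det_q −
s⁻¹d²). So O_q⁺(GL₂) is spanned by products of a power of b or of c with a monomial in t, det_q, d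
(`normalForm_range_eq_top`). On complex sequences there are representations in which b is the shift,
d is diagonal with entries sⁿd, and t and det_q are scalars; applied to the vector supported at 0
they separate these products, so they are jointly faithful (`OqGL2.eq_zero_of_rep`). Identities and
centrality become computations with weighted shifts. The ℓ-th powers of b, c, d are shifts by
multiples of ℓ with constant weight, and they commute with the generators, whose weights are
ℓ-periodic. The weight of c^ℓ is a product of a quadratic −s⁻²(u − y)(v − y) over the orbit of y
under s, namely (u^ℓ + v^ℓ − d^ℓ)d^ℓ − det_q^ℓ (`prod_bcVal`). This is the determinant identity with
z = u^ℓ + v^ℓ − d^ℓ, where u^ℓ + v^ℓ is a polynomial in u + v = st and uv = s det_q. Uniqueness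
holds because d^ℓ is not a zero divisor.

By the Nullstellensatz the coordinate rings are polynomial rings with one element inverted
(`exists_regularFunctions_algEquiv`), so an isomorphism only needs the central entries to be
algebraically independent. For a generic matrix x, suitable parameters and a geometric sequence give
a common eigenvector on which the central entries take the values x (`OqGL2.exists_functional`).

For D_q(GL₂), the cross relations say that the entries of D pass an element of O_q(GL₂) through an
algebra homomorphism into 4 × 4 matrices (`OqGL2.crossHom`). This yields an action on O_q(GL₂) ⊗
O_q(GL₂), and evaluating it at 1 ⊗ 1 inverts the multiplication map: D_q(GL₂) is O_q(GL₂) ⊗ O_q(GL₂)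
as a vector space (`DqGL2.mulEquiv`). Explicit powers of the 4 × 4 matrices become diagonal at
exponent ℓ, so the ℓ-th powers from X commute with D; passing to the opposite algebra exchanges X
and D. The corner elements follow from the determinant identity by cancelling x₂₂^ℓ or ∂₂₂^ℓ, and
algebraic independence follows by tensoring the functionals of the first half. -/

theorem exists_pow_mul_eq_of_mem_regularFunctions [Finite σ] {x : V → σ → ℂ}
    {Δ : MvPolynomial σ ℂ} (hx : ∀ a : σ → ℂ, eval a Δ ≠ 0 → ∃ p, x p = a)
    {f : V → ℂ} (hf : f ∈ regularFunctions x) :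
    ∃ (n : ℕ) (g : MvPolynomial σ ℂ), ∀ p, f p * eval (x p) Δ ^ n = eval (x p) g := by
  -- The ideal of denominators of f; the claim is that a power of Δ lies in it, which the
  -- Nullstellensatz gives once Δ vanishes on its zero locus.
  let I : Ideal (MvPolynomial σ ℂ) :=
    { carrier := {h | ∃ g : MvPolynomial σ ℂ, ∀ p, f p * eval (x p) h = eval (x p) g}
      zero_mem' := ⟨0, fun p => by simp⟩
      add_mem' := by
        rintro h₁ h₂ ⟨g₁, e₁⟩ ⟨g₂, e₂⟩
        exact ⟨g₁ + g₂, fun p => by rw [map_add, map_add, mul_add, e₁, e₂]⟩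
      smul_mem' := by
        rintro c h ⟨g, e⟩
        exact ⟨c * g, fun p => by rw [smul_eq_mul, map_mul, map_mul, mul_left_comm, e]⟩ }
  have hI : Δ ∈ vanishingIdeal ℂ (zeroLocus ℂ I) := by
    rw [mem_vanishingIdeal_iff]
    intro a ha
    by_contra hne
    obtain ⟨p, rfl⟩ := hx a (by simpa [aeval_eq_eval] using hne)
    obtain ⟨g, h, hp, e⟩ := hf p
    -- The square is needed: f h = g is known only where h is nonzero, whereas f h² = g h holds at
    -- every point.
    have hmem : h * h ∈ I := by
      refine ⟨g * h, fun p' => ?_⟩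
      rw [map_mul, map_mul]
      by_cases h0 : eval (x p') h = 0
      · rw [h0]; ring
      · rw [e p' h0]; field_simp
    have := ha _ hmem
    simp only [aeval_eq_eval, map_mul, mul_self_eq_zero] at this
    exact hp this
  rw [vanishingIdeal_zeroLocus_eq_radical] at hI
  obtain ⟨n, g, e⟩ := hI
  exact ⟨n, g, fun p => by rw [← map_pow, e]⟩

theorem aeval_coordFn_apply (x : V → σ → ℂ) (g : MvPolynomial σ ℂ) (p : V) :
    (aeval (coordFn x) g : regularFunctions x).1 p = eval (x p) g := by
  induction g using MvPolynomial.induction_on with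
  | C a => rw [MvPolynomial.aeval_C, eval_C]; rfl
  | add f g hf hg => rw [map_add, map_add, ← hf, ← hg]; rfl
  | mul_X f s hf => rw [map_mul, map_mul, ← hf, aeval_X, eval_X]; rfl

/-- The inverse of a polynomial without zeros, as a regular function. -/
noncomputable def invFn (x : V → σ → ℂ) (Δ : MvPolynomial σ ℂ) (hΔ : ∀ p, eval (x p) Δ ≠ 0) :
    regularFunctions x :=
  ⟨fun p => (eval (x p) Δ)⁻¹, fun p => ⟨1, Δ, hΔ p, fun p' _ => by simp⟩⟩

/-- Regular functions on a principal open subset of affine space form a localization of the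
polynomial ring, so they are identified with any faithful realization of it. -/
theorem exists_regularFunctions_algEquiv [Finite σ] {x : V → σ → ℂ} {Δ : MvPolynomial σ ℂ}
    (hx : ∀ a : σ → ℂ, eval a Δ ≠ 0 → ∃ p, x p = a) (hΔ : ∀ p, eval (x p) Δ ≠ 0)
    {A : Type} [Ring A] [Algebra ℂ A] (y : σ → Subalgebra.center ℂ A)
    (u : Subalgebra.center ℂ A) (hu : aeval y Δ * u = 1)
    (hy : Function.Injective (aeval (R := ℂ) y)) (S : Subalgebra ℂ A)
    (hS : S = Algebra.adjoin ℂ (Set.range (fun s => (y s : A)) ∪ {(u : A)})) :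
    (∃ Φ : regularFunctions x ≃ₐ[ℂ] S, ∀ s, (Φ (coordFn x s) : A) = y s) ∧
      ∀ w ∈ S, ∃ (n : ℕ) (g : MvPolynomial σ ℂ), w = (aeval y g : Subalgebra.center ℂ A) * u ^ n := by
  let π : MvPolynomial σ ℂ →ₐ[ℂ] regularFunctions x := aeval (coordFn x)
  let _ : Algebra (MvPolynomial σ ℂ) (regularFunctions x) := π.toRingHom.toAlgebra
  have hπΔ : π Δ * invFn x Δ hΔ = 1 := by
    ext p
    change (π Δ).1 p * (eval (x p) Δ)⁻¹ = 1
    rw [aeval_coordFn_apply, mul_inv_cancel₀ (hΔ p)]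
  have hpow : ∀ f : regularFunctions x, ∃ (n : ℕ) (g : MvPolynomial σ ℂ), f * π Δ ^ n = π g := by
    intro f
    obtain ⟨n, g, e⟩ := exists_pow_mul_eq_of_mem_regularFunctions hx f.2
    refine ⟨n, g, ?_⟩
    ext p
    change f.1 p * (π Δ ^ n).1 p = (π g).1 p
    rw [← map_pow, aeval_coordFn_apply, aeval_coordFn_apply, map_pow, e]
  have hinj : Function.Injective π := by
    rw [injective_iff_map_eq_zero]
    intro g hg
    have hz : ∀ a, eval a (g * Δ) = 0 := by
      intro a
      by_cases ha : eval a Δ = 0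
      · rw [map_mul, ha, mul_zero]
      · obtain ⟨p, rfl⟩ := hx a ha
        rw [map_mul, ← aeval_coordFn_apply, show (aeval (coordFn x)) g = 0 from hg]
        exact zero_mul _
    have h0 : g * Δ = 0 := MvPolynomial.funext fun a => by rw [hz, map_zero]
    rcases mul_eq_zero.mp h0 with h | h
    · exact h
    -- If Δ were zero, `hu` would read 0 = 1 in the center, against the injectivity of evaluation at
    -- `y`.
    · exfalso
      rw [h, map_zero, zero_mul] at hu
      have := hy (a₁ := 1) (a₂ := 0) (by rw [map_one, map_zero, hu])
      exact one_ne_zero this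
  have : IsLocalization.Away Δ (regularFunctions x) := by
    refine IsLocalization.Away.mk (S := regularFunctions x) Δ ?_ ?_ ?_
    · exact IsUnit.of_mul_eq_one _ hπΔ
    · intro f
      obtain ⟨n, g, e⟩ := hpow f
      exact ⟨n, g, e⟩
    · intro a b hab
      exact ⟨0, by rw [hinj hab]⟩
  have hunit : IsUnit ((aeval (R := ℂ) y).toRingHom Δ) := IsUnit.of_mul_eq_one _ hu
  let L₀ : regularFunctions x →+* Subalgebra.center ℂ A := IsLocalization.Away.lift Δ hunit
  have hL₀ : ∀ g, L₀ (π g) = aeval y g := fun g => IsLocalization.Away.lift_eq Δ hunit g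
  let L : regularFunctions x →ₐ[ℂ] Subalgebra.center ℂ A :=
    { L₀ with
      commutes' := fun r => by
        have h1 := hL₀ (MvPolynomial.C r)
        rw [MvPolynomial.aeval_C, MvPolynomial.aeval_C] at h1
        exact h1 }
  have hL : ∀ g, L (π g) = aeval y g := hL₀
  have hLu : L (invFn x Δ hΔ) = u := by
    have h1 : aeval y Δ * L (invFn x Δ hΔ) = 1 := by rw [← hL, ← map_mul, hπΔ, map_one]
    calc L (invFn x Δ hΔ) = (aeval y Δ * u) * L (invFn x Δ hΔ) := by rw [hu, one_mul]
      _ = u * (aeval y Δ * L (invFn x Δ hΔ)) := by ring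
      _ = u := by rw [h1, mul_one]
  have hform : ∀ f, ∃ (n : ℕ) (g : MvPolynomial σ ℂ), L f = aeval y g * u ^ n := by
    intro f
    obtain ⟨n, g, e⟩ := hpow f
    refine ⟨n, g, ?_⟩
    rw [← hL, ← e, map_mul, map_pow, hL, mul_assoc, ← mul_pow, hu, one_pow, mul_one]
  let Φ : regularFunctions x →ₐ[ℂ] A := (Subalgebra.center ℂ A).val.comp L
  have hΦinj : Function.Injective Φ := by
    rw [injective_iff_map_eq_zero]
    intro f hf
    have hf : L f = 0 := Subtype.ext hf
    obtain ⟨n, g, e⟩ := hpow f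
    have h1 : aeval y g = 0 := by rw [← hL, ← e, map_mul, hf, zero_mul]
    have h2 : g = 0 := hy (by rw [h1, map_zero])
    calc f = f * (π Δ * invFn x Δ hΔ) ^ n := by rw [hπΔ, one_pow, mul_one]
      _ = f * π Δ ^ n * invFn x Δ hΔ ^ n := by rw [mul_pow, mul_assoc]
      _ = 0 := by rw [e, h2, map_zero, zero_mul]
  have hcoord : ∀ s, Φ (coordFn x s) = y s := by
    intro s
    have h1 := hL (MvPolynomial.X s)
    rw [aeval_X, aeval_X] at h1
    exact congrArg Subtype.val h1
  have hpoly : ∀ g : MvPolynomial σ ℂ, ((aeval y g : Subalgebra.center ℂ A) : A) ∈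
      Algebra.adjoin ℂ (Set.range (fun s => (y s : A)) ∪ {(u : A)}) := by
    intro g
    induction g using MvPolynomial.induction_on with
    | C a => rw [MvPolynomial.aeval_C]; exact Subalgebra.algebraMap_mem _ a
    | add f g hf hg => rw [map_add]; exact add_mem hf hg
    | mul_X f s hf =>
      rw [map_mul, aeval_X]
      exact mul_mem hf (Algebra.subset_adjoin (Or.inl ⟨s, rfl⟩))
  have hrange : Φ.range = S := by
    rw [hS]
    apply le_antisymm
    · rintro _ ⟨f, rfl⟩
      obtain ⟨n, g, e⟩ := hform f
      have hf : Φ f = ((aeval y g : Subalgebra.center ℂ A) : A) * (u : A) ^ n :=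
        congrArg Subtype.val e
      have hmem : (u : A) ∈ Algebra.adjoin ℂ (Set.range (fun s => (y s : A)) ∪ {(u : A)}) :=
        Algebra.subset_adjoin (by simp)
      rw [AlgHom.toRingHom_eq_coe, RingHom.coe_coe, hf]
      exact mul_mem (hpoly g) (pow_mem hmem n)
    · rw [Algebra.adjoin_le_iff]
      rintro _ (⟨s, rfl⟩ | h)
      · exact ⟨coordFn x s, hcoord s⟩
      · rw [Set.mem_singleton_iff] at h
        rw [h]
        exact ⟨invFn x Δ hΔ, congrArg Subtype.val hLu⟩
  refine ⟨⟨(AlgEquiv.ofInjective Φ hΦinj).trans (Subalgebra.equivOfEq _ _ hrange), hcoord⟩, ?_⟩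
  intro w hw
  rw [← hrange] at hw
  obtain ⟨f, rfl⟩ := hw
  obtain ⟨n, g, e⟩ := hform f
  exact ⟨n, g, congrArg Subtype.val e⟩

end Geometry

/-! ### The three varieties as principal open sets of matrices -/

section Coordinates
open MvPolynomial

/-- The determinant of the generic `2 × 2` matrix. -/
noncomputable def detPoly : MvPolynomial (Fin 2 × Fin 2) ℂ :=
  X (0, 0) * X (1, 1) - X (0, 1) * X (1, 0)

theorem eval_detPoly (a : Fin 2 × Fin 2 → ℂ) :
    eval a detPoly = a (0, 0) * a (1, 1) - a (0, 1) * a (1, 0) := by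
  simp [detPoly]

theorem eval_detPoly_eq_det (a : Fin 2 × Fin 2 → ℂ) :
    eval a detPoly = (Matrix.of fun i j => a (i, j)).det := by
  rw [eval_detPoly, Matrix.det_fin_two]; rfl

theorem eval_glCoord_ne_zero (g : GL (Fin 2) ℂ) : eval (glCoord g) detPoly ≠ 0 := by
  rw [eval_detPoly_eq_det]
  exact (Matrix.isUnit_iff_isUnit_det _).mp g.isUnit |>.ne_zero

theorem exists_glCoord_eq (a : Fin 2 × Fin 2 → ℂ) (ha : eval a detPoly ≠ 0) :
    ∃ g, glCoord g = a := by
  rw [eval_detPoly_eq_det] at ha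
  exact ⟨Matrix.GeneralLinearGroup.mkOfDetNeZero _ ha, rfl⟩

/-- The lower right entry of a product in BB⁻ is the product of the two lower right entries. This
makes the big cell the principal open set det · x₂₂ ≠ 0. -/
theorem mem_borelUp_mul_borelLow (g : GL (Fin 2) ℂ) :
    g ∈ borelUp * borelLow ↔ (g : Matrix (Fin 2) (Fin 2) ℂ) 1 1 ≠ 0 := by
  constructor
  · rintro ⟨u, hu, w, hw, rfl⟩
    have hu0 : (u : Matrix (Fin 2) (Fin 2) ℂ) 1 0 = 0 := hu
    have hw0 : (w : Matrix (Fin 2) (Fin 2) ℂ) 0 1 = 0 := hw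
    have hu1 := (Matrix.isUnit_iff_isUnit_det _).mp u.isUnit |>.ne_zero
    have hw1 := (Matrix.isUnit_iff_isUnit_det _).mp w.isUnit |>.ne_zero
    rw [Matrix.det_fin_two, hu0, mul_zero, sub_zero] at hu1
    rw [Matrix.det_fin_two, hw0, zero_mul, sub_zero] at hw1
    simp only [Units.val_mul, Matrix.mul_apply, Fin.sum_univ_two, hu0, hw0, zero_mul, zero_add]
    exact mul_ne_zero (right_ne_zero_of_mul hu1) (right_ne_zero_of_mul hw1)
  · intro h
    -- The lower factor w shares its second row with g, so the second row of g w⁻¹ is (0, 1).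
    have hw : (!![1, 0; (g : Matrix (Fin 2) (Fin 2) ℂ) 1 0, (g : Matrix (Fin 2) (Fin 2) ℂ) 1 1] :
        Matrix (Fin 2) (Fin 2) ℂ).det ≠ 0 := by
      rw [Matrix.det_fin_two_of]; simpa using h
    refine ⟨g * (Matrix.GeneralLinearGroup.mkOfDetNeZero _ hw)⁻¹, ?_,
      Matrix.GeneralLinearGroup.mkOfDetNeZero _ hw, ?_, inv_mul_cancel_right _ _⟩
    · set w := Matrix.GeneralLinearGroup.mkOfDetNeZero _ hw with hwdef
      have e : (g * w⁻¹) * w = g := inv_mul_cancel_right _ _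
      have e1 := congrArg (fun m : GL (Fin 2) ℂ => (m : Matrix (Fin 2) (Fin 2) ℂ) 1 1) e
      have e0 := congrArg (fun m : GL (Fin 2) ℂ => (m : Matrix (Fin 2) (Fin 2) ℂ) 1 0) e
      have hwv : (w : Matrix (Fin 2) (Fin 2) ℂ) = !![1, 0;
        (g : Matrix (Fin 2) (Fin 2) ℂ) 1 0, (g : Matrix (Fin 2) (Fin 2) ℂ) 1 1] := rfl
      rw [Units.val_mul, Matrix.mul_apply, Fin.sum_univ_two, hwv] at e1 e0
      simp only [Matrix.of_apply, Matrix.cons_val', Matrix.cons_val_zero, Matrix.cons_val_one,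
        Matrix.cons_val_fin_one, mul_zero, zero_add, mul_one] at e1 e0
      have h1 : ((g * w⁻¹ : GL (Fin 2) ℂ) : Matrix (Fin 2) (Fin 2) ℂ) 1 1 = 1 :=
        mul_right_cancel₀ h (by rw [e1, one_mul])
      rw [h1, one_mul] at e0
      change ((g * w⁻¹ : GL (Fin 2) ℂ) : Matrix (Fin 2) (Fin 2) ℂ) 1 0 = 0
      linear_combination e0
    · rfl

theorem eval_bbCoord_ne_zero (g : ↥(borelUp * borelLow)) :
    eval (bbCoord g) (detPoly * X (1, 1)) ≠ 0 := by
  rw [map_mul, eval_X]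
  exact mul_ne_zero (eval_glCoord_ne_zero g.1) ((mem_borelUp_mul_borelLow g.1).mp g.2)

theorem exists_bbCoord_eq (a : Fin 2 × Fin 2 → ℂ) (ha : eval a (detPoly * X (1, 1)) ≠ 0) :
    ∃ g, bbCoord g = a := by
  rw [map_mul, eval_X] at ha
  obtain ⟨g, rfl⟩ := exists_glCoord_eq a (left_ne_zero_of_mul ha)
  exact ⟨⟨g, (mem_borelUp_mul_borelLow g).mpr (right_ne_zero_of_mul ha)⟩, rfl⟩

theorem eval_glglCoord_ne_zero (g : GL (Fin 2) ℂ × GL (Fin 2) ℂ) :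
    eval (glglCoord g) (rename Sum.inl detPoly * rename Sum.inr detPoly) ≠ 0 := by
  rw [map_mul, eval_rename, eval_rename]
  exact mul_ne_zero (eval_glCoord_ne_zero g.1) (eval_glCoord_ne_zero g.2)

theorem exists_glglCoord_eq (a : (Fin 2 × Fin 2) ⊕ (Fin 2 × Fin 2) → ℂ)
    (ha : eval a (rename Sum.inl detPoly * rename Sum.inr detPoly) ≠ 0) :
    ∃ g, glglCoord g = a := by
  rw [map_mul, eval_rename, eval_rename] at ha
  obtain ⟨g, hg⟩ := exists_glCoord_eq _ (left_ne_zero_of_mul ha)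
  obtain ⟨h, hh⟩ := exists_glCoord_eq _ (right_ne_zero_of_mul ha)
  refine ⟨(g, h), ?_⟩
  rw [glglCoord, hg, hh]
  exact Sum.elim_comp_inl_inr a

end Coordinates

/-! ### Generation, centers and fractions in a localization -/

namespace LocAt

variable {A : Type} [Ring A] [Algebra ℂ A] {s : A}

theorem adjoin_eq_top : Algebra.adjoin ℂ (Set.range (of s) ∪ {inv s}) = ⊤ := by
  rw [eq_top_iff]
  have h1 : (mk s).range = ⊤ := by
    rw [AlgHom.range_eq_top]
    exact RingQuot.mkAlgHom_surjective ℂ _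
  rw [← h1, ← Algebra.map_top, ← FreeAlgebra.adjoin_range_ι, AlgHom.map_adjoin,
    Algebra.adjoin_le_iff]
  rintro _ ⟨_, ⟨o, rfl⟩, rfl⟩
  cases o with
  | some a => exact Algebra.subset_adjoin (Or.inl ⟨a, rfl⟩)
  | none => exact Algebra.subset_adjoin (Or.inr rfl)

/-- An induction principle for subalgebras of `A[s⁻¹]`. -/
theorem subalgebra_eq_top (S : Subalgebra ℂ (LocAt A s)) (h : ∀ a, of s a ∈ S)
    (hi : inv s ∈ S) : S = ⊤ := by
  rw [eq_top_iff, ← adjoin_eq_top, Algebra.adjoin_le_iff]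
  rintro _ (⟨a, rfl⟩ | rfl)
  · exact h a
  · exact hi

variable {B : Type} [Ring B] [Algebra ℂ B]

/-- The homomorphism out of the localization given by its universal property. -/
noncomputable def lift (f : A →ₐ[ℂ] B) (hf : IsUnit (f s)) : LocAt A s →ₐ[ℂ] B :=
  (existsUnique_lift s f hf).choose

@[simp] theorem lift_of (f : A →ₐ[ℂ] B) (hf : IsUnit (f s)) (a : A) :
    lift f hf (of s a) = f a :=
  DFunLike.congr_fun (existsUnique_lift s f hf).choose_spec.1 a

theorem isUnit_of : IsUnit (of s s) := ⟨⟨of s s, inv s, mul_inv s, inv_mul s⟩, rfl⟩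

/-- What commutes with the inverted element commutes with its inverse. -/
theorem commute_inv {y : LocAt A s} (h : Commute y (of s s)) : Commute y (inv s) := by
  have := Commute.units_inv_right (u := ⟨of s s, inv s, mul_inv s, inv_mul s⟩) h
  exact this

theorem mem_center {y : LocAt A s} (h : ∀ a, Commute y (of s a)) :
    y ∈ Subalgebra.center ℂ (LocAt A s) := by
  have h1 : Subalgebra.centralizer ℂ {y} = (⊤ : Subalgebra ℂ (LocAt A s)) := by
    apply subalgebra_eq_top
    · intro a
      rw [Subalgebra.mem_centralizer_iff]
      rintro _ rfl
      exact h a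
    · rw [Subalgebra.mem_centralizer_iff]
      rintro _ rfl
      exact commute_inv (h s)
  rw [Subalgebra.mem_center_iff]
  intro b
  have hb : b ∈ Subalgebra.centralizer ℂ {y} := h1 ▸ Algebra.mem_top
  rw [Subalgebra.mem_centralizer_iff] at hb
  exact (hb y rfl).symm

/-- Elements of the localization at a central element are fractions. -/
theorem exists_mul_pow_eq (hs : ∀ a, Commute s a) (y : LocAt A s) :
    ∃ (n : ℕ) (a : A), y * of s s ^ n = of s a := by
  have hc : ∀ y : LocAt A s, Commute y (of s s) := by
    intro y
    have : of s s ∈ Subalgebra.center ℂ (LocAt A s) :=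
      mem_center fun a => (hs a).map (of s)
    exact Subalgebra.mem_center_iff.mp this y
  let S : Subalgebra ℂ (LocAt A s) :=
    { carrier := {y | ∃ (n : ℕ) (a : A), y * of s s ^ n = of s a}
      mul_mem' := by
        rintro x y ⟨n, a, hx⟩ ⟨m, b, hy⟩
        refine ⟨n + m, a * b, ?_⟩
        rw [map_mul, ← hx, ← hy, pow_add, ((hc y).symm.pow_left n).symm.mul_mul_mul_comm]
      add_mem' := by
        rintro x y ⟨n, a, hx⟩ ⟨m, b, hy⟩
        refine ⟨n + m, a * s ^ m + b * s ^ n, ?_⟩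
        rw [map_add, map_mul, map_mul, map_pow, map_pow, ← hx, ← hy, add_mul, pow_add, mul_assoc,
          mul_assoc, ← pow_add, ← pow_add, add_comm m n]
      algebraMap_mem' := fun r => ⟨0, algebraMap ℂ A r, by simp⟩ }
  have hS : S = ⊤ := subalgebra_eq_top S (fun a => ⟨0, a, by simp⟩) ⟨1, 1, by
    rw [pow_one, inv_mul, map_one]⟩
  have : y ∈ S := hS ▸ Algebra.mem_top
  exact this

end LocAt

/-! ### From R-matrix equations to ordering relations -/

section Relations
set_option linter.unusedSimpArgs false
set_option linter.unusedSectionVars false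

/-- The relations of the reflection equation algebra among the entries of the matrix with rows
`(a, b)` and `(c, d)`; here `s = q²`. -/
structure ReaRel {A : Type*} [Ring A] [Algebra ℂ A] (s : ℂ) (a b c d : A) : Prop where
  db : d * b = s • (b * d)
  cd : c * d = s • (d * c)
  da : d * a = a * d
  ba : b * a = a * b + (1 - s⁻¹) • (b * d)
  ca : c * a = a * c - (1 - s⁻¹) • (d * c)
  cb : c * b = b * c + (1 - s⁻¹) • (a * d - d * d)

/-- The cross relations between the matrix `X` with rows `(a, b)`, `(c, d)` and the matrix `D` with
rows `(A, B)`, `(C, E)`; here `s = q²`. -/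
structure CrossRel {R : Type*} [Ring R] [Algebra ℂ R] (s : ℂ) (a b c d A B C E : R) : Prop where
  Ed : E * d = s⁻¹ • (d * E)
  Eb : E * b = b * E
  Ec : E * c = s⁻¹ • (c * E) + (s⁻¹ - 1) • (d * C)
  Ea : E * a = a * E + (1 - s) • (b * C)
  Cd : C * d = d * C
  Cc : C * c = s⁻¹ • (c * C)
  Cb : C * b = b * C - (s⁻¹ - s⁻¹ * s⁻¹) • (d * E)
  Ca : C * a = s⁻¹ • (a * C) - (s⁻¹ - s⁻¹ * s⁻¹) • (c * E) + ((1 - s⁻¹) * (1 - s⁻¹)) • (d * C)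
  Bb : B * b = s⁻¹ • (b * B)
  Bd : B * d = s⁻¹ • (d * B) + (s⁻¹ - 1) • (b * E)
  Ba : B * a = a * B + (s⁻¹ - 1) • (b * A) + (1 - s⁻¹) • (b * E)
  Bc : B * c = c * B + (s⁻¹ - 1) • (a * E) + (s⁻¹ - 1) • (d * A) + (1 - s⁻¹) • (d * E) +
    (s - 2 + s⁻¹) • (b * C)
  Ab : A * b = s⁻¹ • (b * A) - (s⁻¹ - s⁻¹ * s⁻¹) • (d * B) + ((1 - s⁻¹) * (1 - s⁻¹)) • (b * E)
  Ad : A * d = d * A + (1 - s) • (b * C)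
  Ac : A * c = c * A + (1 - s⁻¹) • (d * C) + (s⁻¹ - 1) • (a * C)
  Aa : A * a = s⁻¹ • (a * A) + (s⁻¹ - s⁻¹ * s⁻¹) • (b * C) - (1 - s⁻¹) • (B * c)

theorem rMat_apply (q : ℂ) (p p' : Fin 2 × Fin 2) :
    rMat q p p' = if p = p' then (if p.1 = p.2 then q else 1) else
      if p = (1, 0) ∧ p' = (0, 1) then q - q⁻¹ else 0 := by
  obtain ⟨i, j⟩ := p
  obtain ⟨k, l⟩ := p'
  fin_cases i <;> fin_cases j <;> fin_cases k <;> fin_cases l <;> rfl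

theorem rMat21_apply (q : ℂ) (p p' : Fin 2 × Fin 2) :
    rMat21 q p p' = if p = p' then (if p.1 = p.2 then q else 1) else
      if p = (0, 1) ∧ p' = (1, 0) then q - q⁻¹ else 0 := by
  obtain ⟨i, j⟩ := p
  obtain ⟨k, l⟩ := p'
  fin_cases i <;> fin_cases j <;> fin_cases k <;> fin_cases l <;> rfl

theorem rMat21_inv {q : ℂ} (hq : q ≠ 0) :
    (rMat21 q)⁻¹ = Matrix.of fun p p' => if p = p' then (if p.1 = p.2 then q⁻¹ else 1) else
      if p = (0, 1) ∧ p' = (1, 0) then q⁻¹ - q else 0 := by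
  apply Matrix.inv_eq_right_inv
  ext ⟨i, j⟩ ⟨k, l⟩
  rw [Matrix.mul_apply, Fintype.sum_prod_type]
  simp only [Fin.sum_univ_two, rMat21_apply, Matrix.of_apply]
  fin_cases i <;> fin_cases j <;> fin_cases k <;> fin_cases l <;> simp [hq]

variable {A : Type} [Ring A] [Algebra ℂ A]

theorem reflL_map {B : Type} [Ring B] [Algebra ℂ B] (f : A →ₐ[ℂ] B) (q : ℂ)
    (M N : Matrix (Fin 2) (Fin 2) A) : (reflL q M N).map f = reflL q (M.map f) (N.map f) := by
  have h1 : ∀ S, (scal S : Matrix _ _ A).map f = scal S := by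
    intro S; ext i j; simp [scal]
  have h2 : ∀ M : Matrix (Fin 2) (Fin 2) A, (leg1 M).map f = leg1 (M.map f) := by
    intro M; ext i j; simp [leg1, Matrix.kroneckerMap_apply, Matrix.one_apply, apply_ite f]
  have h3 : ∀ M : Matrix (Fin 2) (Fin 2) A, (leg2 M).map f = leg2 (M.map f) := by
    intro M; ext i j; simp [leg2, Matrix.kroneckerMap_apply, Matrix.one_apply, apply_ite f]
  simp only [reflL, Matrix.map_mul, h1, h2, h3]

theorem reflR_map {B : Type} [Ring B] [Algebra ℂ B] (f : A →ₐ[ℂ] B) (q : ℂ)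
    (M N : Matrix (Fin 2) (Fin 2) A) : (reflR q M N).map f = reflR q (M.map f) (N.map f) := by
  have h1 : ∀ S, (scal S : Matrix _ _ A).map f = scal S := by
    intro S; ext i j; simp [scal]
  have h2 : ∀ M : Matrix (Fin 2) (Fin 2) A, (leg1 M).map f = leg1 (M.map f) := by
    intro M; ext i j; simp [leg1, Matrix.kroneckerMap_apply, Matrix.one_apply, apply_ite f]
  have h3 : ∀ M : Matrix (Fin 2) (Fin 2) A, (leg2 M).map f = leg2 (M.map f) := by
    intro M; ext i j; simp [leg2, Matrix.kroneckerMap_apply, Matrix.one_apply, apply_ite f]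
  simp only [reflR, Matrix.map_mul, h1, h2, h3]

theorem crossR_map {B : Type} [Ring B] [Algebra ℂ B] (f : A →ₐ[ℂ] B) (q : ℂ)
    (M N : Matrix (Fin 2) (Fin 2) A) : (crossR q M N).map f = crossR q (M.map f) (N.map f) := by
  have h1 : ∀ S, (scal S : Matrix _ _ A).map f = scal S := by
    intro S; ext i j; simp [scal]
  have h2 : ∀ M : Matrix (Fin 2) (Fin 2) A, (leg1 M).map f = leg1 (M.map f) := by
    intro M; ext i j; simp [leg1, Matrix.kroneckerMap_apply, Matrix.one_apply, apply_ite f]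
  have h3 : ∀ M : Matrix (Fin 2) (Fin 2) A, (leg2 M).map f = leg2 (M.map f) := by
    intro M; ext i j; simp [leg2, Matrix.kroneckerMap_apply, Matrix.one_apply, apply_ite f]
  simp only [crossR, Matrix.map_mul, h1, h2, h3]

theorem scal_mul_apply (S : Matrix (Fin 2 × Fin 2) (Fin 2 × Fin 2) ℂ)
    (T : Matrix (Fin 2 × Fin 2) (Fin 2 × Fin 2) A) (p p' : Fin 2 × Fin 2) :
    ((scal S : Matrix _ _ A) * T) p p' = ∑ i, ∑ j, S p (i, j) • T (i, j) p' := by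
  simp [Matrix.mul_apply, Fintype.sum_prod_type, scal, Algebra.smul_def]

theorem mul_scal_apply (S : Matrix (Fin 2 × Fin 2) (Fin 2 × Fin 2) ℂ)
    (T : Matrix (Fin 2 × Fin 2) (Fin 2 × Fin 2) A) (p p' : Fin 2 × Fin 2) :
    (T * (scal S : Matrix _ _ A)) p p' = ∑ i, ∑ j, S (i, j) p' • T p (i, j) := by
  simp [Matrix.mul_apply, Fintype.sum_prod_type, scal, Algebra.smul_def, Algebra.commutes]

theorem mul_leg2_apply (M : Matrix (Fin 2) (Fin 2) A)
    (T : Matrix (Fin 2 × Fin 2) (Fin 2 × Fin 2) A) (p : Fin 2 × Fin 2) (k l : Fin 2) :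
    (T * leg2 M) p (k, l) = ∑ j, T p (k, j) * M j l := by
  fin_cases k <;> simp [Matrix.mul_apply, Fintype.sum_prod_type, leg2, Matrix.kroneckerMap_apply]

theorem leg2_mul_apply (M : Matrix (Fin 2) (Fin 2) A)
    (T : Matrix (Fin 2 × Fin 2) (Fin 2 × Fin 2) A) (p : Fin 2 × Fin 2) (k l : Fin 2) :
    (leg2 M * T) (k, l) p = ∑ j, M l j * T (k, j) p := by
  fin_cases k <;> simp [Matrix.mul_apply, Fintype.sum_prod_type, leg2, Matrix.kroneckerMap_apply]

theorem leg1_apply (M : Matrix (Fin 2) (Fin 2) A) (i j k l : Fin 2) :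
    leg1 M (i, j) (k, l) = if j = l then M i k else 0 := by
  simp [leg1, Matrix.kroneckerMap_apply, Matrix.one_apply]

/-- Six of the sixteen matrix entries already give the six ordering rules, up to scalars and, for
`cb`, a multiple of another entry. Conversely, sorting all products by these rules makes the sixteen
entries agree. -/
theorem reflL_eq_reflR_iff {q : ℂ} (hq : q ≠ 0) (M : Matrix (Fin 2) (Fin 2) A) :
    reflL q M M = reflR q M M ↔
      ReaRel (q ^ 2) (M 0 0) (M 0 1) (M 1 0) (M 1 1) := by
  constructor
  · intro h
    replace h : ∀ i j k l, reflL q M M (i, j) (k, l) = reflR q M M (i, j) (k, l) :=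
      fun i j k l => by rw [h]
    have h0001 := h 0 0 0 1
    have h0100 := h 0 1 0 0
    have h0101 := h 0 1 0 1
    have h0110 := h 0 1 1 0
    have h0111 := h 0 1 1 1
    have h1101 := h 1 1 0 1
    simp [reflL, reflR, crossR, mul_leg2_apply, leg2_mul_apply, scal_mul_apply, mul_scal_apply,
          leg1_apply, rMat_apply, rMat21_apply, Fin.sum_univ_two, rMat21_inv hq, mul_assoc, add_mul,
          mul_add] at h0001 h0100 h0101 h0110 h0111 h1101
    constructor
    · linear_combination (norm := (match_scalars <;> field_simp <;> ring)) (-q) • h0111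
    · linear_combination (norm := (match_scalars <;> field_simp <;> ring)) q • h1101
    · linear_combination (norm := (match_scalars <;> field_simp <;> ring)) (-1 : ℂ) • h0101
    · linear_combination (norm := (match_scalars <;> field_simp <;> ring)) (-1 : ℂ) • h0001
    · linear_combination (norm := (match_scalars <;> field_simp <;> ring)) (-1 : ℂ) • h0100
    · linear_combination (norm := (match_scalars <;> field_simp <;> ring)) (-q⁻¹) • h0110 - (1 - (q ^ 2)⁻¹) • h0101
  · rintro ⟨db, cd, da, ba, ca, cb⟩
    ext ⟨i, j⟩ ⟨k, l⟩
    fin_cases i <;> fin_cases j <;> fin_cases k <;> fin_cases l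
    all_goals
      simp [reflL, reflR, crossR, mul_leg2_apply, leg2_mul_apply, scal_mul_apply, mul_scal_apply,
          leg1_apply, rMat_apply, rMat21_apply, Fin.sum_univ_two, rMat21_inv hq, mul_assoc, add_mul,
          mul_add, db, cd, da, ba, ca, cb, smul_add, smul_sub]
    all_goals try (match_scalars <;> field_simp <;> ring)

/-- The sixteen entries form a triangular linear system for the sixteen products of an entry of N by
an entry of M. The coefficients below solve it; only `Aa` keeps an unsorted product B c. -/
theorem reflL_eq_crossR_iff {q : ℂ} (hq : q ≠ 0) (M N : Matrix (Fin 2) (Fin 2) A) :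
    reflL q N M = crossR q N M ↔
      CrossRel (q ^ 2) (M 0 0) (M 0 1) (M 1 0) (M 1 1) (N 0 0) (N 0 1) (N 1 0) (N 1 1) := by
  constructor
  · intro h
    replace h : ∀ i j k l, reflL q N M (i, j) (k, l) = crossR q N M (i, j) (k, l) :=
      fun i j k l => by rw [h]
    have h0000 := h 0 0 0 0
    have h0001 := h 0 0 0 1
    have h0010 := h 0 0 1 0
    have h0011 := h 0 0 1 1
    have h0100 := h 0 1 0 0
    have h0101 := h 0 1 0 1
    have h0110 := h 0 1 1 0
    have h0111 := h 0 1 1 1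
    have h1000 := h 1 0 0 0
    have h1001 := h 1 0 0 1
    have h1010 := h 1 0 1 0
    have h1011 := h 1 0 1 1
    have h1100 := h 1 1 0 0
    have h1101 := h 1 1 0 1
    have h1110 := h 1 1 1 0
    have h1111 := h 1 1 1 1
    simp [reflL, reflR, crossR, mul_leg2_apply, leg2_mul_apply, scal_mul_apply, mul_scal_apply,
          leg1_apply, rMat_apply, rMat21_apply, Fin.sum_univ_two, rMat21_inv hq, mul_assoc, add_mul,
          mul_add] at h0000 h0001 h0010 h0011 h0100 h0101 h0110 h0111 h1000 h1001 h1010 h1011 h1100 h1101 h1110 h1111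
    constructor
    · linear_combination (norm := (match_scalars <;> field_simp <;> ring)) (q ^ 2)⁻¹ • h1111
    · linear_combination (norm := (match_scalars <;> field_simp <;> ring)) (1 : ℂ) • h1011
    · linear_combination (norm := (match_scalars <;> field_simp <;> ring)) (q ^ 2)⁻¹ • h1110
    · linear_combination (norm := (match_scalars <;> field_simp <;> ring)) (1 : ℂ) • h1010
    · linear_combination (norm := (match_scalars <;> field_simp <;> ring)) q⁻¹ • h1101
    · linear_combination (norm := (match_scalars <;> field_simp <;> ring)) q⁻¹ • h1100
    · linear_combination (norm := (match_scalars <;> field_simp <;> ring)) q⁻¹ • h1001 - ((1 - (q ^ 2)⁻¹) * (q ^ 2)⁻¹) • h1111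
    · linear_combination (norm := (match_scalars <;> field_simp <;> ring)) q⁻¹ • h1000 - ((1 - (q ^ 2)⁻¹) * (q ^ 2)⁻¹) • h1110
    · linear_combination (norm := (match_scalars <;> field_simp <;> ring)) q⁻¹ • h0011
    · linear_combination (norm := (match_scalars <;> field_simp <;> ring)) q⁻¹ • h0111 - (q⁻¹ * (q - q⁻¹)) • h1011
    · linear_combination (norm := (match_scalars <;> field_simp <;> ring)) q⁻¹ • h0010
    · linear_combination (norm := (match_scalars <;> field_simp <;> ring)) q⁻¹ • h0110 - (q⁻¹ * (q - q⁻¹)) • h1010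
    · linear_combination (norm := (match_scalars <;> field_simp <;> ring)) (q ^ 2)⁻¹ • h0001 - ((1 - (q ^ 2)⁻¹) * q⁻¹) • h0111 + ((1 - (q ^ 2)⁻¹) * q⁻¹ * (q - q⁻¹)) • h1011
    · linear_combination (norm := (match_scalars <;> field_simp <;> ring)) (1 : ℂ) • h0101 - (q - q⁻¹) • h1001
    · linear_combination (norm := (match_scalars <;> field_simp <;> ring)) (1 : ℂ) • h0100 - (q - q⁻¹) • h1000
    · linear_combination (norm := (match_scalars <;> field_simp <;> ring)) (q ^ 2)⁻¹ • h0000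
  · rintro ⟨Ed, Eb, Ec, Ea, Cd, Cc, Cb, Ca, Bb, Bd, Ba, Bc, Ab, Ad, Ac, Aa⟩
    ext ⟨i, j⟩ ⟨k, l⟩
    fin_cases i <;> fin_cases j <;> fin_cases k <;> fin_cases l
    all_goals
      simp [reflL, reflR, crossR, mul_leg2_apply, leg2_mul_apply, scal_mul_apply, mul_scal_apply,
          leg1_apply, rMat_apply, rMat21_apply, Fin.sum_univ_two, rMat21_inv hq, mul_assoc, add_mul,
          mul_add, Ed, Eb, Ec, Ea, Cd, Cc, Cb, Ca, Bb, Bd, Ba, Bc, Ab, Ad, Ac, Aa, smul_add, smul_sub]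
    all_goals try (match_scalars <;> field_simp <;> ring)

end Relations

/-! ### Universal properties and generators of the presented algebras -/

section Universal

theorem ReaRel.map {A B : Type*} [Ring A] [Algebra ℂ A] [Ring B] [Algebra ℂ B] {s : ℂ}
    {a b c d : A} (h : ReaRel s a b c d) (f : A →ₐ[ℂ] B) : ReaRel s (f a) (f b) (f c) (f d) where
  db := by rw [← map_mul, ← map_mul, ← map_smul, h.db]
  cd := by rw [← map_mul, ← map_mul, ← map_smul, h.cd]
  da := by rw [← map_mul, ← map_mul, h.da]
  ba := by simp only [← map_mul, ← map_add, ← map_smul, h.ba]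
  ca := by simp only [← map_mul, ← map_sub, ← map_smul, h.ca]
  cb := by simp only [← map_mul, ← map_add, ← map_sub, ← map_smul, h.cb]

theorem CrossRel.map {R R' : Type*} [Ring R] [Algebra ℂ R] [Ring R'] [Algebra ℂ R'] {s : ℂ}
    {a b c d A B C E : R} (h : CrossRel s a b c d A B C E) (f : R →ₐ[ℂ] R') :
    CrossRel s (f a) (f b) (f c) (f d) (f A) (f B) (f C) (f E) where
  Ed := by simp only [← map_mul, ← map_smul, h.Ed]
  Eb := by simp only [← map_mul, h.Eb]
  Ec := by simp only [← map_mul, ← map_add, ← map_smul, h.Ec]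
  Ea := by simp only [← map_mul, ← map_add, ← map_smul, h.Ea]
  Cd := by simp only [← map_mul, h.Cd]
  Cc := by simp only [← map_mul, ← map_smul, h.Cc]
  Cb := by simp only [← map_mul, ← map_sub, ← map_smul, h.Cb]
  Ca := by simp only [← map_mul, ← map_add, ← map_sub, ← map_smul, h.Ca]
  Bb := by simp only [← map_mul, ← map_smul, h.Bb]
  Bd := by simp only [← map_mul, ← map_add, ← map_smul, h.Bd]
  Ba := by simp only [← map_mul, ← map_add, ← map_smul, h.Ba]
  Bc := by simp only [← map_mul, ← map_add, ← map_smul, h.Bc]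
  Ab := by simp only [← map_mul, ← map_add, ← map_sub, ← map_smul, h.Ab]
  Ad := by simp only [← map_mul, ← map_add, ← map_smul, h.Ad]
  Ac := by simp only [← map_mul, ← map_add, ← map_smul, h.Ac]
  Aa := by simp only [← map_mul, ← map_add, ← map_sub, ← map_smul, h.Aa]

theorem qdet_map {A B : Type} [Ring A] [Algebra ℂ A] [Ring B] [Algebra ℂ B] (f : A →ₐ[ℂ] B)
    (q : ℂ) (M : Matrix (Fin 2) (Fin 2) A) : qdet q (M.map f) = f (qdet q M) := by
  simp [qdet]

theorem ringQuot_subalgebra_eq_top {X : Type} {r : FreeAlgebra ℂ X → FreeAlgebra ℂ X → Prop}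
    (S : Subalgebra ℂ (RingQuot r)) (h : ∀ x, RingQuot.mkAlgHom ℂ r (FreeAlgebra.ι ℂ x) ∈ S) :
    S = ⊤ := by
  have h1 : (RingQuot.mkAlgHom ℂ r).range = ⊤ := by
    rw [AlgHom.range_eq_top]
    exact RingQuot.mkAlgHom_surjective ℂ _
  rw [eq_top_iff, ← h1, ← Algebra.map_top, ← FreeAlgebra.adjoin_range_ι, AlgHom.map_adjoin,
    Algebra.adjoin_le_iff]
  rintro _ ⟨_, ⟨x, rfl⟩, rfl⟩
  exact h x

namespace OqPlus
variable {q : ℂ} {B : Type} [Ring B] [Algebra ℂ B]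

theorem reaRel (hq : q ≠ 0) :
    ReaRel (q ^ 2) (L q 0 0) (L q 0 1) (L q 1 0) (L q 1 1) := by
  rw [← reflL_eq_reflR_iff hq]
  have hL : L q = (Matrix.of fun s t => FreeAlgebra.ι ℂ (s, t)).map
    (RingQuot.mkAlgHom ℂ (OqRel q)) := rfl
  rw [hL]
  refine Eq.trans (reflL_map (RingQuot.mkAlgHom ℂ (OqRel q)) q _ _).symm
    (Eq.trans ?_ (reflR_map (RingQuot.mkAlgHom ℂ (OqRel q)) q _ _))
  ext i j
  exact RingQuot.mkAlgHom_rel ℂ (OqRel.refl i j)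

theorem exists_lift (hq : q ≠ 0) {a b c d : B} (h : ReaRel (q ^ 2) a b c d) :
    ∃ f : OqPlus q →ₐ[ℂ] B, f (L q 0 0) = a ∧ f (L q 0 1) = b ∧ f (L q 1 0) = c ∧
      f (L q 1 1) = d := by
  let M : Matrix (Fin 2) (Fin 2) B := !![a, b; c, d]
  let F : FreeAlgebra ℂ (Fin 2 × Fin 2) →ₐ[ℂ] B := FreeAlgebra.lift ℂ fun p => M p.1 p.2
  have hF : (Matrix.of fun s t => FreeAlgebra.ι ℂ (s, t)).map F = M := by
    ext i j
    simp [F]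
  have hrel : reflL q M M = reflR q M M := (reflL_eq_reflR_iff hq M).mpr h
  have hF' : ∀ ⦃x y⦄, OqRel q x y → F x = F y := by
    rintro _ _ ⟨i, j⟩
    have h1 := reflL_map F q (Matrix.of fun s t => FreeAlgebra.ι ℂ (s, t))
      (Matrix.of fun s t => FreeAlgebra.ι ℂ (s, t))
    have h2 := reflR_map F q (Matrix.of fun s t => FreeAlgebra.ι ℂ (s, t))
      (Matrix.of fun s t => FreeAlgebra.ι ℂ (s, t))
    rw [hF] at h1 h2
    exact congrFun₂ (h1.trans (hrel.trans h2.symm)) i j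
  have key : ∀ i j, RingQuot.liftAlgHom ℂ ⟨F, hF'⟩ (L q i j) = M i j := by
    intro i j
    refine Eq.trans (RingQuot.liftAlgHom_mkAlgHom_apply ℂ F hF' _) ?_
    exact congrFun₂ hF i j
  exact ⟨RingQuot.liftAlgHom ℂ ⟨F, hF'⟩, key 0 0, key 0 1, key 1 0, key 1 1⟩

theorem subalgebra_eq_top (S : Subalgebra ℂ (OqPlus q)) (h : ∀ i j, L q i j ∈ S) : S = ⊤ :=
  ringQuot_subalgebra_eq_top (r := OqRel q) S fun x => h x.1 x.2

end OqPlus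

namespace OqGL2
variable {q : ℂ} {B : Type} [Ring B] [Algebra ℂ B]

theorem reaRel (hq : q ≠ 0) :
    ReaRel (q ^ 2) (L q 0 0) (L q 0 1) (L q 1 0) (L q 1 1) :=
  (OqPlus.reaRel hq).map (LocAt.of _)

theorem qdet_eq : qdet q (L q) = LocAt.of _ (qdet q (OqPlus.L q)) := qdet_map _ _ _

theorem detInv_mul : detInv q * qdet q (L q) = 1 := by
  rw [qdet_eq]; exact LocAt.inv_mul _

theorem mul_detInv : qdet q (L q) * detInv q = 1 := by
  rw [qdet_eq]; exact LocAt.mul_inv _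

theorem exists_lift (hq : q ≠ 0) {a b c d : B} (h : ReaRel (q ^ 2) a b c d)
    (hu : IsUnit (a * d - q ^ 2 • (b * c))) :
    ∃ f : OqGL2 q →ₐ[ℂ] B, f (L q 0 0) = a ∧ f (L q 0 1) = b ∧ f (L q 1 0) = c ∧
      f (L q 1 1) = d := by
  obtain ⟨f, ha, hb, hc, hd⟩ := OqPlus.exists_lift hq h
  have hf : IsUnit (f (qdet q (OqPlus.L q))) := by
    rw [qdet, map_sub, map_smul, map_mul, map_mul, ha, hb, hc, hd]
    exact hu
  exact ⟨LocAt.lift f hf, by rw [← ha]; exact LocAt.lift_of f hf _,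
    by rw [← hb]; exact LocAt.lift_of f hf _, by rw [← hc]; exact LocAt.lift_of f hf _,
    by rw [← hd]; exact LocAt.lift_of f hf _⟩

theorem subalgebra_eq_top (S : Subalgebra ℂ (OqGL2 q)) (h : ∀ i j, L q i j ∈ S)
    (hi : detInv q ∈ S) : S = ⊤ := by
  have h1 : S.comap (LocAt.of _) = ⊤ := OqPlus.subalgebra_eq_top _ h
  exact LocAt.subalgebra_eq_top S
    (fun a => (Subalgebra.mem_comap _ _ _).mp (h1 ▸ Algebra.mem_top)) hi

end OqGL2

namespace DqPlus
variable {q : ℂ} {B : Type} [Ring B] [Algebra ℂ B]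

theorem reaRel_X (hq : q ≠ 0) :
    ReaRel (q ^ 2) (X q 0 0) (X q 0 1) (X q 1 0) (X q 1 1) := by
  rw [← reflL_eq_reflR_iff hq]
  refine Eq.trans (reflL_map (RingQuot.mkAlgHom ℂ (DqRel q)) q _ _).symm
    (Eq.trans ?_ (reflR_map (RingQuot.mkAlgHom ℂ (DqRel q)) q _ _))
  ext i j
  exact RingQuot.mkAlgHom_rel ℂ (DqRel.xx i j)

theorem reaRel_D (hq : q ≠ 0) :
    ReaRel (q ^ 2) (D q 0 0) (D q 0 1) (D q 1 0) (D q 1 1) := by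
  rw [← reflL_eq_reflR_iff hq]
  refine Eq.trans (reflL_map (RingQuot.mkAlgHom ℂ (DqRel q)) q _ _).symm
    (Eq.trans ?_ (reflR_map (RingQuot.mkAlgHom ℂ (DqRel q)) q _ _))
  ext i j
  exact RingQuot.mkAlgHom_rel ℂ (DqRel.dd i j)

theorem crossRel (hq : q ≠ 0) :
    CrossRel (q ^ 2) (X q 0 0) (X q 0 1) (X q 1 0) (X q 1 1)
      (D q 0 0) (D q 0 1) (D q 1 0) (D q 1 1) := by
  rw [← reflL_eq_crossR_iff hq]
  refine Eq.trans (reflL_map (RingQuot.mkAlgHom ℂ (DqRel q)) q _ _).symm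
    (Eq.trans ?_ (crossR_map (RingQuot.mkAlgHom ℂ (DqRel q)) q _ _))
  ext i j
  exact RingQuot.mkAlgHom_rel ℂ (DqRel.dx i j)

theorem exists_lift (hq : q ≠ 0) (M N : Matrix (Fin 2) (Fin 2) B)
    (hM : ReaRel (q ^ 2) (M 0 0) (M 0 1) (M 1 0) (M 1 1))
    (hN : ReaRel (q ^ 2) (N 0 0) (N 0 1) (N 1 0) (N 1 1))
    (hMN : CrossRel (q ^ 2) (M 0 0) (M 0 1) (M 1 0) (M 1 1) (N 0 0) (N 0 1) (N 1 0) (N 1 1)) :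
    ∃ f : DqPlus q →ₐ[ℂ] B, (∀ i j, f (X q i j) = M i j) ∧ ∀ i j, f (D q i j) = N i j := by
  let F : FreeAlgebra ℂ DqGen →ₐ[ℂ] B :=
    FreeAlgebra.lift ℂ (Sum.elim (fun p => M p.1 p.2) (fun p => N p.1 p.2))
  have hX : freeX.map F = M := by
    ext i j
    simp [F, freeX]
  have hD : freeD.map F = N := by
    ext i j
    simp [F, freeD]
  have hF' : ∀ ⦃x y⦄, DqRel q x y → F x = F y := by
    rintro _ _ (⟨i, j⟩ | ⟨i, j⟩ | ⟨i, j⟩)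
    · have h1 := reflL_map F q freeX freeX
      have h2 := reflR_map F q freeX freeX
      rw [hX] at h1 h2
      exact congrFun₂ (h1.trans (((reflL_eq_reflR_iff hq M).mpr hM).trans h2.symm)) i j
    · have h1 := reflL_map F q freeD freeD
      have h2 := reflR_map F q freeD freeD
      rw [hD] at h1 h2
      exact congrFun₂ (h1.trans (((reflL_eq_reflR_iff hq N).mpr hN).trans h2.symm)) i j
    · have h1 := reflL_map F q freeD freeX
      have h2 := crossR_map F q freeD freeX
      rw [hD, hX] at h1 h2
      exact congrFun₂ (h1.trans (((reflL_eq_crossR_iff hq M N).mpr hMN).trans h2.symm)) i j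
  refine ⟨RingQuot.liftAlgHom ℂ ⟨F, hF'⟩, fun i j => ?_, fun i j => ?_⟩
  · refine Eq.trans (RingQuot.liftAlgHom_mkAlgHom_apply ℂ F hF' _) ?_
    exact congrFun₂ hX i j
  · refine Eq.trans (RingQuot.liftAlgHom_mkAlgHom_apply ℂ F hF' _) ?_
    exact congrFun₂ hD i j

theorem subalgebra_eq_top (S : Subalgebra ℂ (DqPlus q)) (hX : ∀ i j, X q i j ∈ S)
    (hD : ∀ i j, D q i j ∈ S) : S = ⊤ := by
  refine ringQuot_subalgebra_eq_top (r := DqRel q) S ?_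
  rintro (x | x)
  · exact hX x.1 x.2
  · exact hD x.1 x.2

end DqPlus

namespace DqGL2
variable {q : ℂ} {B : Type} [Ring B] [Algebra ℂ B]

theorem reaRel_X (hq : q ≠ 0) :
    ReaRel (q ^ 2) (X q 0 0) (X q 0 1) (X q 1 0) (X q 1 1) :=
  (DqPlus.reaRel_X hq).map (LocAt.of _)

theorem reaRel_D (hq : q ≠ 0) :
    ReaRel (q ^ 2) (D q 0 0) (D q 0 1) (D q 1 0) (D q 1 1) :=
  (DqPlus.reaRel_D hq).map (LocAt.of _)

theorem crossRel (hq : q ≠ 0) :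
    CrossRel (q ^ 2) (X q 0 0) (X q 0 1) (X q 1 0) (X q 1 1)
      (D q 0 0) (D q 0 1) (D q 1 0) (D q 1 1) :=
  (DqPlus.crossRel hq).map (LocAt.of _)

theorem qdet_mul_qdet_eq : qdet q (X q) * qdet q (D q) =
    LocAt.of _ (qdet q (DqPlus.X q) * qdet q (DqPlus.D q)) := by
  rw [map_mul, X, D, qdet_map, qdet_map]

theorem detInv_mul : detInv q * (qdet q (X q) * qdet q (D q)) = 1 := by
  rw [qdet_mul_qdet_eq]; exact LocAt.inv_mul _

theorem mul_detInv : qdet q (X q) * qdet q (D q) * detInv q = 1 := by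
  rw [qdet_mul_qdet_eq]; exact LocAt.mul_inv _

theorem exists_lift (hq : q ≠ 0) (M N : Matrix (Fin 2) (Fin 2) B)
    (hM : ReaRel (q ^ 2) (M 0 0) (M 0 1) (M 1 0) (M 1 1))
    (hN : ReaRel (q ^ 2) (N 0 0) (N 0 1) (N 1 0) (N 1 1))
    (hMN : CrossRel (q ^ 2) (M 0 0) (M 0 1) (M 1 0) (M 1 1) (N 0 0) (N 0 1) (N 1 0) (N 1 1))
    (hu : IsUnit (qdet q M * qdet q N)) :
    ∃ f : DqGL2 q →ₐ[ℂ] B, (∀ i j, f (X q i j) = M i j) ∧ ∀ i j, f (D q i j) = N i j := by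
  obtain ⟨f, hX, hD⟩ := DqPlus.exists_lift hq M N hM hN hMN
  have hX' : (DqPlus.X q).map f = M := by ext i j; exact hX i j
  have hD' : (DqPlus.D q).map f = N := by ext i j; exact hD i j
  have hf : IsUnit (f (qdet q (DqPlus.X q) * qdet q (DqPlus.D q))) := by
    rwa [map_mul, ← qdet_map, ← qdet_map, hX', hD']
  exact ⟨LocAt.lift f hf, fun i j => by rw [← hX]; exact LocAt.lift_of f hf _,
    fun i j => by rw [← hD]; exact LocAt.lift_of f hf _⟩

theorem subalgebra_eq_top (S : Subalgebra ℂ (DqGL2 q)) (hX : ∀ i j, X q i j ∈ S)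
    (hD : ∀ i j, D q i j ∈ S) (hi : detInv q ∈ S) : S = ⊤ := by
  have h1 : S.comap (LocAt.of _) = ⊤ := DqPlus.subalgebra_eq_top _ hX hD
  exact LocAt.subalgebra_eq_top S
    (fun a => (Subalgebra.mem_comap _ _ _).mp (h1 ▸ Algebra.mem_top)) hi

end DqGL2

end Universal

/-! ### Central elements and skew commutation in the reflection equation algebra -/

namespace ReaRel
variable {A : Type*} [Ring A] [Algebra ℂ A] {s : ℂ} {a b c d : A}

/-- The primed rules carry a trailing factor, so that `simp only` can sort inside products
associated to the right. -/
theorem db' (h : ReaRel s a b c d) (x : A) : d * (b * x) = s • (b * (d * x)) := by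
  rw [← mul_assoc, h.db, smul_mul_assoc, mul_assoc]

theorem cd' (h : ReaRel s a b c d) (x : A) : c * (d * x) = s • (d * (c * x)) := by
  rw [← mul_assoc, h.cd, smul_mul_assoc, mul_assoc]

theorem da' (h : ReaRel s a b c d) (x : A) : d * (a * x) = a * (d * x) := by
  rw [← mul_assoc, h.da, mul_assoc]

theorem ba' (h : ReaRel s a b c d) (x : A) :
    b * (a * x) = a * (b * x) + (1 - s⁻¹) • (b * (d * x)) := by
  rw [← mul_assoc, h.ba, add_mul, smul_mul_assoc, mul_assoc, mul_assoc]

theorem ca' (h : ReaRel s a b c d) (x : A) :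
    c * (a * x) = a * (c * x) - (1 - s⁻¹) • (d * (c * x)) := by
  rw [← mul_assoc, h.ca, sub_mul, smul_mul_assoc, mul_assoc, mul_assoc]

theorem cb' (h : ReaRel s a b c d) (x : A) :
    c * (b * x) = b * (c * x) + (1 - s⁻¹) • (a * (d * x) - d * (d * x)) := by
  rw [← mul_assoc, h.cb, add_mul, smul_mul_assoc, sub_mul, mul_assoc, mul_assoc, mul_assoc]

/-- This is the quantum trace. Together with the quantum determinant it supplies the two scalar
parameters of the representations below. -/
theorem commute_trace (h : ReaRel s a b c d) (hs : s ≠ 0) :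
    Commute (a + s⁻¹ • d) a ∧ Commute (a + s⁻¹ • d) b ∧ Commute (a + s⁻¹ • d) c ∧
      Commute (a + s⁻¹ • d) d := by
  refine ⟨?_, ?_, ?_, ?_⟩ <;> rw [commute_iff_eq] <;>
    simp only [mul_add, add_mul, smul_mul_assoc, mul_smul_comm, h.db, h.cd, h.da, h.ba, h.ca] <;>
    match_scalars <;> field_simp <;> ring

theorem commute_det (h : ReaRel s a b c d) (hs : s ≠ 0) :
    Commute (a * d - s • (b * c)) a ∧ Commute (a * d - s • (b * c)) b ∧
      Commute (a * d - s • (b * c)) c ∧ Commute (a * d - s • (b * c)) d := by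
  refine ⟨?_, ?_, ?_, ?_⟩ <;> rw [commute_iff_eq] <;>
    simp only [mul_add, mul_sub, sub_mul, smul_add, smul_sub, smul_mul_assoc,
      mul_smul_comm, mul_assoc, h.db, h.cd, h.da, h.ca, h.cb,
      h.db', h.da', h.ba', h.ca', h.cb'] <;> match_scalars <;> field_simp <;> ring

theorem d_mul_b_pow (h : ReaRel s a b c d) (n : ℕ) : d * b ^ n = s ^ n • (b ^ n * d) := by
  induction n with
  | zero => simp
  | succ n ih =>
    rw [pow_succ, ← mul_assoc, ih, smul_mul_assoc, mul_assoc, h.db, mul_smul_comm, smul_smul,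
      pow_succ, mul_assoc]

theorem d_mul_c_pow (h : ReaRel s a b c d) (hs : s ≠ 0) (n : ℕ) :
    d * c ^ n = s⁻¹ ^ n • (c ^ n * d) := by
  have hdc : d * c = s⁻¹ • (c * d) := by rw [h.cd, smul_smul, inv_mul_cancel₀ hs, one_smul]
  induction n with
  | zero => simp
  | succ n ih =>
    rw [pow_succ, ← mul_assoc, ih, smul_mul_assoc, mul_assoc, hdc, mul_smul_comm, smul_smul,
      pow_succ, mul_assoc]

end ReaRel

/-! ### A spanning set of ordered monomials -/

section NormalForm
open MvPolynomial

variable {A : Type} [Ring A] [Algebra ℂ A]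

/-- The linear map that substitutes the elements `t, D, d` of a noncommutative algebra into
polynomials, with the factors of each monomial written in this order. -/
noncomputable def orderedEval (t D d : A) : MvPolynomial (Fin 3) ℂ →ₗ[ℂ] A :=
  (basisMonomials (Fin 3) ℂ).constr ℂ fun m => t ^ m 0 * D ^ m 1 * d ^ m 2

theorem orderedEval_monomial (t D d : A) (m : Fin 3 →₀ ℕ) :
    orderedEval t D d (monomial m 1) = t ^ m 0 * D ^ m 1 * d ^ m 2 := by
  have := (basisMonomials (Fin 3) ℂ).constr_basis ℂ (fun m => t ^ m 0 * D ^ m 1 * d ^ m 2) m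
  rwa [coe_basisMonomials] at this

/-- `orderedEval` is merely linear, its target being noncommutative. Pairwise commutation of t, D, d
gives this much multiplicativity, which is all that left multiplication on normal forms requires. -/
theorem orderedEval_X_mul {t D d : A} (htD : Commute t D) (htd : Commute t d)
    (hDd : Commute D d) (i : Fin 3) (f : MvPolynomial (Fin 3) ℂ) :
    orderedEval t D d (X i * f) = ![t, D, d] i * orderedEval t D d f := by
  have key : (orderedEval t D d).comp (LinearMap.mulLeft ℂ (X i)) =
      (LinearMap.mulLeft ℂ (![t, D, d] i)).comp (orderedEval t D d) := by
    refine (basisMonomials (Fin 3) ℂ).ext fun m => ?_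
    rw [coe_basisMonomials, LinearMap.comp_apply, LinearMap.comp_apply, LinearMap.mulLeft_apply,
      LinearMap.mulLeft_apply, orderedEval_monomial, X, monomial_mul, one_mul,
      orderedEval_monomial]
    fin_cases i
    · simp [pow_add, mul_assoc]
    · have h1 := (htD.pow_left (m 0)).eq
      simp only [Fin.mk_one, Finsupp.coe_add, Pi.add_apply, pow_add, Finsupp.single_apply]
      simp [← mul_assoc, h1]
    · have h1 := (htd.pow_left (m 0)).eq
      have h2 := (hDd.pow_left (m 1)).eq
      simp only [Fin.reduceFinMk, Finsupp.coe_add, Pi.add_apply, pow_add, Finsupp.single_apply]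
      simp only [Fin.reduceEq, if_true, if_false, pow_zero, one_mul, pow_one, Matrix.cons_val]
      rw [mul_assoc, ← mul_assoc _ d, h2, mul_assoc, ← mul_assoc _ d, h1, mul_assoc, mul_assoc]
  exact LinearMap.congr_fun key f

/-- The element `b ^ i` for `i ≥ 0` and `c ^ (-i)` for `i < 0`. -/
def signedPow (b c : A) : ℤ → A
  | Int.ofNat n => b ^ n
  | Int.negSucc n => c ^ (n + 1)

/-- The linear combinations of the products of a signed power and an ordered monomial. -/
noncomputable def normalForm (b c t D d : A) : (ℤ →₀ MvPolynomial (Fin 3) ℂ) →ₗ[ℂ] A :=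
  Finsupp.lsum ℂ fun i => (LinearMap.mulLeft ℂ (signedPow b c i)).comp (orderedEval t D d)

theorem normalForm_single (b c t D d : A) (i : ℤ) (f : MvPolynomial (Fin 3) ℂ) :
    normalForm b c t D d (Finsupp.single i f) = signedPow b c i * orderedEval t D d f := by
  simp [normalForm]

/-- The span of the normal forms contains 1 and is stable under left multiplication by the
generators: t and D are central, d passes powers of b and c up to a scalar, and bc and cb are
polynomials in t, D, d, so b and c never need to occur together. -/
theorem normalForm_range_eq_top {s : ℂ} (hs : s ≠ 0) {a b c d : A} (h : ReaRel s a b c d)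
    (hgen : ∀ S : Subalgebra ℂ A, a ∈ S → b ∈ S → c ∈ S → d ∈ S → S = ⊤) :
    LinearMap.range (normalForm b c (a + s⁻¹ • d) (a * d - s • (b * c)) d) = ⊤ := by
  obtain ⟨ta, tb, tc, td⟩ := h.commute_trace hs
  obtain ⟨Da, Db, Dc, Dd⟩ := h.commute_det hs
  set t := a + s⁻¹ • d with ht
  set D := a * d - s • (b * c) with hD
  have tD : Commute t D := (ta.mul_right td).sub_right ((tb.mul_right tc).smul_right s)
  set N := LinearMap.range (normalForm b c t D d) with hN
  have hmem : ∀ i f, signedPow b c i * orderedEval t D d f ∈ N :=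
    fun i f => ⟨Finsupp.single i f, normalForm_single ..⟩
  have closed : ∀ x : A, (∀ i f, x * (signedPow b c i * orderedEval t D d f) ∈ N) →
      ∀ y ∈ N, x * y ∈ N := by
    rintro x hx _ ⟨F, rfl⟩
    induction F using Finsupp.induction_linear with
    | zero => rw [map_zero, mul_zero]; exact N.zero_mem
    | add F G hF hG => rw [map_add, mul_add]; exact N.add_mem hF hG
    | single i f => rw [normalForm_single]; exact hx i f
  have ct : ∀ y ∈ N, t * y ∈ N := by
    refine closed t fun i f => ?_
    have h1 : Commute t (signedPow b c i) := by
      cases i with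
      | ofNat n => exact tb.pow_right n
      | negSucc n => exact tc.pow_right (n + 1)
    rw [← mul_assoc, h1.eq, mul_assoc]
    have := hmem i (X 0 * f)
    rwa [orderedEval_X_mul tD td Dd] at this
  have cD : ∀ y ∈ N, D * y ∈ N := by
    refine closed D fun i f => ?_
    have h1 : Commute D (signedPow b c i) := by
      cases i with
      | ofNat n => exact Db.pow_right n
      | negSucc n => exact Dc.pow_right (n + 1)
    rw [← mul_assoc, h1.eq, mul_assoc]
    have := hmem i (X 1 * f)
    rwa [orderedEval_X_mul tD td Dd] at this
  have cd : ∀ y ∈ N, d * y ∈ N := by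
    refine closed d fun i f => ?_
    have h1 : ∃ k : ℂ, d * signedPow b c i = k • (signedPow b c i * d) := by
      cases i with
      | ofNat n => exact ⟨_, h.d_mul_b_pow n⟩
      | negSucc n => exact ⟨_, h.d_mul_c_pow hs (n + 1)⟩
    obtain ⟨k, hk⟩ := h1
    rw [← mul_assoc, hk, smul_mul_assoc, mul_assoc]
    have := hmem i (X 2 * f)
    rw [orderedEval_X_mul tD td Dd] at this
    exact N.smul_mem k this
  have hbc : ∀ y, b * (c * y) = s⁻¹ • (t * (d * y) - D * y - s⁻¹ • (d * (d * y))) := by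
    intro y
    rw [ht, hD]
    simp only [add_mul, sub_mul, smul_mul_assoc, mul_assoc]
    match_scalars <;> field_simp <;> ring
  have hcb : ∀ y, c * (b * y) = b * (c * y) +
      (1 - s⁻¹) • (t * (d * y) - s⁻¹ • (d * (d * y)) - d * (d * y)) := by
    intro y
    rw [h.cb', ht]
    simp only [add_mul, smul_mul_assoc]
    match_scalars <;> field_simp <;> ring
  have cbc : ∀ y ∈ N, b * (c * y) ∈ N := by
    intro y hy
    rw [hbc]
    exact N.smul_mem _ (N.sub_mem (N.sub_mem (ct _ (cd _ hy)) (cD _ hy))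
      (N.smul_mem _ (cd _ (cd _ hy))))
  have ccb : ∀ y ∈ N, c * (b * y) ∈ N := by
    intro y hy
    rw [hcb]
    exact N.add_mem (cbc y hy) (N.smul_mem _ (N.sub_mem (N.sub_mem (ct _ (cd _ hy))
      (N.smul_mem _ (cd _ (cd _ hy)))) (cd _ (cd _ hy))))
  have cb : ∀ y ∈ N, b * y ∈ N := by
    refine closed b fun i f => ?_
    cases i with
    | ofNat n =>
      have := hmem (Int.ofNat (n + 1)) f
      rwa [signedPow, pow_succ', mul_assoc] at this
    | negSucc n =>
      rw [signedPow, pow_succ', mul_assoc]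
      refine cbc _ ?_
      -- After one factor c cancels against b, the remaining power c ^ n is indexed by a negative
      -- integer only if n > 0; for n = 0 it is the normal form of index 0.
      cases n with
      | zero => simpa [signedPow] using hmem (Int.ofNat 0) f
      | succ n => exact hmem (Int.negSucc n) f
  have cc : ∀ y ∈ N, c * y ∈ N := by
    refine closed c fun i f => ?_
    cases i with
    | ofNat n =>
      cases n with
      | zero =>
        have := hmem (Int.negSucc 0) f
        rw [signedPow, zero_add, pow_one] at this
        rwa [signedPow, pow_zero, one_mul]
      | succ n =>
        rw [signedPow, pow_succ', mul_assoc]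
        exact ccb _ (hmem (Int.ofNat n) f)
    | negSucc n =>
      have := hmem (Int.negSucc (n + 1)) f
      rwa [signedPow, pow_succ', mul_assoc] at this
  have ca : ∀ y ∈ N, a * y ∈ N := by
    intro y hy
    have : a * y = t * y - s⁻¹ • (d * y) := by
      rw [ht, add_mul, smul_mul_assoc, add_sub_cancel_right]
    rw [this]
    exact N.sub_mem (ct _ hy) (N.smul_mem _ (cd _ hy))
  -- The elements whose left multiplication preserves the span form a subalgebra; it contains the
  -- generators, and applying its elements to 1 gives everything.
  let S : Subalgebra ℂ A :=
    { carrier := {x | ∀ y ∈ N, x * y ∈ N}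
      mul_mem' := fun {x x'} hx hx' y hy => by rw [mul_assoc]; exact hx _ (hx' _ hy)
      add_mem' := fun {x x'} hx hx' y hy => by rw [add_mul]; exact N.add_mem (hx _ hy) (hx' _ hy)
      algebraMap_mem' := fun r y hy => by rw [← Algebra.smul_def]; exact N.smul_mem _ hy }
  have hS : S = ⊤ := hgen S ca cb cc cd
  have h1 : (1 : A) ∈ N := by
    have := hmem 0 (monomial 0 1)
    rw [orderedEval_monomial] at this
    simpa [signedPow] using this
  rw [eq_top_iff]
  intro x _
  have hx : x ∈ S := hS ▸ Algebra.mem_top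
  have := hx 1 h1
  rwa [mul_one] at this

end NormalForm

/-! ### Weighted shift representations and their joint faithfulness -/

section Representation
open MvPolynomial

/-- The operator `(w v)(n) = w(n) v(n + k)` on complex sequences. -/
def wshift (w : ℤ → ℂ) (k : ℤ) : Module.End ℂ (ℤ → ℂ) where
  toFun v n := w n * v (n + k)
  map_add' u v := by ext n; simp [mul_add]
  map_smul' r v := by ext n; simp [mul_left_comm]

@[simp] theorem wshift_apply (w : ℤ → ℂ) (k : ℤ) (v : ℤ → ℂ) (n : ℤ) :
    wshift w k v n = w n * v (n + k) := rfl

/-- The value at `y` of the quadratic polynomial through which `b c` acts. -/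
noncomputable def bcVal (s t D y : ℂ) : ℂ := s⁻¹ * (t * y - D - s⁻¹ * y ^ 2)

/-- Once t and det_q are to be scalars and b is the pure shift, a and c are forced. The exponent n +
1 in the weight of c makes up for the shift by b: the product bc acts at n by `bcVal` at sⁿd. -/
theorem reaRel_wshift {s : ℂ} (hs : s ≠ 0) (t D d : ℂ) :
    ReaRel s (wshift (fun n => t - s⁻¹ * (s ^ n * d)) 0) (wshift 1 (-1))
      (wshift (fun n => bcVal s t D (s ^ (n + 1) * d)) 1) (wshift (fun n => s ^ n * d) 0) where
  db := by
    ext v n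
    simp [zpow_sub₀ hs, ← sub_eq_add_neg]; field_simp
  cd := by
    ext v n
    simp [zpow_add₀ hs]; field_simp
  da := by
    ext v n
    simp; ring
  ba := by
    ext v n
    simp [zpow_sub₀ hs, ← sub_eq_add_neg]; field_simp; ring
  ca := by
    ext v n
    simp [zpow_add₀ hs]; field_simp; ring
  cb := by
    ext v n
    simp [zpow_add₀ hs, bcVal]; field_simp; ring

theorem qdet_wshift {s : ℂ} (hs : s ≠ 0) (t D d : ℂ) :
    wshift (fun n => t - s⁻¹ * (s ^ n * d)) 0 * wshift (fun n => s ^ n * d) 0 -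
      s • (wshift 1 (-1) * wshift (fun n => bcVal s t D (s ^ (n + 1) * d)) 1) =
      algebraMap ℂ (Module.End ℂ (ℤ → ℂ)) D := by
  ext v n
  simp [bcVal]; field_simp; ring

variable {q : ℂ}

theorem OqGL2.exists_rep (hq : q ≠ 0) (t : ℂ) (D : ℂˣ) (d : ℂ) :
    ∃ ρ : OqGL2 q →ₐ[ℂ] Module.End ℂ (ℤ → ℂ),
      ρ (L q 0 0) = wshift (fun n => t - (q ^ 2)⁻¹ * ((q ^ 2) ^ n * d)) 0 ∧
      ρ (L q 0 1) = wshift 1 (-1) ∧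
      ρ (L q 1 0) = wshift (fun n => bcVal (q ^ 2) t D ((q ^ 2) ^ (n + 1) * d)) 1 ∧
      ρ (L q 1 1) = wshift (fun n => (q ^ 2) ^ n * d) 0 := by
  have hs : q ^ 2 ≠ 0 := pow_ne_zero 2 hq
  refine OqGL2.exists_lift hq (reaRel_wshift hs t D d) ?_
  rw [qdet_wshift hs]
  exact D.isUnit.map (algebraMap ℂ _)

/-- The representation of `O_q(GL₂)` on sequences in which `b` is the shift, `d` is diagonal and
the central elements `a + q⁻² d` and `det_q` act by the scalars `t` and `D`. -/
noncomputable def OqGL2.rep (hq : q ≠ 0) (t : ℂ) (D : ℂˣ) (d : ℂ) :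
    OqGL2 q →ₐ[ℂ] Module.End ℂ (ℤ → ℂ) :=
  (OqGL2.exists_rep hq t D d).choose

namespace OqGL2

theorem rep_a (hq : q ≠ 0) (t : ℂ) (D : ℂˣ) (d : ℂ) : rep hq t D d (L q 0 0) =
    wshift (fun n => t - (q ^ 2)⁻¹ * ((q ^ 2) ^ n * d)) 0 :=
  (exists_rep hq t D d).choose_spec.1

theorem rep_b (hq : q ≠ 0) (t : ℂ) (D : ℂˣ) (d : ℂ) : rep hq t D d (L q 0 1) = wshift 1 (-1) :=
  (exists_rep hq t D d).choose_spec.2.1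

theorem rep_c (hq : q ≠ 0) (t : ℂ) (D : ℂˣ) (d : ℂ) : rep hq t D d (L q 1 0) =
    wshift (fun n => bcVal (q ^ 2) t D ((q ^ 2) ^ (n + 1) * d)) 1 :=
  (exists_rep hq t D d).choose_spec.2.2.1

theorem rep_d (hq : q ≠ 0) (t : ℂ) (D : ℂˣ) (d : ℂ) : rep hq t D d (L q 1 1) =
    wshift (fun n => (q ^ 2) ^ n * d) 0 :=
  (exists_rep hq t D d).choose_spec.2.2.2

theorem rep_qdet (hq : q ≠ 0) (t : ℂ) (D : ℂˣ) (d : ℂ) : rep hq t D d (qdet q (L q)) =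
    algebraMap ℂ (Module.End ℂ (ℤ → ℂ)) D := by
  rw [show qdet q (L q) = L q 0 0 * L q 1 1 - q ^ 2 • (L q 0 1 * L q 1 0) from rfl, map_sub, map_smul, map_mul, map_mul, rep_a, rep_b, rep_c, rep_d,
    qdet_wshift (pow_ne_zero 2 hq)]

theorem rep_trace (hq : q ≠ 0) (t : ℂ) (D : ℂˣ) (d : ℂ) :
    rep hq t D d (L q 0 0 + (q ^ 2)⁻¹ • L q 1 1) = algebraMap ℂ (Module.End ℂ (ℤ → ℂ)) t := by
  rw [map_add, map_smul, rep_a, rep_d]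
  ext v n
  simp; ring

end OqGL2

/-- The coefficient with which a signed power of `b` or `c` acts on the vector supported at `0`,
as a polynomial in the parameters `t, D, d`. -/
noncomputable def leadPoly (s : ℂ) : ℤ → MvPolynomial (Fin 3) ℂ
  | Int.ofNat _ => 1
  | Int.negSucc n => ∏ k ∈ Finset.range (n + 1),
      C s⁻¹ * (X 0 * (C (s⁻¹ ^ k) * X 2) - X 1 - C s⁻¹ * (C (s⁻¹ ^ k) * X 2) ^ 2)

theorem leadPoly_ne_zero {s : ℂ} (hs : s ≠ 0) (i : ℤ) : leadPoly s i ≠ 0 := by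
  cases i with
  | ofNat n => exact one_ne_zero
  | negSucc n =>
    rw [leadPoly, Finset.prod_ne_zero_iff]
    intro k _ h
    -- At t = 0, D = 1, d = 0 the factor equals −s⁻¹.
    have := congrArg (eval ![0, 1, 0]) h
    simp [hs] at this

/-- Each b moves the support one step up and each c one step down, collecting the weight of c at
each site. Different indices therefore land on different basis vectors, which is what separates the
normal forms. -/
theorem OqGL2.rep_signedPow_single (hq : q ≠ 0) (t : ℂ) (D : ℂˣ) (d : ℂ) (i : ℤ) :
    OqGL2.rep hq t D d (signedPow (OqGL2.L q 0 1) (OqGL2.L q 1 0) i) (Pi.single 0 1) =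
      eval ![t, (D : ℂ), d] (leadPoly (q ^ 2) i) • Pi.single i (1 : ℂ) := by
  have hs : q ^ 2 ≠ 0 := pow_ne_zero 2 hq
  cases i with
  | ofNat n =>
    rw [leadPoly, map_one, one_smul, signedPow]
    induction n with
    | zero => rw [pow_zero, map_one]; rfl
    | succ n ih =>
      rw [pow_succ', map_mul, Module.End.mul_apply, ih, rep_b]
      ext m
      simp only [wshift_apply, Pi.one_apply, one_mul, Pi.single_apply]
      congr 1
      simp only [Int.ofNat_eq_natCast, Nat.cast_add, Nat.cast_one, eq_iff_iff]
      omega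
  | negSucc n =>
    have key : ∀ n : ℕ, rep hq t D d (L q 1 0 ^ n) (Pi.single 0 1) =
        (∏ k ∈ Finset.range n, bcVal (q ^ 2) t D ((q ^ 2)⁻¹ ^ k * d)) •
          Pi.single (-(n : ℤ)) (1 : ℂ) := by
      intro n
      induction n with
      | zero => simp
      | succ n ih =>
        rw [pow_succ', map_mul, Module.End.mul_apply, ih, rep_c, map_smul, Finset.prod_range_succ,
          mul_smul]
        congr 1
        ext m
        simp only [wshift_apply, Pi.single_apply, Pi.smul_apply, smul_eq_mul, Nat.cast_add,
          Nat.cast_one]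
        by_cases hm : m = -((n : ℤ) + 1)
        · have h1 : m + 1 = -(n : ℤ) := by omega
          rw [if_pos h1, if_pos hm, h1, zpow_neg, zpow_natCast, inv_pow]
        · have h1 : m + 1 ≠ -(n : ℤ) := by omega
          rw [if_neg h1, if_neg hm, mul_zero, mul_zero]
    rw [signedPow, key, leadPoly, map_prod]
    congr 1
    refine Finset.prod_congr rfl fun k _ => ?_
    simp [bcVal]

/-- The vector supported at 0 is an eigenvector of d with eigenvalue s⁰d, and the other two factors
act by scalars. -/
theorem OqGL2.rep_orderedEval_single (hq : q ≠ 0) (t : ℂ) (D : ℂˣ) (d : ℂ)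
    (f : MvPolynomial (Fin 3) ℂ) :
    OqGL2.rep hq t D d (orderedEval (OqGL2.L q 0 0 + (q ^ 2)⁻¹ • OqGL2.L q 1 1)
      (qdet q (OqGL2.L q)) (OqGL2.L q 1 1) f) (Pi.single 0 1) =
      eval ![t, (D : ℂ), d] f • Pi.single 0 (1 : ℂ) := by
  induction f using MvPolynomial.monomial_add_induction_on with
  | C r =>
    have : (C r : MvPolynomial (Fin 3) ℂ) = r • monomial 0 1 := by
      rw [smul_monomial, smul_eq_mul, mul_one]; rfl
    rw [this, map_smul, orderedEval_monomial]
    simp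
  | monomial_add m r f _ _ ih =>
    rw [map_add, map_add, LinearMap.add_apply, ih, map_add, add_smul]
    congr 1
    have h1 : (monomial m r : MvPolynomial (Fin 3) ℂ) = r • monomial m 1 := by
      rw [smul_monomial, smul_eq_mul, mul_one]
    have h2 : ∀ n : ℕ, (OqGL2.rep hq t D d (OqGL2.L q 1 1) ^ n) (Pi.single 0 1) =
        d ^ n • Pi.single 0 (1 : ℂ) := by
      intro n
      induction n with
      | zero => simp
      | succ n ih =>
        rw [pow_succ', Module.End.mul_apply, ih, map_smul, OqGL2.rep_d, pow_succ d n, mul_smul]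
        congr 1
        ext m
        by_cases hm : m = 0 <;> simp [hm]
    rw [h1, smul_eval, map_smul, map_smul, orderedEval_monomial, map_mul, map_mul, map_pow, map_pow, map_pow,
      OqGL2.rep_trace, OqGL2.rep_qdet, LinearMap.smul_apply, Module.End.mul_apply, h2, ← map_pow,
      ← map_pow, ← map_mul, map_smul, Module.algebraMap_end_apply, eval_monomial,
      smul_smul, smul_smul, Finsupp.prod_fintype _ _ (fun _ => pow_zero _), Fin.prod_univ_three]
    congr 1
    simp
    ring

/-- The representations `OqGL2.rep` are jointly faithful, already on one vector. -/
theorem OqGL2.eq_zero_of_rep (hq : q ≠ 0) (y : OqGL2 q)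
    (h : ∀ (t : ℂ) (D : ℂˣ) (d : ℂ), d ≠ 0 → OqGL2.rep hq t D d y (Pi.single 0 1) = 0) :
    y = 0 := by
  have hs : q ^ 2 ≠ 0 := pow_ne_zero 2 hq
  have hrea := OqPlus.reaRel hq
  obtain ⟨Da, Db, Dc, Dd⟩ := hrea.commute_det hs
  have hcentral : ∀ x, Commute (qdet q (OqPlus.L q)) x := by
    have hS : Subalgebra.centralizer ℂ {qdet q (OqPlus.L q)} = ⊤ := by
      apply OqPlus.subalgebra_eq_top
      intro i j
      rw [Subalgebra.mem_centralizer_iff]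
      rintro _ rfl
      fin_cases i <;> fin_cases j
      exacts [Da.eq, Db.eq, Dc.eq, Dd.eq]
    intro x
    have hx : x ∈ Subalgebra.centralizer ℂ {qdet q (OqPlus.L q)} := hS ▸ Algebra.mem_top
    rw [Subalgebra.mem_centralizer_iff] at hx
    exact hx _ rfl
  obtain ⟨n, x, hx⟩ := LocAt.exists_mul_pow_eq hcentral y
  have htop := normalForm_range_eq_top hs hrea (fun S ha hb hc hd =>
    OqPlus.subalgebra_eq_top S fun i j => by fin_cases i <;> fin_cases j <;> assumption)
  have hxr : x ∈ LinearMap.range (normalForm (OqPlus.L q 0 1) (OqPlus.L q 1 0)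
    (OqPlus.L q 0 0 + (q ^ 2)⁻¹ • OqPlus.L q 1 1) (qdet q (OqPlus.L q)) (OqPlus.L q 1 1)) := by
    rw [show qdet q (OqPlus.L q) = OqPlus.L q 0 0 * OqPlus.L q 1 1 -
      q ^ 2 • (OqPlus.L q 0 1 * OqPlus.L q 1 0) from rfl, htop]
    exact Submodule.mem_top
  obtain ⟨F, rfl⟩ := hxr
  -- The coordinate at i of the result sees only the i-th component of the normal form.
  have hval : ∀ (t : ℂ) (D : ℂˣ) (d : ℂ) (i : ℤ) (F : ℤ →₀ MvPolynomial (Fin 3) ℂ),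
      OqGL2.rep hq t D d (LocAt.of _ (normalForm (OqPlus.L q 0 1) (OqPlus.L q 1 0)
        (OqPlus.L q 0 0 + (q ^ 2)⁻¹ • OqPlus.L q 1 1) (qdet q (OqPlus.L q)) (OqPlus.L q 1 1) F))
        (Pi.single 0 1) i =
      eval ![t, (D : ℂ), d] (leadPoly (q ^ 2) i) * eval ![t, (D : ℂ), d] (F i) := by
    intro t D d i F
    induction F using Finsupp.induction_linear with
    | zero => simp
    | add F G hF hG =>
      rw [map_add, map_add, map_add, LinearMap.add_apply, Pi.add_apply, hF, hG, Finsupp.add_apply,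
        map_add, mul_add]
    | single j f =>
      have h1 : ∀ j, LocAt.of (qdet q (OqPlus.L q))
          (signedPow (OqPlus.L q 0 1) (OqPlus.L q 1 0) j) =
          signedPow (OqGL2.L q 0 1) (OqGL2.L q 1 0) j := by
        rintro (j | j)
        · exact map_pow _ _ _
        · exact map_pow _ _ _
      have h2 : LocAt.of (qdet q (OqPlus.L q)) (orderedEval
          (OqPlus.L q 0 0 + (q ^ 2)⁻¹ • OqPlus.L q 1 1) (qdet q (OqPlus.L q)) (OqPlus.L q 1 1) f) =
          orderedEval (OqGL2.L q 0 0 + (q ^ 2)⁻¹ • OqGL2.L q 1 1)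
            (qdet q (OqGL2.L q)) (OqGL2.L q 1 1) f := by
        have : (LocAt.of (qdet q (OqPlus.L q))).toLinearMap.comp (orderedEval
            (OqPlus.L q 0 0 + (q ^ 2)⁻¹ • OqPlus.L q 1 1) (qdet q (OqPlus.L q))
            (OqPlus.L q 1 1)) = orderedEval (OqGL2.L q 0 0 + (q ^ 2)⁻¹ • OqGL2.L q 1 1)
            (qdet q (OqGL2.L q)) (OqGL2.L q 1 1) := by
          refine (basisMonomials (Fin 3) ℂ).ext fun m => ?_
          rw [coe_basisMonomials, LinearMap.comp_apply, orderedEval_monomial,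
            orderedEval_monomial, AlgHom.toLinearMap_apply, map_mul, map_mul, map_pow, map_pow,
            map_pow, map_add, map_smul, OqGL2.qdet_eq]
          rfl
        exact LinearMap.congr_fun this f
      rw [normalForm_single, map_mul, h1, h2, map_mul, Module.End.mul_apply,
        OqGL2.rep_orderedEval_single, map_smul, OqGL2.rep_signedPow_single]
      by_cases hij : i = j
      · subst hij
        simp [mul_comm]
      · simp [hij]
  have hF : F = 0 := by
    ext1 i
    -- The factors X 1 and X 2 take care of the points with D = 0 or d = 0, where the hypothesis
    -- gives no information.
    have hz : ∀ p, eval p (leadPoly (q ^ 2) i * F i * X 1 * X 2) = 0 := by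
      intro p
      by_cases h1 : p 1 = 0
      · simp [h1]
      by_cases h2 : p 2 = 0
      · simp [h2]
      have := hval (p 0) (Units.mk0 _ h1) (p 2) i F
      rw [← hx, map_mul, Module.End.mul_apply, map_pow, ← OqGL2.qdet_eq, OqGL2.rep_qdet,
        ← map_pow, Module.algebraMap_end_apply, map_smul, h _ _ _ h2, smul_zero,
        Pi.zero_apply] at this
      have hp : (![p 0, ((Units.mk0 _ h1 : ℂˣ) : ℂ), p 2] : Fin 3 → ℂ) = p := by
        ext k; fin_cases k <;> rfl
      rw [hp] at this
      rw [map_mul, map_mul, map_mul, ← this, zero_mul, zero_mul]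
    have h0 : leadPoly (q ^ 2) i * F i * X 1 * X 2 = 0 :=
      MvPolynomial.funext fun p => by rw [hz, map_zero]
    have h1 := mul_right_cancel₀ (X_ne_zero (2 : Fin 3)) (h0.trans (zero_mul _).symm)
    have h2 := mul_right_cancel₀ (X_ne_zero (1 : Fin 3)) (h1.trans (zero_mul _).symm)
    exact (mul_eq_zero.mp h2).resolve_left (leadPoly_ne_zero hs i)
  rw [hF, map_zero, map_zero] at hx
  have hunit : IsUnit (LocAt.of (qdet q (OqPlus.L q)) (qdet q (OqPlus.L q)) ^ n) :=
    LocAt.isUnit_of.pow n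
  exact hunit.mul_left_eq_zero.mp hx

end Representation

/-! ### The ℓ-th powers and the corner element in the representations -/

section FrobeniusCenter
open MvPolynomial

/-- The power sums `λⁿ + μⁿ` as expressions in `e = λ + μ` and `p = λ μ`. -/
def newtonPow {A : Type*} [Ring A] (e p : A) : ℕ → A
  | 0 => 2
  | 1 => e
  | n + 2 => e * newtonPow e p (n + 1) - p * newtonPow e p n

theorem map_newtonPow {A B : Type*} [Ring A] [Ring B] (f : A →+* B) (e p : A) (n : ℕ) :
    f (newtonPow e p n) = newtonPow (f e) (f p) n := by
  induction n using Nat.twoStepInduction with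
  | zero => exact map_ofNat f 2
  | one => simp [newtonPow]
  | more n h₁ h₂ => rw [newtonPow, map_sub, map_mul, map_mul, h₁, h₂, newtonPow]

theorem newtonPow_add_mul {A : Type*} [CommRing A] (x y : A) (n : ℕ) :
    newtonPow (x + y) (x * y) n = x ^ n + y ^ n := by
  induction n using Nat.twoStepInduction with
  | zero => simp [newtonPow]; norm_num
  | one => simp [newtonPow]
  | more n h₁ h₂ => rw [newtonPow, h₁, h₂]; ring

theorem exists_add_mul_eq (e p : ℂ) : ∃ x y : ℂ, x + y = e ∧ x * y = p := by
  obtain ⟨r, hr⟩ := IsAlgClosed.exists_pow_nat_eq (e ^ 2 - 4 * p) (n := 2) (by norm_num)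
  exact ⟨(e + r) / 2, (e - r) / 2, by ring, by linear_combination -(1 / 4 : ℂ) * hr⟩

/-- With u + v = st and uv = sD the quadratic factors as −s⁻²(u − y)(v − y), and the product of u −
sⁱy over a full period is u^ℓ − y^ℓ. Oddness of ℓ fixes the sign of the constant, and u^ℓ v^ℓ = D^ℓ
because s^ℓ = 1. -/
theorem prod_bcVal {s : ℂ} {ℓ : ℕ} (hodd : Odd ℓ) (hs : IsPrimitiveRoot s ℓ) (t D y : ℂ) :
    ∏ i ∈ Finset.range ℓ, bcVal s t D (s ^ i * y) =
      (newtonPow (s * t) (s * D) ℓ - y ^ ℓ) * y ^ ℓ - D ^ ℓ := by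
  have h0 : s ≠ 0 := hs.ne_zero hodd.pos.ne'
  obtain ⟨u, v, hu, hv⟩ := exists_add_mul_eq (s * t) (s * D)
  have key : ∀ u : ℂ, ∏ i ∈ Finset.range ℓ, (u - s ^ i * y) = u ^ ℓ - y ^ ℓ := by
    intro u
    have := congrArg (Polynomial.eval u) (X_pow_sub_C_eq_prod hs hodd.pos (rfl : y ^ ℓ = y ^ ℓ))
    simpa [Polynomial.eval_prod] using this.symm
  have h1 : ∀ i, bcVal s t D (s ^ i * y) =
      (-(s⁻¹ ^ 2)) * ((u - s ^ i * y) * (v - s ^ i * y)) := by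
    intro i
    rw [bcVal]
    have ht : t = s⁻¹ * (u + v) := by rw [hu]; field_simp
    have hD : D = s⁻¹ * (u * v) := by rw [hv]; field_simp
    rw [ht, hD]
    ring
  have h2 : (-(s⁻¹ ^ 2)) ^ ℓ = -1 := by
    rw [hodd.neg_pow, ← pow_mul, mul_comm, pow_mul, inv_pow, hs.pow_eq_one]; norm_num
  have h3 : u ^ ℓ * v ^ ℓ = D ^ ℓ := by rw [← mul_pow, hv, mul_pow, hs.pow_eq_one, one_mul]
  rw [Finset.prod_congr rfl fun i _ => h1 i, Finset.prod_mul_distrib, Finset.prod_mul_distrib, key,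
    key, Finset.prod_const, Finset.card_range, h2, ← hu, ← hv, newtonPow_add_mul, ← h3]
  ring

theorem wshift_mul (w w' : ℤ → ℂ) (k k' : ℤ) :
    wshift w k * wshift w' k' = wshift (fun n => w n * w' (n + k)) (k + k') := by
  ext v n
  simp [mul_assoc, add_assoc]

theorem wshift_pow (w : ℤ → ℂ) (k : ℤ) (m : ℕ) :
    wshift w k ^ m = wshift (fun n => ∏ j ∈ Finset.range m, w (n + j * k)) (m * k) := by
  induction m with
  | zero => ext v n; simp
  | succ m ih =>
    rw [pow_succ, ih, wshift_mul]
    congr 1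
    · ext n; rw [Finset.prod_range_succ]
    · push_cast; ring

theorem algebraMap_eq_wshift (r : ℂ) :
    algebraMap ℂ (Module.End ℂ (ℤ → ℂ)) r = wshift (fun _ => r) 0 := by
  ext v n
  simp

theorem IsPrimitiveRoot.zpow_add_mul {s : ℂ} {ℓ : ℕ} (hs : IsPrimitiveRoot s ℓ) (h0 : s ≠ 0)
    (n m : ℤ) : s ^ (n + m * ℓ) = s ^ n := by
  rw [zpow_add₀ h0, mul_comm m, zpow_mul, zpow_natCast, hs.pow_eq_one, one_zpow, mul_one]

namespace OqGL2

variable {q : ℂ} {ℓ : ℕ}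

/-- The central element `z` with `det_q ^ ℓ = z d ^ ℓ - b ^ ℓ c ^ ℓ`. -/
noncomputable def corner (q : ℂ) (ℓ : ℕ) : OqGL2 q :=
  newtonPow (q ^ 2 • (L q 0 0 + (q ^ 2)⁻¹ • L q 1 1)) (q ^ 2 • qdet q (L q)) ℓ - L q 1 1 ^ ℓ

variable (hodd : Odd ℓ) (hs : IsPrimitiveRoot (q ^ 2) ℓ) (hq : q ≠ 0) (t : ℂ) (D : ℂˣ) (d : ℂ)
include hs

theorem rep_d_pow : rep hq t D d (L q 1 1 ^ ℓ) = wshift (fun _ => d ^ ℓ) 0 := by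
  rw [map_pow, rep_d, wshift_pow]
  congr 1
  ext n
  simp only [mul_zero, add_zero, Finset.prod_const, Finset.card_range]
  rw [mul_pow, ← zpow_natCast, ← zpow_mul]
  have := hs.zpow_add_mul (pow_ne_zero 2 hq) 0 n
  rw [zero_add, zpow_zero] at this
  rw [this, one_mul]

omit hs in
theorem rep_b_pow : rep hq t D d (L q 0 1 ^ ℓ) = wshift (fun _ => 1) (-ℓ) := by
  rw [map_pow, rep_b, wshift_pow]
  simp

omit hs in
theorem rep_newtonPow : rep hq t D d (newtonPow (q ^ 2 • (L q 0 0 + (q ^ 2)⁻¹ • L q 1 1))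
    (q ^ 2 • qdet q (L q)) ℓ) = wshift (fun _ => newtonPow (q ^ 2 * t) (q ^ 2 * D) ℓ) 0 := by
  rw [← algebraMap_eq_wshift, map_newtonPow, ← AlgHom.coe_toRingHom, map_newtonPow]
  simp only [AlgHom.coe_toRingHom]
  rw [map_smul, map_smul, rep_trace, rep_qdet, map_mul, map_mul, Algebra.smul_def, Algebra.smul_def]

theorem rep_corner : rep hq t D d (corner q ℓ) =
    wshift (fun _ => newtonPow (q ^ 2 * t) (q ^ 2 * D) ℓ - d ^ ℓ) 0 := by
  rw [corner, map_sub, rep_newtonPow, rep_d_pow hs]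
  ext v n
  simp [sub_mul]

include hodd in
theorem rep_c_pow : rep hq t D d (L q 1 0 ^ ℓ) =
    wshift (fun _ => (newtonPow (q ^ 2 * t) (q ^ 2 * D) ℓ - d ^ ℓ) * d ^ ℓ - (D : ℂ) ^ ℓ) ℓ := by
  rw [map_pow, rep_c, wshift_pow]
  congr 1
  · ext n
    have h0 : q ^ 2 ≠ 0 := pow_ne_zero 2 hq
    -- The ℓ sites visited from n on form one full orbit starting at s^(n+1)d; its ℓ-th power is
    -- d^ℓ, so the weight does not depend on n.
    have h1 := prod_bcVal hodd hs t D ((q ^ 2) ^ (n + 1) * d)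
    have h2 : ((q ^ 2) ^ (n + 1) * d) ^ ℓ = d ^ ℓ := by
      rw [mul_pow, ← zpow_natCast, ← zpow_mul]
      have := hs.zpow_add_mul h0 0 (n + 1)
      rw [zero_add, zpow_zero] at this
      rw [this, one_mul]
    rw [h2] at h1
    rw [← h1]
    refine Finset.prod_congr rfl fun i _ => ?_
    rw [mul_one, ← mul_assoc, show n + (i : ℤ) + 1 = i + (n + 1) by ring, zpow_add₀ h0 i,
      zpow_natCast]
  · simp

omit hs in
theorem eq_of_rep (hq : q ≠ 0) {y y' : OqGL2 q}
    (h : ∀ (t : ℂ) (D : ℂˣ) (d : ℂ), d ≠ 0 → rep hq t D d y = rep hq t D d y') : y = y' := by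
  rw [← sub_eq_zero]
  refine eq_zero_of_rep hq _ fun t D d hd => ?_
  rw [map_sub, h t D d hd, sub_self]
  rfl

omit hs in
theorem mem_center_of_commute {y : OqGL2 q} (h : ∀ i j, Commute y (L q i j)) :
    y ∈ Subalgebra.center ℂ (OqGL2 q) := by
  apply LocAt.mem_center
  have hS : (Subalgebra.centralizer ℂ {y}).comap (LocAt.of _) =
      (⊤ : Subalgebra ℂ (OqPlus q)) := by
    apply OqPlus.subalgebra_eq_top
    intro i j
    rw [Subalgebra.mem_comap, Subalgebra.mem_centralizer_iff]
    rintro _ rfl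
    exact h i j
  intro a
  have ha : a ∈ (Subalgebra.centralizer ℂ {y}).comap (LocAt.of _) := hS ▸ Algebra.mem_top
  rw [Subalgebra.mem_comap, Subalgebra.mem_centralizer_iff] at ha
  exact ha y rfl

/-- The weights of all four generators have period ℓ, so a shift by a multiple of ℓ with constant
weight commutes with them; joint faithfulness brings this back to the algebra. -/
theorem mem_center_of_rep (hq : q ≠ 0) {y : OqGL2 q} (m : ℤ)
    (h : ∀ (t : ℂ) (D : ℂˣ) (d : ℂ), ∃ N, rep hq t D d y = wshift (fun _ => N) (m * ℓ)) :
    y ∈ Subalgebra.center ℂ (OqGL2 q) := by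
  apply mem_center_of_commute
  intro i j
  refine eq_of_rep hq fun t D d _ => ?_
  obtain ⟨N, hN⟩ := h t D d
  have key : ∀ w k, (∀ n, w (n + m * ℓ) = w n) →
      wshift (fun _ => N) (m * ℓ) * wshift w k = wshift w k * wshift (fun _ => N) (m * ℓ) := by
    intro w k hw
    rw [wshift_mul, wshift_mul, add_comm]
    congr 1
    ext n
    rw [hw, mul_comm]
  have h0 : q ^ 2 ≠ 0 := pow_ne_zero 2 hq
  rw [map_mul, map_mul, hN]
  fin_cases i <;> fin_cases j
  · change _ * rep hq t D d (L q 0 0) = rep hq t D d (L q 0 0) * _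
    rw [rep_a]
    exact key _ _ fun n => by simp only [hs.zpow_add_mul h0]
  · change _ * rep hq t D d (L q 0 1) = rep hq t D d (L q 0 1) * _
    rw [rep_b]
    exact key _ _ fun n => rfl
  · change _ * rep hq t D d (L q 1 0) = rep hq t D d (L q 1 0) * _
    rw [rep_c]
    exact key _ _ fun n => by simp only [add_right_comm n (m * ℓ) 1, hs.zpow_add_mul h0]
  · change _ * rep hq t D d (L q 1 1) = rep hq t D d (L q 1 1) * _
    rw [rep_d]
    exact key _ _ fun n => by simp only [hs.zpow_add_mul h0]

theorem corner_mem_center (hq : q ≠ 0) : corner q ℓ ∈ Subalgebra.center ℂ (OqGL2 q) :=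
  mem_center_of_rep hs hq 0 fun t D d => ⟨_, by rw [rep_corner hs, zero_mul]⟩

include hodd in
theorem frobMat_mem_center (hq : q ≠ 0) (i j : Fin 2) :
    frobMat ℓ (L q) (corner q ℓ) i j ∈ Subalgebra.center ℂ (OqGL2 q) := by
  fin_cases i <;> fin_cases j
  · exact corner_mem_center hs hq
  · exact mem_center_of_rep (y := L q 0 1 ^ ℓ) hs hq (-1) fun t D d =>
      ⟨_, by rw [rep_b_pow, neg_one_mul]⟩
  · exact mem_center_of_rep (y := L q 1 0 ^ ℓ) hs hq 1 fun t D d =>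
      ⟨_, by rw [rep_c_pow hodd hs, one_mul]⟩
  · exact mem_center_of_rep (y := L q 1 1 ^ ℓ) hs hq 0 fun t D d =>
      ⟨_, by rw [rep_d_pow hs, zero_mul]⟩

include hodd in
theorem isFrobCorner_corner (hq : q ≠ 0) : IsFrobCorner q ℓ (L q) (corner q ℓ) := by
  refine ⟨corner_mem_center hs hq, eq_of_rep hq fun t D d _ => ?_⟩
  rw [map_sub, map_mul, map_mul, rep_corner hs, rep_d_pow hs, rep_b_pow, rep_c_pow hodd hs,
    map_pow, rep_qdet, ← map_pow, algebraMap_eq_wshift, wshift_mul, wshift_mul]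
  ext v n
  simp
  ring

/-- In each representation with d ≠ 0 the element d^ℓ is a nonzero scalar, and those representations
alone are already jointly faithful. -/
theorem eq_zero_of_d_pow_mul (hq : q ≠ 0) {y : OqGL2 q} (h : L q 1 1 ^ ℓ * y = 0) : y = 0 := by
  refine eq_zero_of_rep hq y fun t D d hd => ?_
  have h1 := congrArg (rep hq t D d) h
  rw [map_mul, rep_d_pow hs, ← algebraMap_eq_wshift, map_zero] at h1
  have h2 := LinearMap.congr_fun h1 (Pi.single 0 1)
  rw [Module.End.mul_apply, Module.algebraMap_end_apply, LinearMap.zero_apply] at h2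
  exact (smul_eq_zero.mp h2).resolve_left (pow_ne_zero _ hd)

end OqGL2

end FrobeniusCenter

/-! ### Central characters and algebraic independence -/

section FrobeniusPoints
open MvPolynomial

theorem detPoly_ne_zero : detPoly ≠ 0 := by
  intro h
  have := congrArg (eval (fun p : Fin 2 × Fin 2 => if p.1 = p.2 then (1 : ℂ) else 0)) h
  rw [eval_detPoly] at this
  simp at this

/-- A polynomial that vanishes at the invertible matrices with nonzero second column is zero. -/
theorem eq_zero_of_eval_eq_zero {f : MvPolynomial (Fin 2 × Fin 2) ℂ}
    (h : ∀ x : Fin 2 × Fin 2 → ℂ, x (0, 1) ≠ 0 → x (1, 1) ≠ 0 → eval x detPoly ≠ 0 →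
      eval x f = 0) : f = 0 := by
  have h0 : f * (X (0, 1) * X (1, 1) * detPoly) = 0 := by
    refine MvPolynomial.funext fun x => ?_
    simp only [map_mul, map_zero, eval_X]
    by_cases h1 : x (0, 1) = 0
    · simp [h1]
    by_cases h2 : x (1, 1) = 0
    · simp [h2]
    by_cases h3 : eval x detPoly = 0
    · simp [h3]
    rw [h x h1 h2 h3, zero_mul]
  exact (mul_eq_zero.mp h0).resolve_right
    (mul_ne_zero (mul_ne_zero (X_ne_zero _) (X_ne_zero _)) detPoly_ne_zero)

theorem coe_aeval_eq_map {σ : Type} {A B : Type} [Ring A] [Algebra ℂ A] [Ring B] [Algebra ℂ B]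
    (g : A →ₐ[ℂ] B) (y : σ → Subalgebra.center ℂ A) (y' : σ → Subalgebra.center ℂ B)
    (h : ∀ i, (y' i : B) = g (y i)) (f : MvPolynomial σ ℂ) :
    ((aeval y' f : Subalgebra.center ℂ B) : B) = g (aeval y f : Subalgebra.center ℂ A) := by
  induction f using MvPolynomial.induction_on with
  | C r =>
    rw [MvPolynomial.aeval_C, MvPolynomial.aeval_C]
    exact (g.commutes r).symm
  | add f f' hf hf' => rw [map_add, map_add, AddMemClass.coe_add, hf, hf', ← map_add]; rfl
  | mul_X f i hf =>
    rw [map_mul, map_mul, MulMemClass.coe_mul, hf, aeval_X, aeval_X, h, ← map_mul]; rfl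

namespace OqGL2

variable {q : ℂ} {ℓ : ℕ}

/-- The entries of the matrix `(z, b ^ ℓ; c ^ ℓ, d ^ ℓ)`, as central elements. -/
noncomputable def frobEntry (hodd : Odd ℓ) (hs : IsPrimitiveRoot (q ^ 2) ℓ) (hq : q ≠ 0)
    (p : Fin 2 × Fin 2) : Subalgebra.center ℂ (OqGL2 q) :=
  ⟨frobMat ℓ (L q) (corner q ℓ) p.1 p.2, frobMat_mem_center hodd hs hq p.1 p.2⟩

variable (hodd : Odd ℓ) (hs : IsPrimitiveRoot (q ^ 2) ℓ) (hq : q ≠ 0)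
include hodd hs hq

/-- Every invertible matrix with nonzero second column is the central character of a vector in some
representation of `O_q(BB⁻)`. -/
theorem exists_functional {x : Fin 2 × Fin 2 → ℂ} (h01 : x (0, 1) ≠ 0) (h11 : x (1, 1) ≠ 0)
    (hdet : eval x detPoly ≠ 0) :
    ∃ φ : OqBB q →ₗ[ℂ] ℂ, ∀ f : MvPolynomial (Fin 2 × Fin 2) ℂ,
      φ (OqBB.of q (aeval (frobEntry hodd hs hq) f : Subalgebra.center ℂ (OqGL2 q))) =
        eval x f := by
  have hs0 : q ^ 2 ≠ 0 := pow_ne_zero 2 hq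
  have hpos := hodd.pos
  obtain ⟨d, hd⟩ := IsAlgClosed.exists_pow_nat_eq (x (1, 1)) hpos
  obtain ⟨β, hβ⟩ := IsAlgClosed.exists_pow_nat_eq (x (0, 1)) hpos
  obtain ⟨D, hD⟩ := IsAlgClosed.exists_pow_nat_eq (eval x detPoly) hpos
  -- u and v are the eigenvalues of x: as z is the power sum minus d^ℓ, the power sum has to be the
  -- trace of x for z to take the value x₀₀.
  obtain ⟨u, v, huv, huv'⟩ := exists_add_mul_eq (x (0, 0) + x (1, 1)) (eval x detPoly)
  have hd0 : d ≠ 0 := by rintro rfl; rw [zero_pow hpos.ne'] at hd; exact h11 hd.symm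
  have hβ0 : β ≠ 0 := by rintro rfl; rw [zero_pow hpos.ne'] at hβ; exact h01 hβ.symm
  have hD0 : D ≠ 0 := by rintro rfl; rw [zero_pow hpos.ne'] at hD; exact hdet hD.symm
  have hu0 : u ≠ 0 := by rintro rfl; rw [zero_mul] at huv'; exact hdet huv'.symm
  obtain ⟨lam, hlam⟩ := IsAlgClosed.exists_pow_nat_eq u hpos
  have hlam0 : lam ≠ 0 := by rintro rfl; rw [zero_pow hpos.ne'] at hlam; exact hu0 hlam.symm
  -- An arbitrary ℓ-th root of v would not do: lam · mu must equal q²D itself. That mu ^ ℓ = v is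
  -- then a consequence.
  set mu := q ^ 2 * D / lam with hmu
  have hmul : mu ^ ℓ = v := by
    rw [hmu, div_pow, mul_pow, hs.pow_eq_one, one_mul, hD, hlam, ← huv']
    field_simp
  set t := (q ^ 2)⁻¹ * (lam + mu) with ht
  have hT : newtonPow (q ^ 2 * t) (q ^ 2 * D) ℓ = x (0, 0) + x (1, 1) := by
    have h1 : q ^ 2 * t = lam + mu := by rw [ht]; field_simp
    have h2 : q ^ 2 * D = lam * mu := by rw [hmu]; field_simp
    rw [h1, h2, newtonPow_add_mul, hlam, hmul, huv]
  let ρ := rep hq t (Units.mk0 D hD0) d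
  have hunit : IsUnit (ρ (L q 1 1)) := by
    have h1 : wshift (fun n => (q ^ 2) ^ n * d) 0 * wshift (fun n => ((q ^ 2) ^ n * d)⁻¹) 0 = 1 := by
      ext v n
      have : (q ^ 2) ^ n * d ≠ 0 := mul_ne_zero (zpow_ne_zero _ hs0) hd0
      simp only [Module.End.mul_apply, wshift_apply, add_zero, Module.End.one_apply]
      field_simp
    have h2 : wshift (fun n => ((q ^ 2) ^ n * d)⁻¹) 0 * wshift (fun n => (q ^ 2) ^ n * d) 0 = 1 := by
      ext v n
      have : (q ^ 2) ^ n * d ≠ 0 := mul_ne_zero (zpow_ne_zero _ hs0) hd0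
      simp only [Module.End.mul_apply, wshift_apply, add_zero, Module.End.one_apply]
      field_simp
    rw [rep_d]
    exact ⟨⟨_, _, h1, h2⟩, rfl⟩
  let ρ' : OqBB q →ₐ[ℂ] Module.End ℂ (ℤ → ℂ) := LocAt.lift ρ hunit
  -- A geometric sequence is an eigenvector of every shift with constant weight. The shift b^ℓ, by
  -- −ℓ, acts by β^ℓ, and the eigenvalue of c^ℓ then comes out as (x₀₀x₁₁ − det x)/x₀₁.
  let w : ℤ → ℂ := fun n => β ^ (-n)
  have hw : ∀ N : ℂ, ∀ k : ℤ, wshift (fun _ => N) k w = (N * β ^ (-k)) • w := by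
    intro N k
    ext n
    simp only [w, wshift_apply, Pi.smul_apply, smul_eq_mul, neg_add, zpow_add₀ hβ0]
    ring
  have hgen : ∀ p, ρ (frobEntry hodd hs hq p : OqGL2 q) w = x p • w := by
    rintro ⟨i, j⟩
    fin_cases i <;> fin_cases j
    · change ρ (corner q ℓ) w = x (0, 0) • w
      rw [rep_corner hs, hw, neg_zero, zpow_zero, mul_one, Units.val_mk0, hT, hd,
        add_sub_cancel_right]
    · change ρ (L q 0 1 ^ ℓ) w = x (0, 1) • w
      rw [rep_b_pow, hw, neg_neg, one_mul, zpow_natCast, hβ]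
    · change ρ (L q 1 0 ^ ℓ) w = x (1, 0) • w
      rw [rep_c_pow hodd hs, hw, zpow_neg, zpow_natCast, hβ, Units.val_mk0, hT, hd, hD,
        eval_detPoly]
      congr 1
      field_simp
      ring
    · change ρ (L q 1 1 ^ ℓ) w = x (1, 1) • w
      rw [rep_d_pow hs, hw, neg_zero, zpow_zero, mul_one, hd]
  have hpoly : ∀ f : MvPolynomial (Fin 2 × Fin 2) ℂ,
      ρ (aeval (frobEntry hodd hs hq) f : Subalgebra.center ℂ (OqGL2 q)) w = eval x f • w := by
    intro f
    induction f using MvPolynomial.induction_on with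
    | C r =>
      rw [MvPolynomial.aeval_C, eval_C]
      change ρ (algebraMap ℂ (OqGL2 q) r) w = r • w
      rw [ρ.commutes, Module.algebraMap_end_apply]
    | add f f' hf hf' =>
      rw [map_add, AddMemClass.coe_add, map_add, LinearMap.add_apply, hf, hf', map_add, add_smul]
    | mul_X f i hf =>
      rw [map_mul, MulMemClass.coe_mul, aeval_X, map_mul, Module.End.mul_apply, hgen, map_smul, hf,
        map_mul, eval_X, smul_smul, mul_comm]
  -- Act on w and read the coordinate at 0, where w has the value 1.
  refine ⟨(LinearMap.proj (0 : ℤ)).comp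
    ((LinearMap.applyₗ w).comp ρ'.toLinearMap), fun f => ?_⟩
  have h1 : ρ' (OqBB.of q (aeval (frobEntry hodd hs hq) f : Subalgebra.center ℂ (OqGL2 q))) =
      ρ (aeval (frobEntry hodd hs hq) f : Subalgebra.center ℂ (OqGL2 q)) := LocAt.lift_of ρ hunit _
  simp only [LinearMap.comp_apply, AlgHom.toLinearMap_apply, h1, LinearMap.applyₗ_apply_apply,
    hpoly, LinearMap.proj_apply, w, Pi.smul_apply, neg_zero, zpow_zero, smul_eq_mul, mul_one]

omit hodd hs in
theorem detInv_mem_center : detInv q ∈ Subalgebra.center ℂ (OqGL2 q) := by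
  obtain ⟨Da, Db, Dc, Dd⟩ := (reaRel hq).commute_det (pow_ne_zero 2 hq)
  have h1 : qdet q (L q) ∈ Subalgebra.center ℂ (OqGL2 q) := by
    apply mem_center_of_commute
    intro i j
    fin_cases i <;> fin_cases j
    exacts [Da, Db, Dc, Dd]
  rw [Subalgebra.mem_center_iff] at h1 ⊢
  intro y
  have h2 := h1 y
  rw [qdet_eq] at h2
  exact LocAt.commute_inv h2

omit hodd hs in
/-- The element `det_q ^ (-ℓ)`, as a central element. -/
noncomputable def detInvPow (ℓ : ℕ) : Subalgebra.center ℂ (OqGL2 q) :=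
  ⟨detInv q ^ ℓ, pow_mem (detInv_mem_center hq) ℓ⟩

theorem coe_aeval_detPoly :
    ((aeval (frobEntry hodd hs hq) detPoly : Subalgebra.center ℂ (OqGL2 q)) : OqGL2 q) =
      qdet q (L q) ^ ℓ := by
  rw [(isFrobCorner_corner hodd hs hq).2, detPoly, map_sub, map_mul, map_mul, aeval_X, aeval_X,
    aeval_X, aeval_X]
  rfl

theorem aeval_detPoly_mul :
    aeval (frobEntry hodd hs hq) detPoly * detInvPow hq ℓ = 1 := by
  apply Subtype.ext
  rw [MulMemClass.coe_mul, coe_aeval_detPoly]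
  change qdet q (L q) ^ ℓ * detInv q ^ ℓ = 1
  have hc : Commute (qdet q (L q)) (detInv q) :=
    mul_detInv.trans detInv_mul.symm
  rw [← hc.mul_pow, mul_detInv, one_pow]

/-- The functionals are defined on O_q(BB⁻), d being invertible in the chosen representations. They
thus show independence after inverting d as well, without a prior proof that O_q(GL₂) embeds in its
localization. -/
theorem map_aeval_injective {f : MvPolynomial (Fin 2 × Fin 2) ℂ}
    (hf : OqBB.of q (aeval (frobEntry hodd hs hq) f : Subalgebra.center ℂ (OqGL2 q)) = 0) :
    f = 0 := by
  refine eq_zero_of_eval_eq_zero fun x h1 h2 h3 => ?_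
  obtain ⟨φ, hφ⟩ := exists_functional hodd hs hq h1 h2 h3
  rw [← hφ, hf, map_zero]

theorem aeval_injective : Function.Injective (aeval (R := ℂ) (frobEntry hodd hs hq)) := by
  rw [injective_iff_map_eq_zero]
  intro f hf
  apply map_aeval_injective hodd hs hq
  rw [hf]
  exact map_zero _

end OqGL2

end FrobeniusPoints

/-! ### The Frobenius centers of O_q(GL₂) and O_q(BB⁻) -/

section MainOq
open MvPolynomial

namespace OqGL2

variable {q : ℂ} {ℓ : ℕ} (hodd : Odd ℓ) (hs : IsPrimitiveRoot (q ^ 2) ℓ) (hq : q ≠ 0)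
include hodd hs hq

theorem corner_unique (z : OqGL2 q) (hz : IsFrobCorner q ℓ (L q) z) : z = corner q ℓ := by
  have h1 : z * L q 1 1 ^ ℓ = corner q ℓ * L q 1 1 ^ ℓ :=
    sub_left_injective (hz.2.symm.trans (isFrobCorner_corner hodd hs hq).2)
  rw [← sub_eq_zero]
  refine eq_zero_of_d_pow_mul hs hq ?_
  have hd : L q 1 1 ^ ℓ ∈ Subalgebra.center ℂ (OqGL2 q) := frobMat_mem_center hodd hs hq 1 1
  rw [← (Subalgebra.mem_center_iff.mp hd _), sub_mul, h1, sub_self]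

theorem ell_eq_adjoin : OqEll q ℓ (corner q ℓ) = Algebra.adjoin ℂ
    (Set.range (fun p => (frobEntry hodd hs hq p : OqGL2 q)) ∪
      {(detInvPow hq ℓ : OqGL2 q)}) := rfl

theorem ell_le_center : OqEll q ℓ (corner q ℓ) ≤ Subalgebra.center ℂ (OqGL2 q) := by
  rw [ell_eq_adjoin hodd hs hq, Algebra.adjoin_le_iff]
  rintro _ (⟨p, rfl⟩ | h)
  · exact (frobEntry hodd hs hq p).2
  · rw [Set.mem_singleton_iff.mp h]
    exact (detInvPow hq ℓ).2

omit hodd hs hq in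
theorem map_mem_center {y : OqGL2 q} (hy : y ∈ Subalgebra.center ℂ (OqGL2 q)) :
    OqBB.of q y ∈ Subalgebra.center ℂ (OqBB q) :=
  LocAt.mem_center fun a => Commute.map (Subalgebra.mem_center_iff.mp hy a).symm (OqBB.of q)

theorem dInv_pow_mem_center : OqBB.dInv q ^ ℓ ∈ Subalgebra.center ℂ (OqBB q) := by
  have hd := map_mem_center (frobMat_mem_center hodd hs hq 1 1)
  have hc : Commute (OqBB.of q (L q 1 1)) (OqBB.dInv q) :=
    (LocAt.mul_inv (L q 1 1)).trans (LocAt.inv_mul (L q 1 1)).symm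
  have h1 : OqBB.of q (L q 1 1 ^ ℓ) * OqBB.dInv q ^ ℓ = 1 := by
    rw [map_pow, ← hc.mul_pow]
    exact (congrArg (· ^ ℓ) (LocAt.mul_inv (L q 1 1))).trans (one_pow ℓ)
  have h2 : OqBB.dInv q ^ ℓ * OqBB.of q (L q 1 1 ^ ℓ) = 1 := by
    rw [map_pow, ← hc.symm.mul_pow]
    exact (congrArg (· ^ ℓ) (LocAt.inv_mul (L q 1 1))).trans (one_pow ℓ)
  rw [Subalgebra.mem_center_iff] at hd ⊢
  intro y
  exact Commute.units_inv_right (u := ⟨_, _, h1, h2⟩) (hd y)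

/-- The entries of the matrix `(z, b ^ ℓ; c ^ ℓ, d ^ ℓ)`, as central elements of `O_q(BB⁻)`. -/
noncomputable def frobEntryBB (p : Fin 2 × Fin 2) : Subalgebra.center ℂ (OqBB q) :=
  ⟨OqBB.of q (frobEntry hodd hs hq p), map_mem_center (frobEntry hodd hs hq p).2⟩

/-- The element `det_q ^ (-ℓ) d ^ (-ℓ)`, as a central element of `O_q(BB⁻)`. -/
noncomputable def invPowBB : Subalgebra.center ℂ (OqBB q) :=
  ⟨OqBB.of q (detInvPow hq ℓ), map_mem_center (detInvPow hq ℓ).2⟩ *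
    ⟨OqBB.dInv q ^ ℓ, dInv_pow_mem_center hodd hs hq⟩

omit hodd hs hq in
theorem d_pow_mul_dInv_pow : OqBB.of q (L q 1 1 ^ ℓ) * OqBB.dInv q ^ ℓ = 1 := by
  have hc : Commute (OqBB.of q (L q 1 1)) (OqBB.dInv q) :=
    (LocAt.mul_inv (L q 1 1)).trans (LocAt.inv_mul (L q 1 1)).symm
  rw [map_pow, ← hc.mul_pow]
  exact (congrArg (· ^ ℓ) (LocAt.mul_inv (L q 1 1))).trans (one_pow ℓ)

theorem coe_aeval_frobEntryBB (f : MvPolynomial (Fin 2 × Fin 2) ℂ) :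
    ((aeval (frobEntryBB hodd hs hq) f : Subalgebra.center ℂ (OqBB q)) : OqBB q) =
      OqBB.of q (aeval (frobEntry hodd hs hq) f : Subalgebra.center ℂ (OqGL2 q)) :=
  coe_aeval_eq_map (OqBB.of q) _ _ (fun _ => rfl) f

theorem aeval_detPoly_mul_X_mul :
    aeval (frobEntryBB hodd hs hq) (detPoly * X (1, 1)) * invPowBB hodd hs hq = 1 := by
  apply Subtype.ext
  rw [MulMemClass.coe_mul, coe_aeval_frobEntryBB, map_mul, MulMemClass.coe_mul, aeval_X, map_mul]
  change OqBB.of q _ * OqBB.of q (L q 1 1 ^ ℓ) * (OqBB.of q _ * OqBB.dInv q ^ ℓ) = 1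
  have h1 : OqBB.of q (aeval (frobEntry hodd hs hq) detPoly : Subalgebra.center ℂ (OqGL2 q)) *
      OqBB.of q (detInvPow hq ℓ) = 1 := by
    rw [← map_mul, ← MulMemClass.coe_mul, aeval_detPoly_mul]
    exact map_one _
  have hd : OqBB.of q (L q 1 1 ^ ℓ) ∈ Subalgebra.center ℂ (OqBB q) :=
    map_mem_center (frobMat_mem_center hodd hs hq 1 1)
  have hc : Commute (OqBB.of q (L q 1 1 ^ ℓ)) (OqBB.of q (detInvPow hq ℓ)) :=
    (Subalgebra.mem_center_iff.mp hd _).symm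
  rw [hc.mul_mul_mul_comm, h1, d_pow_mul_dInv_pow, one_mul]

/-- Inverting the single element det_q^ℓ d^ℓ inverts both factors: multiply the inverse by d^ℓ, or
by det_q^ℓ = z d^ℓ − b^ℓ c^ℓ. This is the form with one inverted polynomial that
`exists_regularFunctions_algEquiv` takes. -/
theorem ellBB_eq_adjoin : OqEllBB q ℓ (corner q ℓ) = Algebra.adjoin ℂ
    (Set.range (fun p => (frobEntryBB hodd hs hq p : OqBB q)) ∪
      {(invPowBB hodd hs hq : OqBB q)}) := by
  have hmem : ∀ p, (frobEntryBB hodd hs hq p : OqBB q) ∈ Algebra.adjoin ℂ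
      (Set.range (fun p => (frobEntryBB hodd hs hq p : OqBB q)) ∪
        {(invPowBB hodd hs hq : OqBB q)}) := fun p => Algebra.subset_adjoin (by simp)
  have hinv : (invPowBB hodd hs hq : OqBB q) ∈ Algebra.adjoin ℂ
      (Set.range (fun p => (frobEntryBB hodd hs hq p : OqBB q)) ∪
        {(invPowBB hodd hs hq : OqBB q)}) := Algebra.subset_adjoin (by simp)
  have hone := congrArg Subtype.val (aeval_detPoly_mul_X_mul hodd hs hq)
  apply le_antisymm
  · rw [OqEllBB, Algebra.adjoin_le_iff]
    rintro _ (⟨y, hy, rfl⟩ | h)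
    · have hle : (OqEll q ℓ (corner q ℓ)).map (OqBB.of q) ≤ Algebra.adjoin ℂ
          (Set.range (fun p => (frobEntryBB hodd hs hq p : OqBB q)) ∪
            {(invPowBB hodd hs hq : OqBB q)}) := by
        rw [ell_eq_adjoin hodd hs hq, AlgHom.map_adjoin, Algebra.adjoin_le_iff]
        rintro _ ⟨_, ⟨p, rfl⟩ | h, rfl⟩
        · exact hmem p
        · rw [Set.mem_singleton_iff.mp h]
          have : OqBB.of q (detInvPow hq ℓ) = (frobEntryBB hodd hs hq (1, 1) : OqBB q) *
              (invPowBB hodd hs hq : OqBB q) := by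
            change _ = OqBB.of q (L q 1 1 ^ ℓ) * (OqBB.of q _ * OqBB.dInv q ^ ℓ)
            have hd := (dInv_pow_mem_center hodd hs hq)
            rw [Subalgebra.mem_center_iff] at hd
            rw [hd, ← mul_assoc, d_pow_mul_dInv_pow, one_mul]
          rw [this]
          exact mul_mem (hmem _) hinv
      exact hle ⟨y, hy, rfl⟩
    · rw [Set.mem_singleton_iff.mp h]
      have h1 : OqBB.of q (qdet q (L q) ^ ℓ) * OqBB.of q (detInvPow hq ℓ) = 1 := by
        rw [← coe_aeval_detPoly hodd hs hq, ← map_mul, ← MulMemClass.coe_mul,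
          aeval_detPoly_mul hodd hs hq]
        exact map_one _
      have : OqBB.dInv q ^ ℓ = OqBB.of q (qdet q (L q) ^ ℓ) *
          (invPowBB hodd hs hq : OqBB q) := by
        change _ = _ * (OqBB.of q _ * OqBB.dInv q ^ ℓ)
        rw [← mul_assoc, h1, one_mul]
      rw [this, (isFrobCorner_corner hodd hs hq).2, map_sub, map_mul, map_mul]
      exact mul_mem (sub_mem (mul_mem (hmem (0, 0)) (hmem (1, 1)))
        (mul_mem (hmem (0, 1)) (hmem (1, 0)))) hinv
  · rw [Algebra.adjoin_le_iff]
    rintro _ (⟨p, rfl⟩ | h)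
    · exact Algebra.subset_adjoin (Or.inl ⟨_, Algebra.subset_adjoin (Or.inl ⟨p, rfl⟩), rfl⟩)
    · rw [Set.mem_singleton_iff.mp h]
      exact mul_mem (Algebra.subset_adjoin
        (Or.inl ⟨_, Algebra.subset_adjoin (Or.inr rfl), rfl⟩)) (Algebra.subset_adjoin (Or.inr rfl))

theorem ellBB_le_center : OqEllBB q ℓ (corner q ℓ) ≤ Subalgebra.center ℂ (OqBB q) := by
  rw [ellBB_eq_adjoin hodd hs hq, Algebra.adjoin_le_iff]
  rintro _ (⟨p, rfl⟩ | h)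
  · exact (frobEntryBB hodd hs hq p).2
  · rw [Set.mem_singleton_iff.mp h]
    exact (invPowBB hodd hs hq).2

theorem aeval_frobEntryBB_injective :
    Function.Injective (aeval (R := ℂ) (frobEntryBB hodd hs hq)) := by
  rw [injective_iff_map_eq_zero]
  intro f hf
  apply map_aeval_injective hodd hs hq
  rw [← coe_aeval_frobEntryBB, hf]
  rfl

/-- An element of the subalgebra is a polynomial in the central entries times a power of det_q^(−ℓ).
Clearing that unit in O_q(BB⁻) leaves a polynomial, to which `map_aeval_injective` applies. -/
theorem injOn_ell : Set.InjOn (OqBB.of q) (OqEll q ℓ (corner q ℓ)) := by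
  intro y hy y' hy' h
  rw [← sub_eq_zero]
  have hmem : y - y' ∈ OqEll q ℓ (corner q ℓ) := sub_mem hy hy'
  obtain ⟨n, g, hg⟩ := (exists_regularFunctions_algEquiv exists_glCoord_eq eval_glCoord_ne_zero
    (frobEntry hodd hs hq) (detInvPow hq ℓ) (aeval_detPoly_mul hodd hs hq)
    (aeval_injective hodd hs hq) _ (ell_eq_adjoin hodd hs hq)).2 _ hmem
  have h0 : OqBB.of q (y - y') = 0 := by rw [map_sub, h, sub_self]
  have h1 : OqBB.of q ((detInvPow hq ℓ : OqGL2 q) ^ n) *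
      OqBB.of q ((aeval (frobEntry hodd hs hq) detPoly : Subalgebra.center ℂ (OqGL2 q)) ^ n) =
      1 := by
    rw [← map_mul]
    have := congrArg (fun u => ((u ^ n : Subalgebra.center ℂ (OqGL2 q)) : OqGL2 q))
      (aeval_detPoly_mul hodd hs hq)
    simp only [one_pow, mul_comm, mul_pow] at this
    exact (congrArg (OqBB.of q) this).trans (map_one _)
  have h2 : OqBB.of q (aeval (frobEntry hodd hs hq) g : Subalgebra.center ℂ (OqGL2 q)) = 0 := by
    rw [← mul_one (OqBB.of q _), ← h1, ← mul_assoc, ← map_mul, ← hg, h0, zero_mul]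
  rw [hg, map_aeval_injective hodd hs hq h2, map_zero]
  exact zero_mul _

theorem exists_frobenius_center :
    ∃ z : OqGL2 q,
      (IsFrobCorner q ℓ (OqGL2.L q) z ∧ ∀ z', IsFrobCorner q ℓ (OqGL2.L q) z' → z' = z) ∧
      OqEll q ℓ z ≤ Subalgebra.center ℂ (OqGL2 q) ∧
      (∃ Φ : regularFunctions glCoord ≃ₐ[ℂ] OqEll q ℓ z,
        ∀ i j, (Φ (coordFn glCoord (i, j)) : OqGL2 q) = frobMat ℓ (OqGL2.L q) z i j) ∧
      Set.InjOn (OqBB.of q) (OqEll q ℓ z) ∧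
      OqEllBB q ℓ z ≤ Subalgebra.center ℂ (OqBB q) ∧
      (∃ Ψ : regularFunctions bbCoord ≃ₐ[ℂ] OqEllBB q ℓ z,
        ∀ i j, (Ψ (coordFn bbCoord (i, j)) : OqBB q) =
          OqBB.of q (frobMat ℓ (OqGL2.L q) z i j)) := by
  obtain ⟨⟨Φ, hΦ⟩, _⟩ := exists_regularFunctions_algEquiv exists_glCoord_eq eval_glCoord_ne_zero
    (frobEntry hodd hs hq) (detInvPow hq ℓ) (aeval_detPoly_mul hodd hs hq)
    (aeval_injective hodd hs hq) _ (ell_eq_adjoin hodd hs hq)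
  obtain ⟨⟨Ψ, hΨ⟩, _⟩ := exists_regularFunctions_algEquiv exists_bbCoord_eq eval_bbCoord_ne_zero
    (frobEntryBB hodd hs hq) (invPowBB hodd hs hq) (aeval_detPoly_mul_X_mul hodd hs hq)
    (aeval_frobEntryBB_injective hodd hs hq) _ (ellBB_eq_adjoin hodd hs hq)
  exact ⟨corner q ℓ, ⟨isFrobCorner_corner hodd hs hq, corner_unique hodd hs hq⟩,
    ell_le_center hodd hs hq, ⟨Φ, fun i j => hΦ (i, j)⟩, injOn_ell hodd hs hq,
    ellBB_le_center hodd hs hq, ⟨Ψ, fun i j => hΨ (i, j)⟩⟩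

end OqGL2

end MainOq

/-! ### The 4 × 4 matrices of the cross relations -/

section CrossMatrices
variable {A : Type*} [Ring A] [Algebra ℂ A]

/-- The matrices through which the entries of `X` move to the left of the column vector of the
entries of `D` (in the order `∂₁₁, ∂₁₂, ∂₂₁, ∂₂₂`) by the cross relations. -/
noncomputable def crossMatA (s : ℂ) (a b c d : A) : Matrix (Fin 4) (Fin 4) A :=
  !![s⁻¹ • a + ((1 - s⁻¹) * (1 - s⁻¹)) • d, -((1 - s⁻¹) • c),
      (s⁻¹ - s⁻¹ * s⁻¹ - (1 - s⁻¹) * (s - 2 + s⁻¹)) • b,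
      ((1 - s⁻¹) * (1 - s⁻¹)) • a - ((1 - s⁻¹) * (1 - s⁻¹)) • d;
    (s⁻¹ - 1) • b, a, 0, (1 - s⁻¹) • b;
    0, 0, s⁻¹ • a + ((1 - s⁻¹) * (1 - s⁻¹)) • d, -((s⁻¹ - s⁻¹ * s⁻¹) • c);
    0, 0, (1 - s) • b, a]

/-- See `crossMatA`. -/
noncomputable def crossMatB (s : ℂ) (b d : A) : Matrix (Fin 4) (Fin 4) A :=
  !![s⁻¹ • b, -((s⁻¹ - s⁻¹ * s⁻¹) • d), 0, ((1 - s⁻¹) * (1 - s⁻¹)) • b;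
    0, s⁻¹ • b, 0, 0;
    0, 0, b, -((s⁻¹ - s⁻¹ * s⁻¹) • d);
    0, 0, 0, b]

/-- See `crossMatA`. -/
noncomputable def crossMatC (s : ℂ) (a b c d : A) : Matrix (Fin 4) (Fin 4) A :=
  !![c, 0, (1 - s⁻¹) • d + (s⁻¹ - 1) • a, 0;
    (s⁻¹ - 1) • d, c, (s - 2 + s⁻¹) • b, (s⁻¹ - 1) • a + (1 - s⁻¹) • d;
    0, 0, s⁻¹ • c, 0;
    0, 0, (s⁻¹ - 1) • d, s⁻¹ • c]

/-- See `crossMatA`. -/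
noncomputable def crossMatD (s : ℂ) (b d : A) : Matrix (Fin 4) (Fin 4) A :=
  !![d, 0, (1 - s) • b, 0;
    0, s⁻¹ • d, 0, (s⁻¹ - 1) • b;
    0, 0, d, 0;
    0, 0, 0, s⁻¹ • d]

omit [Algebra ℂ A] in
theorem mul_apply_fin_four (M N : Matrix (Fin 4) (Fin 4) A) (i j : Fin 4) :
    (M * N) i j = M i 0 * N 0 j + M i 1 * N 1 j + M i 2 * N 2 j + M i 3 * N 3 j := by
  rw [Matrix.mul_apply, Fin.sum_univ_four]

variable {s : ℂ} {a b c d : A}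

set_option linter.unusedSimpArgs false
set_option linter.unnecessarySeqFocus false

/-- This and the next five lemmas express that the cross relations are compatible with the
reflection equation for X: moving an entry of D past the two sides of a relation must give the same
result. Each is checked entry by entry after sorting. -/
theorem ReaRel.crossMat_db (h : ReaRel s a b c d) (hs : s ≠ 0) :
    crossMatD s b d * crossMatB s b d =
      s • (crossMatB s b d * crossMatD s b d) := by
  have db := h.db
  have cd := h.cd
  have da := h.da
  have ba := h.ba
  have ca := h.ca
  have cb := h.cb
  ext i j
  simp only [Matrix.add_apply, Matrix.sub_apply, Matrix.smul_apply, mul_apply_fin_four]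
  fin_cases i <;> fin_cases j <;>
    simp [crossMatA, crossMatB, crossMatC, crossMatD, -smul_eq_mul] <;>
    (try simp only [mul_add, add_mul, mul_sub, sub_mul, smul_add, smul_sub, neg_mul, mul_neg,
      smul_mul_assoc, mul_smul_comm, db, cd, da, ba, ca, cb]) <;>
    match_scalars <;> field_simp <;> ring

theorem ReaRel.crossMat_cd (h : ReaRel s a b c d) (hs : s ≠ 0) :
    crossMatC s a b c d * crossMatD s b d =
      s • (crossMatD s b d * crossMatC s a b c d) := by
  have db := h.db
  have cd := h.cd
  have da := h.da
  have ba := h.ba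
  have ca := h.ca
  have cb := h.cb
  ext i j
  simp only [Matrix.add_apply, Matrix.sub_apply, Matrix.smul_apply, mul_apply_fin_four]
  fin_cases i <;> fin_cases j <;>
    simp [crossMatA, crossMatB, crossMatC, crossMatD, -smul_eq_mul] <;>
    (try simp only [mul_add, add_mul, mul_sub, sub_mul, smul_add, smul_sub, neg_mul, mul_neg,
      smul_mul_assoc, mul_smul_comm, db, cd, da, ba, ca, cb]) <;>
    match_scalars <;> field_simp <;> ring

theorem ReaRel.crossMat_da (h : ReaRel s a b c d) (hs : s ≠ 0) :
    crossMatD s b d * crossMatA s a b c d =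
      crossMatA s a b c d * crossMatD s b d := by
  have db := h.db
  have cd := h.cd
  have da := h.da
  have ba := h.ba
  have ca := h.ca
  have cb := h.cb
  ext i j
  simp only [Matrix.add_apply, Matrix.sub_apply, Matrix.smul_apply, mul_apply_fin_four]
  fin_cases i <;> fin_cases j <;>
    simp [crossMatA, crossMatB, crossMatC, crossMatD, -smul_eq_mul] <;>
    (try simp only [mul_add, add_mul, mul_sub, sub_mul, smul_add, smul_sub, neg_mul, mul_neg,
      smul_mul_assoc, mul_smul_comm, db, cd, da, ba, ca, cb]) <;>
    match_scalars <;> field_simp <;> ring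

theorem ReaRel.crossMat_ba (h : ReaRel s a b c d) (hs : s ≠ 0) :
    crossMatB s b d * crossMatA s a b c d =
      crossMatA s a b c d * crossMatB s b d + (1 - s⁻¹) • (crossMatB s b d * crossMatD s b d) := by
  have db := h.db
  have cd := h.cd
  have da := h.da
  have ba := h.ba
  have ca := h.ca
  have cb := h.cb
  ext i j
  simp only [Matrix.add_apply, Matrix.sub_apply, Matrix.smul_apply, mul_apply_fin_four]
  fin_cases i <;> fin_cases j <;>
    simp [crossMatA, crossMatB, crossMatC, crossMatD, -smul_eq_mul] <;>
    (try simp only [mul_add, add_mul, mul_sub, sub_mul, smul_add, smul_sub, neg_mul, mul_neg,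
      smul_mul_assoc, mul_smul_comm, db, cd, da, ba, ca, cb]) <;>
    match_scalars <;> field_simp <;> ring

theorem ReaRel.crossMat_ca (h : ReaRel s a b c d) (hs : s ≠ 0) :
    crossMatC s a b c d * crossMatA s a b c d =
      crossMatA s a b c d * crossMatC s a b c d - (1 - s⁻¹) • (crossMatD s b d * crossMatC s a b c d) := by
  have db := h.db
  have cd := h.cd
  have da := h.da
  have ba := h.ba
  have ca := h.ca
  have cb := h.cb
  ext i j
  simp only [Matrix.add_apply, Matrix.sub_apply, Matrix.smul_apply, mul_apply_fin_four]
  fin_cases i <;> fin_cases j <;>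
    simp [crossMatA, crossMatB, crossMatC, crossMatD, -smul_eq_mul] <;>
    (try simp only [mul_add, add_mul, mul_sub, sub_mul, smul_add, smul_sub, neg_mul, mul_neg,
      smul_mul_assoc, mul_smul_comm, db, cd, da, ba, ca, cb]) <;>
    match_scalars <;> field_simp <;> ring

theorem ReaRel.crossMat_cb (h : ReaRel s a b c d) (hs : s ≠ 0) :
    crossMatC s a b c d * crossMatB s b d =
      crossMatB s b d * crossMatC s a b c d +
        (1 - s⁻¹) • (crossMatA s a b c d * crossMatD s b d - crossMatD s b d * crossMatD s b d) := by
  have db := h.db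
  have cd := h.cd
  have da := h.da
  have ba := h.ba
  have ca := h.ca
  have cb := h.cb
  ext i j
  simp only [Matrix.add_apply, Matrix.sub_apply, Matrix.smul_apply, mul_apply_fin_four]
  fin_cases i <;> fin_cases j <;>
    simp [crossMatA, crossMatB, crossMatC, crossMatD, -smul_eq_mul] <;>
    (try simp only [mul_add, add_mul, mul_sub, sub_mul, smul_add, smul_sub, neg_mul, mul_neg,
      smul_mul_assoc, mul_smul_comm, db, cd, da, ba, ca, cb]) <;>
    match_scalars <;> field_simp <;> ring

/-- Each entry of D thus passes det_q(X) with the factor s⁻¹. Being diagonal, the image of the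
determinant is invertible, so the matrices define a homomorphism on the localization O_q(GL₂). -/
theorem ReaRel.det_crossMat (h : ReaRel s a b c d) (hs : s ≠ 0) :
    crossMatA s a b c d * crossMatD s b d - s • (crossMatB s b d * crossMatC s a b c d) =
      Matrix.diagonal fun _ => s⁻¹ • (a * d - s • (b * c)) := by
  have db := h.db
  have cd := h.cd
  have da := h.da
  have ba := h.ba
  have ca := h.ca
  have cb := h.cb
  ext i j
  simp only [Matrix.add_apply, Matrix.sub_apply, Matrix.smul_apply, mul_apply_fin_four]
  fin_cases i <;> fin_cases j <;>
    simp [crossMatA, crossMatB, crossMatC, crossMatD, -smul_eq_mul] <;>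
    (try simp only [mul_add, add_mul, mul_sub, sub_mul, smul_add, smul_sub, neg_mul, mul_neg,
      smul_mul_assoc, mul_smul_comm, db, cd, da, ba, ca, cb]) <;>
    match_scalars <;> field_simp <;> ring

theorem ReaRel.crossMat (h : ReaRel s a b c d) (hs : s ≠ 0) :
    ReaRel s (crossMatA s a b c d) (crossMatB s b d) (crossMatC s a b c d) (crossMatD s b d) :=
  ⟨h.crossMat_db hs, h.crossMat_cd hs, h.crossMat_da hs, h.crossMat_ba hs, h.crossMat_ca hs,
    h.crossMat_cb hs⟩

end CrossMatrices

/-! ### Moving D past O_q(GL₂) -/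

section CrossHom

namespace OqGL2
variable {q : ℂ}

theorem hom_ext {B : Type} [Ring B] [Algebra ℂ B] {f g : OqGL2 q →ₐ[ℂ] B}
    (h : ∀ i j, f (L q i j) = g (L q i j)) : f = g := by
  have h1 : AlgHom.equalizer f g = ⊤ := by
    refine subalgebra_eq_top _ h ?_
    have hd : f (qdet q (L q)) = g (qdet q (L q)) := by simp [qdet, h]
    calc f (detInv q) = f (detInv q) * g (qdet q (L q) * detInv q) := by
          rw [mul_detInv, map_one, mul_one]
      _ = f (detInv q * qdet q (L q)) * g (detInv q) := by
          rw [map_mul, map_mul, hd, mul_assoc]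
      _ = g (detInv q) := by rw [detInv_mul, map_one, one_mul]
  ext u
  have : u ∈ AlgHom.equalizer f g := h1 ▸ Algebra.mem_top
  exact this

theorem exists_crossHom (hq : q ≠ 0) : ∃ f : OqGL2 q →ₐ[ℂ] Matrix (Fin 4) (Fin 4) (OqGL2 q),
    f (L q 0 0) = crossMatA (q ^ 2) (L q 0 0) (L q 0 1) (L q 1 0) (L q 1 1) ∧
    f (L q 0 1) = crossMatB (q ^ 2) (L q 0 1) (L q 1 1) ∧
    f (L q 1 0) = crossMatC (q ^ 2) (L q 0 0) (L q 0 1) (L q 1 0) (L q 1 1) ∧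
    f (L q 1 1) = crossMatD (q ^ 2) (L q 0 1) (L q 1 1) := by
  have hs : q ^ 2 ≠ 0 := pow_ne_zero 2 hq
  refine exists_lift hq ((reaRel hq).crossMat hs) ?_
  rw [(reaRel hq).det_crossMat hs]
  have h1 : (Matrix.diagonal fun _ => (q ^ 2)⁻¹ • qdet q (L q) : Matrix (Fin 4) (Fin 4) (OqGL2 q)) *
      (Matrix.diagonal fun _ => q ^ 2 • detInv q) = 1 := by
    simp [Matrix.diagonal_mul_diagonal, smul_smul, hq, mul_detInv]
  have h2 : (Matrix.diagonal fun _ => q ^ 2 • detInv q) *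
      (Matrix.diagonal fun _ => (q ^ 2)⁻¹ • qdet q (L q) : Matrix (Fin 4) (Fin 4) (OqGL2 q)) = 1 := by
    simp [Matrix.diagonal_mul_diagonal, smul_smul, hq, detInv_mul]
  exact ⟨⟨_, _, h1, h2⟩, rfl⟩

/-- The homomorphism describing how the entries of `D` move to the right of `O_q(GL₂)`. -/
noncomputable def crossHom (hq : q ≠ 0) : OqGL2 q →ₐ[ℂ] Matrix (Fin 4) (Fin 4) (OqGL2 q) :=
  (exists_crossHom hq).choose

theorem crossHom_a (hq : q ≠ 0) : crossHom hq (L q 0 0) =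
    crossMatA (q ^ 2) (L q 0 0) (L q 0 1) (L q 1 0) (L q 1 1) :=
  (exists_crossHom hq).choose_spec.1

theorem crossHom_b (hq : q ≠ 0) : crossHom hq (L q 0 1) =
    crossMatB (q ^ 2) (L q 0 1) (L q 1 1) :=
  (exists_crossHom hq).choose_spec.2.1

theorem crossHom_c (hq : q ≠ 0) : crossHom hq (L q 1 0) =
    crossMatC (q ^ 2) (L q 0 0) (L q 0 1) (L q 1 0) (L q 1 1) :=
  (exists_crossHom hq).choose_spec.2.2.1

theorem crossHom_d (hq : q ≠ 0) : crossHom hq (L q 1 1) =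
    crossMatD (q ^ 2) (L q 0 1) (L q 1 1) :=
  (exists_crossHom hq).choose_spec.2.2.2

theorem crossHom_qdet (hq : q ≠ 0) : crossHom hq (qdet q (L q)) =
    Matrix.diagonal fun _ => (q ^ 2)⁻¹ • qdet q (L q) := by
  rw [show crossHom hq (qdet q (L q)) = crossHom hq (L q 0 0) * crossHom hq (L q 1 1) -
    q ^ 2 • (crossHom hq (L q 0 1) * crossHom hq (L q 1 0)) by simp [qdet], crossHom_a,
    crossHom_b, crossHom_c, crossHom_d, (reaRel hq).det_crossMat (pow_ne_zero 2 hq)]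
  rfl

theorem crossHom_detInv (hq : q ≠ 0) : crossHom hq (detInv q) =
    Matrix.diagonal fun _ => q ^ 2 • detInv q := by
  have h1 : crossHom hq (detInv q) * crossHom hq (qdet q (L q)) = 1 := by
    rw [← map_mul, detInv_mul, map_one]
  have h2 : crossHom hq (qdet q (L q)) * (Matrix.diagonal fun _ => q ^ 2 • detInv q) = 1 := by
    rw [crossHom_qdet]
    simp [Matrix.diagonal_mul_diagonal, smul_smul, hq, mul_detInv]
  exact left_inv_eq_right_inv h1 h2

variable {R : Type} [Ring R] [Algebra ℂ R]

/-- The elements `A B C E` of `R` satisfy the cross relations with respect to all elements of the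
image of `O_q(GL₂)`. -/
theorem mul_hom_eq_sum (hq : q ≠ 0) (g : OqGL2 q →ₐ[ℂ] R) {A B C E : R}
    (h : CrossRel (q ^ 2) (g (L q 0 0)) (g (L q 0 1)) (g (L q 1 0)) (g (L q 1 1)) A B C E)
    (u : OqGL2 q) (i : Fin 4) :
    ![A, B, C, E] i * g u = ∑ k, g (crossHom hq u i k) * ![A, B, C, E] k := by
  have hs : q ^ 2 ≠ 0 := pow_ne_zero 2 hq
  -- Closure under products is matrix multiplication: passing x and then y uses the product of the
  -- two matrices, which is the matrix of xy.
  let S : Subalgebra ℂ (OqGL2 q) :=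
    { carrier := {u | ∀ i, ![A, B, C, E] i * g u = ∑ k, g (crossHom hq u i k) * ![A, B, C, E] k}
      mul_mem' := by
        intro x y hx hy i
        simp only [Set.mem_ofPred_eq] at hx hy
        rw [map_mul, ← mul_assoc, hx, Finset.sum_mul]
        simp only [mul_assoc, hy, map_mul, Matrix.mul_apply, map_sum, Finset.sum_mul,
          Finset.mul_sum]
        rw [Finset.sum_comm]
      add_mem' := by
        intro x y hx hy i
        simp only [Set.mem_ofPred_eq] at hx hy
        simp only [map_add, mul_add, hx, hy, Matrix.add_apply, add_mul, Finset.sum_add_distrib]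
      algebraMap_mem' := by
        intro r i
        rw [AlgHom.commutes, AlgHom.commutes, Finset.sum_eq_single i]
        · simp [Matrix.algebraMap_matrix_apply, Algebra.commutes]
        · intro k _ hk
          simp [Matrix.algebraMap_matrix_apply, hk.symm]
        · simp }
  have hE : ∀ i, ![A, B, C, E] i * g (L q 0 0) =
      ∑ k, g (crossHom hq (L q 0 0) i k) * ![A, B, C, E] k := by
    intro i
    rw [crossHom_a, Fin.sum_univ_four]
    -- `h.Bc` enters because the rule `Aa` contains the product B c, which the first row of
    -- `crossMatA` has already expanded.
    fin_cases i <;> simp [crossMatA, h.Aa, h.Ba, h.Ca, h.Ea, h.Bc, smul_add, sub_mul,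
      add_mul] <;> match_scalars <;> field_simp <;> ring
  have hB : ∀ i, ![A, B, C, E] i * g (L q 0 1) =
      ∑ k, g (crossHom hq (L q 0 1) i k) * ![A, B, C, E] k := by
    intro i
    rw [crossHom_b, Fin.sum_univ_four]
    fin_cases i <;> simp [crossMatB, h.Ab, h.Bb, h.Cb, h.Eb] <;> match_scalars <;> field_simp
  have hC : ∀ i, ![A, B, C, E] i * g (L q 1 0) =
      ∑ k, g (crossHom hq (L q 1 0) i k) * ![A, B, C, E] k := by
    intro i
    rw [crossHom_c, Fin.sum_univ_four]
    fin_cases i <;> simp [crossMatC, h.Ac, h.Bc, h.Cc, h.Ec, add_mul] <;> match_scalars <;>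
      field_simp
  have hD : ∀ i, ![A, B, C, E] i * g (L q 1 1) =
      ∑ k, g (crossHom hq (L q 1 1) i k) * ![A, B, C, E] k := by
    intro i
    rw [crossHom_d, Fin.sum_univ_four]
    fin_cases i <;> simp [crossMatD, h.Ad, h.Bd, h.Cd, h.Ed]
  have hL : ∀ i j, L q i j ∈ S := by
    intro i j
    fin_cases i <;> fin_cases j
    exacts [hE, hB, hC, hD]
  have hdet : qdet q (L q) ∈ S :=
    S.sub_mem (S.mul_mem (hL _ _) (hL _ _)) (S.smul_mem (S.mul_mem (hL _ _) (hL _ _)) _)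
  have hdet' : ∀ i, ![A, B, C, E] i * g (qdet q (L q)) =
      (q ^ 2)⁻¹ • (g (qdet q (L q)) * ![A, B, C, E] i) := by
    intro i
    rw [hdet i, crossHom_qdet, Finset.sum_eq_single i]
    · simp
    · intro k _ hk
      simp [Matrix.diagonal_apply_ne _ hk.symm]
    · simp
  have hinv : detInv q ∈ S := by
    intro i
    rw [crossHom_detInv, Finset.sum_eq_single i]
    · rw [Matrix.diagonal_apply_eq, map_smul, smul_mul_assoc]
      calc ![A, B, C, E] i * g (detInv q)
          = q ^ 2 • (g (detInv q) * ((q ^ 2)⁻¹ • (g (qdet q (L q)) * ![A, B, C, E] i)) *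
              g (detInv q)) := by
            rw [mul_smul_comm, smul_mul_assoc, smul_smul, mul_inv_cancel₀ hs, one_smul, ← mul_assoc,
              ← map_mul, detInv_mul, map_one, one_mul]
        _ = _ := by
            rw [← hdet', mul_assoc, mul_assoc, ← map_mul, mul_detInv, map_one, mul_one]
    · intro k _ hk
      simp [Matrix.diagonal_apply_ne _ hk.symm]
    · simp
  have : u ∈ S := subalgebra_eq_top S hL hinv ▸ Algebra.mem_top
  exact this i

theorem crossRel_of_mul_hom_eq_sum (hq : q ≠ 0) (g : OqGL2 q →ₐ[ℂ] R) (D : Fin 4 → R)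
    (h : ∀ u i, D i * g u = ∑ k, g (crossHom hq u i k) * D k) :
    CrossRel (q ^ 2) (g (L q 0 0)) (g (L q 0 1)) (g (L q 1 0)) (g (L q 1 1))
      (D 0) (D 1) (D 2) (D 3) := by
  have hs : q ^ 2 ≠ 0 := pow_ne_zero 2 hq
  have hBc : D 1 * g (L q 1 0) = _ := h _ 1
  simp only [crossHom_c, Fin.sum_univ_four] at hBc
  constructor <;> rw [h, Fin.sum_univ_four] <;>
    simp only [crossHom_a, crossHom_b, crossHom_c, crossHom_d, hBc] <;>
    simp [crossMatA, crossMatB, crossMatC, crossMatD, add_mul, sub_mul, smul_add] <;>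
    (try match_scalars) <;> (try field_simp) <;> try ring

/-- The automorphism of `O_q(GL₂)` that multiplies the entries of `L` by `t`. -/
theorem exists_scale (hq : q ≠ 0) {t : ℂ} (ht : t ≠ 0) :
    ∃ f : OqGL2 q →ₐ[ℂ] OqGL2 q, ∀ i j, f (L q i j) = t • L q i j := by
  have h := reaRel hq
  obtain ⟨f, h1, h2, h3, h4⟩ := exists_lift hq (a := t • L q 0 0) (b := t • L q 0 1)
    (c := t • L q 1 0) (d := t • L q 1 1)
    ⟨by simp only [smul_mul_smul_comm, h.db, smul_comm _ (t * t)],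
      by simp only [smul_mul_smul_comm, h.cd, smul_comm _ (t * t)],
      by simp only [smul_mul_smul_comm, h.da],
      by simp only [smul_mul_smul_comm, h.ba, smul_comm _ (t * t), smul_add],
      by simp only [smul_mul_smul_comm, h.ca, smul_comm _ (t * t), smul_sub],
      by simp only [smul_mul_smul_comm, h.cb, smul_comm _ (t * t), smul_add, smul_sub]⟩
    (by
      have h1 : t • L q 0 0 * t • L q 1 1 - q ^ 2 • (t • L q 0 1 * t • L q 1 0) =
          (t * t) • qdet q (L q) := by
        simp only [smul_mul_smul_comm, qdet, smul_comm _ (t * t), smul_sub]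
      rw [h1]
      refine ⟨⟨_, (t * t)⁻¹ • detInv q, ?_, ?_⟩, rfl⟩
      · rw [smul_mul_smul_comm, mul_detInv, mul_inv_cancel₀ (mul_ne_zero ht ht), one_smul]
      · rw [smul_mul_smul_comm, detInv_mul, inv_mul_cancel₀ (mul_ne_zero ht ht), one_smul])
  refine ⟨f, fun i j => ?_⟩
  fin_cases i <;> fin_cases j
  exacts [h1, h2, h3, h4]

/-- See `exists_scale`. -/
noncomputable def scale (hq : q ≠ 0) {t : ℂ} (ht : t ≠ 0) : OqGL2 q →ₐ[ℂ] OqGL2 q :=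
  (exists_scale hq ht).choose

theorem scale_L (hq : q ≠ 0) {t : ℂ} (ht : t ≠ 0) (i j : Fin 2) :
    scale hq ht (L q i j) = t • L q i j :=
  (exists_scale hq ht).choose_spec i j

theorem scale_scale (hq : q ≠ 0) {t t' : ℂ} (ht : t ≠ 0) (ht' : t' ≠ 0) (h : t * t' = 1)
    (u : OqGL2 q) : scale hq ht (scale hq ht' u) = u := by
  have h1 : (scale hq ht).comp (scale hq ht') = AlgHom.id ℂ _ := hom_ext fun i j => by
    simp [scale_L, smul_smul, mul_comm t' t, h]
  exact DFunLike.congr_fun h1 u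

/-- The scalar analogue of `mul_hom_eq_sum`, intended for w = det_q(D), which passes every entry of
X with the factor q⁻². The rule extends to det_q⁻¹ by multiplying the rule for det_q by inverses on
both sides. -/
theorem mul_hom_eq_scale (hq : q ≠ 0) {t : ℂ} (ht : t ≠ 0) (g : OqGL2 q →ₐ[ℂ] R) {w : R}
    (h : ∀ i j, w * g (L q i j) = t • (g (L q i j) * w)) (u : OqGL2 q) :
    w * g u = g (scale hq ht u) * w := by
  let S : Subalgebra ℂ (OqGL2 q) :=
    { carrier := {u | w * g u = g (scale hq ht u) * w}
      mul_mem' := by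
        intro x y hx hy
        simp only [Set.mem_ofPred_eq] at hx hy ⊢
        rw [map_mul, ← mul_assoc, hx, mul_assoc, hy, map_mul, map_mul, mul_assoc]
      add_mem' := by
        intro x y hx hy
        simp only [Set.mem_ofPred_eq] at hx hy ⊢
        rw [map_add, mul_add, hx, hy, map_add, map_add, add_mul]
      algebraMap_mem' := by
        intro r
        simp only [Set.mem_ofPred_eq, AlgHom.commutes]
        exact (Algebra.commutes r w).symm }
  have hL : ∀ i j, L q i j ∈ S := fun i j =>
    (h i j).trans (by rw [scale_L, map_smul, smul_mul_assoc])
  have hdet : w * g (qdet q (L q)) = g (scale hq ht (qdet q (L q))) * w :=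
    S.sub_mem (S.mul_mem (hL _ _) (hL _ _)) (S.smul_mem (S.mul_mem (hL _ _) (hL _ _)) _)
  have hinv : detInv q ∈ S := by
    have h1 : g (scale hq ht (detInv q)) * g (scale hq ht (qdet q (L q))) = 1 := by
      rw [← map_mul, ← map_mul, detInv_mul, map_one, map_one]
    have h2 : g (qdet q (L q)) * g (detInv q) = 1 := by rw [← map_mul, mul_detInv, map_one]
    calc w * g (detInv q)
        = g (scale hq ht (detInv q)) * (g (scale hq ht (qdet q (L q))) * w) * g (detInv q) := by
          rw [← mul_assoc, h1, one_mul]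
      _ = _ := by rw [← hdet, mul_assoc, mul_assoc, h2, mul_one]
  have : u ∈ S := subalgebra_eq_top S hL hinv ▸ Algebra.mem_top
  exact this

end OqGL2

end CrossHom

/-! ### Propagating the reflection equation for D from vector to vector -/

section RelOn
variable {V : Type*} [AddCommGroup V] [Module ℂ V]

/-- The reflection equation relations applied to a vector. -/
structure ReaRelOn (s : ℂ) (a b c d : Module.End ℂ V) (v : V) : Prop where
  db : d (b v) = s • b (d v)
  cd : c (d v) = s • d (c v)
  da : d (a v) = a (d v)
  ba : b (a v) = a (b v) + (1 - s⁻¹) • b (d v)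
  ca : c (a v) = a (c v) - (1 - s⁻¹) • d (c v)
  cb : c (b v) = b (c v) + (1 - s⁻¹) • (a (d v) - d (d v))

variable {s : ℂ} {a b c d A B C E : Module.End ℂ V} {v : V}

set_option linter.unusedSimpArgs false in
-- Moving two entries of D past one entry of X leaves a combination of single entries of X applied
-- to quadratic expressions in D at v. Hence only the cross relations and the relations at v are
-- used, and no relation among a, b, c, d.
theorem CrossRel.reaRelOn (h : CrossRel s a b c d A B C E) (hs : s ≠ 0)
    (hv : ReaRelOn s A B C E v) :
    (ReaRelOn s A B C E (a v) ∧ ReaRelOn s A B C E (b v)) ∧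
    ReaRelOn s A B C E (c v) ∧ ReaRelOn s A B C E (d v) := by
  have Aa (w : V) : A (a w) = _ := DFunLike.congr_fun h.Aa w
  have Ab (w : V) : A (b w) = _ := DFunLike.congr_fun h.Ab w
  have Ac (w : V) : A (c w) = _ := DFunLike.congr_fun h.Ac w
  have Ad (w : V) : A (d w) = _ := DFunLike.congr_fun h.Ad w
  have Ba (w : V) : B (a w) = _ := DFunLike.congr_fun h.Ba w
  have Bb (w : V) : B (b w) = _ := DFunLike.congr_fun h.Bb w
  have Bc (w : V) : B (c w) = _ := DFunLike.congr_fun h.Bc w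
  have Bd (w : V) : B (d w) = _ := DFunLike.congr_fun h.Bd w
  have Ca (w : V) : C (a w) = _ := DFunLike.congr_fun h.Ca w
  have Cb (w : V) : C (b w) = _ := DFunLike.congr_fun h.Cb w
  have Cc (w : V) : C (c w) = _ := DFunLike.congr_fun h.Cc w
  have Cd (w : V) : C (d w) = _ := DFunLike.congr_fun h.Cd w
  have Ea (w : V) : E (a w) = _ := DFunLike.congr_fun h.Ea w
  have Eb (w : V) : E (b w) = _ := DFunLike.congr_fun h.Eb w
  have Ec (w : V) : E (c w) = _ := DFunLike.congr_fun h.Ec w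
  have Ed (w : V) : E (d w) = _ := DFunLike.congr_fun h.Ed w
  simp only [LinearMap.add_apply, LinearMap.sub_apply, LinearMap.smul_apply,
    Module.End.mul_apply] at *
  have h1 := hv.db
  have h2 := hv.cd
  have h3 := hv.da
  have h4 := hv.ba
  have h5 := hv.ca
  have h6 := hv.cb
  clear h hv
  refine ⟨⟨?_, ?_⟩, ?_, ?_⟩
  all_goals
    constructor <;>
    simp only [Aa, Ab, Ac, Ad, Ba, Bb, Bc, Bd, Ca, Cb, Cc, Cd, Ea, Eb, Ec, Ed, map_add, map_sub,
      map_smul, smul_add, smul_sub, h1, h2, h3, h4, h5, h6] <;>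
    match_scalars <;> field_simp <;> ring

end RelOn

/-! ### The quantum determinant of D against X -/

section Det
variable {R : Type*} [Ring R] [Algebra ℂ R] {s : ℂ} {a b c d A B C E : R}

set_option linter.unusedSimpArgs false in
theorem CrossRel.det_mul (h : CrossRel s a b c d A B C E) (h' : ReaRel s A B C E) (hs : s ≠ 0) :
    ((A * E - s • (B * C)) * a = s⁻¹ • (a * (A * E - s • (B * C))) ∧
    (A * E - s • (B * C)) * b = s⁻¹ • (b * (A * E - s • (B * C)))) ∧
    (A * E - s • (B * C)) * c = s⁻¹ • (c * (A * E - s • (B * C))) ∧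
    (A * E - s • (B * C)) * d = s⁻¹ • (d * (A * E - s • (B * C))) := by
  have hc (x y z : R) (e : x * y = z) (w : R) : x * (y * w) = z * w := by rw [← mul_assoc, e]
  refine ⟨⟨?_, ?_⟩, ?_, ?_⟩
  all_goals
    simp only [mul_add, add_mul, mul_sub, sub_mul, smul_add, smul_sub, smul_mul_assoc,
      mul_smul_comm, mul_assoc, h'.db, h'.cd, h'.da, h'.ba, h'.ca, h'.cb,
      h.Aa, h.Ab, h.Ac, h.Ad, h.Ba, h.Bb, h.Bc, h.Bd, h.Ca, h.Cb, h.Cc, h.Cd, h.Ea, h.Eb, h.Ec,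
      h.Ed, hc _ _ _ h.Aa, hc _ _ _ h.Ab, hc _ _ _ h.Ac, hc _ _ _ h.Ad, hc _ _ _ h.Ba,
      hc _ _ _ h.Bb, hc _ _ _ h.Bc, hc _ _ _ h.Bd, hc _ _ _ h.Ca, hc _ _ _ h.Cb, hc _ _ _ h.Cc,
      hc _ _ _ h.Cd, hc _ _ _ h.Ea, hc _ _ _ h.Eb, hc _ _ _ h.Ec, hc _ _ _ h.Ed] <;>
    match_scalars <;> field_simp <;> ring

end Det

/-! ### The representation on O_q(GL₂) ⊗ O_q(GL₂) -/

section Rep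
open TensorProduct

namespace DqGL2
variable {q : ℂ}

/-- The space `O_q(GL₂) ⊗ O_q(GL₂)`, on which `D_q(GL₂)` acts. -/
abbrev RepSpace (q : ℂ) : Type := OqGL2 q ⊗[ℂ] OqGL2 q

/-- The action of the subalgebra generated by `X` on `RepSpace`. -/
noncomputable def repX (q : ℂ) : OqGL2 q →ₐ[ℂ] Module.End ℂ (RepSpace q) :=
  (Module.End.rTensorAlgHom ℂ (OqGL2 q) (OqGL2 q)).comp (Algebra.lmul ℂ (OqGL2 q))

theorem repX_tmul (u x y : OqGL2 q) : repX q u (x ⊗ₜ y) = (u * x) ⊗ₜ y := rfl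

/-- The entries `a, b, c, d` of the matrix `L` as a vector. -/
noncomputable def entryVec (q : ℂ) : Fin 4 → OqGL2 q :=
  ![OqGL2.L q 0 0, OqGL2.L q 0 1, OqGL2.L q 1 0, OqGL2.L q 1 1]

/-- The action of the entries of `D` on `RepSpace`. -/
noncomputable def repD (hq : q ≠ 0) (i : Fin 4) : Module.End ℂ (RepSpace q) :=
  ∑ k, TensorProduct.map
    ((Matrix.entryLinearMap ℂ (OqGL2 q) i k).comp (OqGL2.crossHom hq).toLinearMap)
    (LinearMap.mulLeft ℂ (entryVec q k))

theorem repD_tmul (hq : q ≠ 0) (i : Fin 4) (x y : OqGL2 q) :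
    repD hq i (x ⊗ₜ y) = ∑ k, (OqGL2.crossHom hq x i k) ⊗ₜ (entryVec q k * y) := by
  simp [repD]

theorem repD_one_tmul (hq : q ≠ 0) (i : Fin 4) (y : OqGL2 q) :
    repD hq i (1 ⊗ₜ y) = 1 ⊗ₜ (entryVec q i * y) := by
  rw [repD_tmul, map_one, Finset.sum_eq_single i]
  · simp
  · intro k _ hk
    rw [Matrix.one_apply_ne hk.symm, zero_tmul]
  · simp

/-- Multiplicativity of `crossHom` on u x is the whole content. It makes the cross relations hold
for these operators. -/
theorem repD_mul_repX (hq : q ≠ 0) (u : OqGL2 q) (i : Fin 4) :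
    repD hq i * repX q u = ∑ k, repX q (OqGL2.crossHom hq u i k) * repD hq k := by
  refine TensorProduct.ext' fun x y => ?_
  simp only [Module.End.mul_apply, repX_tmul, repD_tmul, LinearMap.sum_apply, map_sum, map_mul,
    Matrix.mul_apply, sum_tmul]
  rw [Finset.sum_comm]

theorem crossRel_rep (hq : q ≠ 0) :
    CrossRel (q ^ 2) (repX q (OqGL2.L q 0 0)) (repX q (OqGL2.L q 0 1)) (repX q (OqGL2.L q 1 0))
      (repX q (OqGL2.L q 1 1)) (repD hq 0) (repD hq 1) (repD hq 2) (repD hq 3) :=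
  OqGL2.crossRel_of_mul_hom_eq_sum hq (repX q) (repD hq) (repD_mul_repX hq)

theorem repD_repX_detInv (hq : q ≠ 0) (i : Fin 4) (v : RepSpace q) :
    repD hq i (repX q (OqGL2.detInv q) v) = q ^ 2 • repX q (OqGL2.detInv q) (repD hq i v) := by
  rw [← Module.End.mul_apply, repD_mul_repX, OqGL2.crossHom_detInv, Finset.sum_eq_single i]
  · simp
  · intro k _ hk
    rw [Matrix.diagonal_apply_ne _ hk.symm, map_zero, zero_mul]
  · simp

/-- On 1 ⊗ y the entries of D act by left multiplication by L on y, so the relations hold there.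
They spread to x ⊗ y because the good vectors are stable under the entries of X and under
det_q(X)⁻¹, which D passes with a scalar. -/
theorem reaRelOn_rep (hq : q ≠ 0) (v : RepSpace q) :
    ReaRelOn (q ^ 2) (repD hq 0) (repD hq 1) (repD hq 2) (repD hq 3) v := by
  have hs : q ^ 2 ≠ 0 := pow_ne_zero 2 hq
  let K : Submodule ℂ (RepSpace q) :=
    { carrier := {v | ReaRelOn (q ^ 2) (repD hq 0) (repD hq 1) (repD hq 2) (repD hq 3) v}
      zero_mem' := by constructor <;> simp
      add_mem' := by
        rintro v w hv hw
        constructor <;> simp only [map_add, hv.db, hv.cd, hv.da, hv.ba, hv.ca, hv.cb, hw.db, hw.cd,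
          hw.da, hw.ba, hw.ca, hw.cb, smul_add, smul_sub] <;> abel
      smul_mem' := by
        rintro r v hv
        constructor <;> simp only [map_smul, hv.db, hv.cd, hv.da, hv.ba, hv.ca, hv.cb, smul_add,
          smul_sub, smul_comm r] }
  have hone (y : OqGL2 q) : (1 : OqGL2 q) ⊗ₜ[ℂ] y ∈ K := by
    have h := OqGL2.reaRel hq
    constructor <;> simp only [repD_one_tmul, entryVec, ← mul_assoc, Matrix.cons_val] <;>
      simp only [h.db, h.cd, h.da, h.ba, h.ca, h.cb, add_mul, sub_mul, smul_mul_assoc, smul_sub,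
        tmul_add, tmul_sub, tmul_smul]
  let S : Subalgebra ℂ (OqGL2 q) :=
    { carrier := {u | ∀ v ∈ K, repX q u v ∈ K}
      mul_mem' := fun {x y} hx hy v hv => by
        rw [map_mul, Module.End.mul_apply]
        exact hx _ (hy _ hv)
      add_mem' := fun {x y} hx hy v hv => by
        rw [map_add, LinearMap.add_apply]
        exact K.add_mem (hx _ hv) (hy _ hv)
      algebraMap_mem' := fun r v hv => by
        rw [AlgHom.commutes, Module.algebraMap_end_apply]
        exact K.smul_mem r hv }
  have hS : S = ⊤ := by
    refine OqGL2.subalgebra_eq_top S ?_ ?_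
    · intro i j v hv
      obtain ⟨⟨h1, h2⟩, h3, h4⟩ := (crossRel_rep hq).reaRelOn hs hv
      fin_cases i <;> fin_cases j
      exacts [h1, h2, h3, h4]
    · intro v hv
      have hv' : ReaRelOn (q ^ 2) (repD hq 0) (repD hq 1) (repD hq 2) (repD hq 3) v := hv
      constructor <;> simp only [repD_repX_detInv, map_smul, hv'.db, hv'.cd, hv'.da, hv'.ba,
        hv'.ca, hv'.cb, map_add, map_sub, smul_add, smul_sub] <;> match_scalars <;> ring
  have hK : ∀ v, v ∈ K := by
    intro v
    induction v using TensorProduct.induction_on with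
    | zero => exact K.zero_mem
    | add x y hx hy => exact K.add_mem hx hy
    | tmul x y =>
      have hx : x ∈ S := hS ▸ Algebra.mem_top
      have := hx _ (hone y)
      rwa [repX_tmul, mul_one] at this
  exact hK v

theorem reaRel_rep (hq : q ≠ 0) :
    ReaRel (q ^ 2) (repD hq 0) (repD hq 1) (repD hq 2) (repD hq 3) where
  db := LinearMap.ext fun v => (reaRelOn_rep hq v).db
  cd := LinearMap.ext fun v => (reaRelOn_rep hq v).cd
  da := LinearMap.ext fun v => (reaRelOn_rep hq v).da
  ba := LinearMap.ext fun v => (reaRelOn_rep hq v).ba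
  ca := LinearMap.ext fun v => (reaRelOn_rep hq v).ca
  cb := LinearMap.ext fun v => (reaRelOn_rep hq v).cb

/-- The action of `det_q(D)` on `RepSpace`. -/
noncomputable def repDetD (hq : q ≠ 0) : Module.End ℂ (RepSpace q) :=
  repD hq 0 * repD hq 3 - q ^ 2 • (repD hq 1 * repD hq 2)

theorem repDetD_one_tmul (hq : q ≠ 0) (y : OqGL2 q) :
    repDetD hq (1 ⊗ₜ y) = 1 ⊗ₜ (qdet q (OqGL2.L q) * y) := by
  simp [repDetD, repD_one_tmul, entryVec, qdet, sub_mul, mul_assoc, tmul_sub]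

theorem repDetD_mul_repX (hq : q ≠ 0) (u : OqGL2 q) :
    repDetD hq * repX q u =
      repX q (OqGL2.scale hq (inv_ne_zero (pow_ne_zero 2 hq)) u) * repDetD hq := by
  refine OqGL2.mul_hom_eq_scale hq _ (repX q) (fun i j => ?_) u
  obtain ⟨⟨h1, h2⟩, h3, h4⟩ := (crossRel_rep hq).det_mul (reaRel_rep hq) (pow_ne_zero 2 hq)
  fin_cases i <;> fin_cases j
  exacts [h1, h2, h3, h4]

theorem repDetD_tmul (hq : q ≠ 0) (x y : OqGL2 q) : repDetD hq (x ⊗ₜ y) =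
    OqGL2.scale hq (inv_ne_zero (pow_ne_zero 2 hq)) x ⊗ₜ (qdet q (OqGL2.L q) * y) := by
  have h := DFunLike.congr_fun (repDetD_mul_repX hq x) (1 ⊗ₜ y)
  rwa [Module.End.mul_apply, Module.End.mul_apply, repX_tmul, mul_one, repDetD_one_tmul, repX_tmul,
    mul_one] at h

/-- The operator rescales the first factor and multiplies the second by det_q, and both operations
can be undone. The action of D_q⁺(GL₂) therefore extends to D_q(GL₂). -/
theorem isUnit_repDetD (hq : q ≠ 0) : IsUnit (repDetD hq) := by
  have hs : q ^ 2 ≠ 0 := pow_ne_zero 2 hq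
  refine ⟨⟨repDetD hq, TensorProduct.map (OqGL2.scale hq hs).toLinearMap
    (LinearMap.mulLeft ℂ (OqGL2.detInv q)), ?_, ?_⟩, rfl⟩
  · refine TensorProduct.ext' fun x y => ?_
    rw [Module.End.mul_apply, map_tmul, repDetD_tmul, LinearMap.mulLeft_apply, ← mul_assoc,
      OqGL2.mul_detInv, one_mul, AlgHom.toLinearMap_apply,
      OqGL2.scale_scale hq _ _ (inv_mul_cancel₀ hs)]
    rfl
  · refine TensorProduct.ext' fun x y => ?_
    rw [Module.End.mul_apply, repDetD_tmul, map_tmul, LinearMap.mulLeft_apply, ← mul_assoc,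
      OqGL2.detInv_mul, one_mul, AlgHom.toLinearMap_apply,
      OqGL2.scale_scale hq _ _ (mul_inv_cancel₀ hs)]
    rfl

theorem exists_rep (hq : q ≠ 0) : ∃ f : DqGL2 q →ₐ[ℂ] Module.End ℂ (RepSpace q),
    (∀ i j, f (X q i j) = repX q (OqGL2.L q i j)) ∧
    f (D q 0 0) = repD hq 0 ∧ f (D q 0 1) = repD hq 1 ∧ f (D q 1 0) = repD hq 2 ∧
    f (D q 1 1) = repD hq 3 := by
  obtain ⟨f, hX, hD⟩ := exists_lift hq ((OqGL2.L q).map (repX q))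
    !![repD hq 0, repD hq 1; repD hq 2, repD hq 3] ((OqGL2.reaRel hq).map (repX q))
    (reaRel_rep hq) (crossRel_rep hq) (by
      refine IsUnit.mul ?_ (isUnit_repDetD hq)
      rw [qdet_map]
      exact IsUnit.map _ ⟨⟨_, _, OqGL2.mul_detInv, OqGL2.detInv_mul⟩, rfl⟩)
  exact ⟨f, hX, hD 0 0, hD 0 1, hD 1 0, hD 1 1⟩

/-- The representation of `D_q(GL₂)` on `RepSpace`. -/
noncomputable def rep (hq : q ≠ 0) : DqGL2 q →ₐ[ℂ] Module.End ℂ (RepSpace q) :=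
  (exists_rep hq).choose

theorem rep_X (hq : q ≠ 0) (i j : Fin 2) : rep hq (X q i j) = repX q (OqGL2.L q i j) :=
  (exists_rep hq).choose_spec.1 i j

theorem rep_D_one_tmul (hq : q ≠ 0) (i j : Fin 2) (y : OqGL2 q) :
    rep hq (D q i j) (1 ⊗ₜ y) = 1 ⊗ₜ (OqGL2.L q i j * y) := by
  obtain ⟨_, h1, h2, h3, h4⟩ := (exists_rep hq).choose_spec
  fin_cases i <;> fin_cases j
  · exact (congrArg (fun f => f (1 ⊗ₜ y)) h1).trans (repD_one_tmul hq 0 y)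
  · exact (congrArg (fun f => f (1 ⊗ₜ y)) h2).trans (repD_one_tmul hq 1 y)
  · exact (congrArg (fun f => f (1 ⊗ₜ y)) h3).trans (repD_one_tmul hq 2 y)
  · exact (congrArg (fun f => f (1 ⊗ₜ y)) h4).trans (repD_one_tmul hq 3 y)

end DqGL2

end Rep

/-! ### Triangular decomposition of D_q(GL₂) -/

section Triangular
open TensorProduct

namespace DqGL2
variable {q : ℂ}

theorem qdet_D_mul_X (hq : q ≠ 0) (i j : Fin 2) :
    qdet q (D q) * X q i j = (q ^ 2)⁻¹ • (X q i j * qdet q (D q)) := by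
  obtain ⟨⟨h1, h2⟩, h3, h4⟩ := (crossRel hq).det_mul (reaRel_D hq) (pow_ne_zero 2 hq)
  fin_cases i <;> fin_cases j
  exacts [h1, h2, h3, h4]

theorem qdet_D_mul_qdet_X (hq : q ≠ 0) : qdet q (D q) * qdet q (X q) =
    ((q ^ 2)⁻¹ * (q ^ 2)⁻¹) • (qdet q (X q) * qdet q (D q)) := by
  have h (i j k l : Fin 2) : qdet q (D q) * (X q i j * X q k l) =
      ((q ^ 2)⁻¹ * (q ^ 2)⁻¹) • (X q i j * X q k l * qdet q (D q)) := by
    rw [← mul_assoc, qdet_D_mul_X hq, smul_mul_assoc, mul_assoc, qdet_D_mul_X hq, mul_smul_comm,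
      smul_smul, mul_assoc]
  generalize qdet q (D q) = e at *
  simp only [qdet, mul_sub, sub_mul, mul_smul_comm, smul_mul_assoc, h, smul_sub]
  rw [smul_comm (q ^ 2)]

/-- Only the product of the two determinants is inverted by definition. As they commute up to a
scalar, the first one has inverses on both sides. -/
theorem isUnit_qdet_X (hq : q ≠ 0) : IsUnit (qdet q (X q)) := by
  have hs : q ^ 2 ≠ 0 := pow_ne_zero 2 hq
  rw [isUnit_iff_exists]
  have h1 : qdet q (X q) * (qdet q (D q) * detInv q) = 1 := by rw [← mul_assoc, mul_detInv]
  have h2 : (q ^ 2 * q ^ 2) • (detInv q * qdet q (D q)) * qdet q (X q) = 1 := by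
    rw [smul_mul_assoc, mul_assoc, qdet_D_mul_qdet_X hq, mul_smul_comm, smul_smul, detInv_mul,
      ← mul_inv, mul_inv_cancel₀ (mul_ne_zero hs hs), one_smul]
  exact ⟨_, h1, left_inv_eq_right_inv h2 h1 ▸ h2⟩

theorem isUnit_qdet_D (hq : q ≠ 0) : IsUnit (qdet q (D q)) := by
  have h : IsUnit (qdet q (X q) * qdet q (D q)) := ⟨⟨_, _, mul_detInv, detInv_mul⟩, rfl⟩
  exact ((isUnit_qdet_X hq).mul_left_iff).mp h

theorem exists_homX (hq : q ≠ 0) :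
    ∃ f : OqGL2 q →ₐ[ℂ] DqGL2 q, ∀ i j, f (OqGL2.L q i j) = X q i j := by
  obtain ⟨f, h1, h2, h3, h4⟩ := OqGL2.exists_lift hq (reaRel_X hq) (isUnit_qdet_X hq)
  refine ⟨f, fun i j => ?_⟩
  fin_cases i <;> fin_cases j
  exacts [h1, h2, h3, h4]

theorem exists_homD (hq : q ≠ 0) :
    ∃ f : OqGL2 q →ₐ[ℂ] DqGL2 q, ∀ i j, f (OqGL2.L q i j) = D q i j := by
  obtain ⟨f, h1, h2, h3, h4⟩ := OqGL2.exists_lift hq (reaRel_D hq) (isUnit_qdet_D hq)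
  refine ⟨f, fun i j => ?_⟩
  fin_cases i <;> fin_cases j
  exacts [h1, h2, h3, h4]

/-- The homomorphism `O_q(GL₂) → D_q(GL₂)` with `L ↦ X`. -/
noncomputable def homX (hq : q ≠ 0) : OqGL2 q →ₐ[ℂ] DqGL2 q := (exists_homX hq).choose

/-- The homomorphism `O_q(GL₂) → D_q(GL₂)` with `L ↦ D`. -/
noncomputable def homD (hq : q ≠ 0) : OqGL2 q →ₐ[ℂ] DqGL2 q := (exists_homD hq).choose

theorem homX_L (hq : q ≠ 0) (i j : Fin 2) : homX hq (OqGL2.L q i j) = X q i j :=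
  (exists_homX hq).choose_spec i j

theorem homD_L (hq : q ≠ 0) (i j : Fin 2) : homD hq (OqGL2.L q i j) = D q i j :=
  (exists_homD hq).choose_spec i j

theorem homX_qdet (hq : q ≠ 0) : homX hq (qdet q (OqGL2.L q)) = qdet q (X q) := by
  simp [qdet, homX_L]

theorem homD_qdet (hq : q ≠ 0) : homD hq (qdet q (OqGL2.L q)) = qdet q (D q) := by
  simp [qdet, homD_L]

theorem detInv_eq (hq : q ≠ 0) :
    detInv q = homD hq (OqGL2.detInv q) * homX hq (OqGL2.detInv q) := by
  have h1 : qdet q (X q) * qdet q (D q) *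
      (homD hq (OqGL2.detInv q) * homX hq (OqGL2.detInv q)) = 1 := by
    rw [← homX_qdet hq, ← homD_qdet hq, mul_assoc, ← mul_assoc (homD hq _), ← map_mul,
      OqGL2.mul_detInv, map_one, one_mul, ← map_mul, OqGL2.mul_detInv, map_one]
  exact left_inv_eq_right_inv detInv_mul h1

theorem vec_mul_homX (hq : q ≠ 0) (u : OqGL2 q) (i : Fin 4) :
    homD hq (entryVec q i) * homX hq u =
      ∑ k, homX hq (OqGL2.crossHom hq u i k) * homD hq (entryVec q k) := by
  have h := OqGL2.mul_hom_eq_sum hq (homX hq) (by simpa only [homX_L] using crossRel hq) u i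
  have hv (k : Fin 4) : ![D q 0 0, D q 0 1, D q 1 0, D q 1 1] k = homD hq (entryVec q k) := by
    fin_cases k <;> simp [entryVec, homD_L]
  simpa only [hv] using h

theorem homD_qdet_mul_homX (hq : q ≠ 0) (u : OqGL2 q) :
    qdet q (D q) * homX hq u =
      homX hq (OqGL2.scale hq (inv_ne_zero (pow_ne_zero 2 hq)) u) * qdet q (D q) :=
  OqGL2.mul_hom_eq_scale hq _ _ (fun i j => by rw [homX_L, qdet_D_mul_X hq]) u

theorem homD_detInv_mul_homX (hq : q ≠ 0) (u : OqGL2 q) :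
    homD hq (OqGL2.detInv q) * homX hq u =
      homX hq (OqGL2.scale hq (pow_ne_zero 2 hq) u) * homD hq (OqGL2.detInv q) := by
  have hs : q ^ 2 ≠ 0 := pow_ne_zero 2 hq
  have h1 : homD hq (OqGL2.detInv q) * qdet q (D q) = 1 := by
    rw [← homD_qdet hq, ← map_mul, OqGL2.detInv_mul, map_one]
  have h2 : qdet q (D q) * homD hq (OqGL2.detInv q) = 1 := by
    rw [← homD_qdet hq, ← map_mul, OqGL2.mul_detInv, map_one]
  have h := homD_qdet_mul_homX hq (OqGL2.scale hq hs u)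
  rw [OqGL2.scale_scale hq _ _ (inv_mul_cancel₀ hs)] at h
  calc homD hq (OqGL2.detInv q) * homX hq u
      = homD hq (OqGL2.detInv q) * (homX hq u * qdet q (D q)) * homD hq (OqGL2.detInv q) := by
        rw [mul_assoc, mul_assoc, h2, mul_one]
    _ = _ := by rw [← h, ← mul_assoc, h1, one_mul]

/-- The multiplication map of the triangular decomposition of `D_q(GL₂)`. -/
noncomputable def mulMap (hq : q ≠ 0) : OqGL2 q ⊗[ℂ] OqGL2 q →ₗ[ℂ] DqGL2 q :=
  TensorProduct.lift ((LinearMap.mul ℂ (DqGL2 q)).compl₁₂ (homX hq).toLinearMap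
    (homD hq).toLinearMap)

theorem mulMap_tmul (hq : q ≠ 0) (x y : OqGL2 q) :
    mulMap hq (x ⊗ₜ y) = homX hq x * homD hq y := rfl

/-- The elements preserving the image under left multiplication form a subalgebra. It contains X
trivially, D because `crossHom` moves it to the right, and the inverse of det_q(X) det_q(D) because
it splits into two inverses. -/
theorem mulMap_surjective (hq : q ≠ 0) : Function.Surjective (mulMap hq) := by
  let S : Subalgebra ℂ (DqGL2 q) :=
    { carrier := {w | ∀ x y, w * (homX hq x * homD hq y) ∈ LinearMap.range (mulMap hq)}
      mul_mem' := fun {w w'} hw hw' x y => by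
        obtain ⟨t, ht⟩ := hw' x y
        rw [mul_assoc, ← ht]
        clear ht
        induction t using TensorProduct.induction_on with
        | zero => rw [map_zero, mul_zero]; exact zero_mem _
        | add t t' h h' => rw [map_add, mul_add]; exact add_mem h h'
        | tmul x y => exact hw x y
      add_mem' := fun {w w'} hw hw' x y => by
        rw [add_mul]
        exact add_mem (hw x y) (hw' x y)
      algebraMap_mem' := fun r x y =>
        ⟨r • x ⊗ₜ y, by rw [map_smul, mulMap_tmul, Algebra.smul_def]⟩ }
  have hX (u : OqGL2 q) : homX hq u ∈ S := fun x y =>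
    ⟨(u * x) ⊗ₜ y, by rw [mulMap_tmul, map_mul, mul_assoc]⟩
  have hV (i : Fin 4) : homD hq (entryVec q i) ∈ S := fun x y => by
    rw [← mul_assoc, vec_mul_homX, Finset.sum_mul]
    exact sum_mem fun k _ => ⟨OqGL2.crossHom hq x i k ⊗ₜ (entryVec q k * y), by
      rw [mulMap_tmul, map_mul, mul_assoc]⟩
  have hI : homD hq (OqGL2.detInv q) ∈ S := fun x y =>
    ⟨OqGL2.scale hq (pow_ne_zero 2 hq) x ⊗ₜ (OqGL2.detInv q * y), by
      rw [mulMap_tmul, map_mul, ← mul_assoc, ← mul_assoc, homD_detInv_mul_homX]⟩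
  have hS : S = ⊤ := by
    refine subalgebra_eq_top S (fun i j => homX_L hq i j ▸ hX _) (fun i j => ?_) ?_
    · rw [← homD_L hq]
      fin_cases i <;> fin_cases j
      exacts [hV 0, hV 1, hV 2, hV 3]
    · rw [detInv_eq hq]
      exact S.mul_mem hI (hX _)
  intro w
  have hw : w ∈ S := hS ▸ Algebra.mem_top
  simpa using hw 1 1

theorem rep_homX (hq : q ≠ 0) (u : OqGL2 q) : rep hq (homX hq u) = repX q u := by
  have h : (rep hq).comp (homX hq) = repX q := OqGL2.hom_ext fun i j => by
    rw [AlgHom.comp_apply, homX_L, rep_X]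
  exact DFunLike.congr_fun h u

theorem rep_homD_one_tmul (hq : q ≠ 0) (u y : OqGL2 q) :
    rep hq (homD hq u) (1 ⊗ₜ y) = 1 ⊗ₜ (u * y) := by
  let S : Subalgebra ℂ (OqGL2 q) :=
    { carrier := {u | ∀ y : OqGL2 q, rep hq (homD hq u) (1 ⊗ₜ y) = 1 ⊗ₜ (u * y)}
      mul_mem' := fun {u u'} hu hu' y => by
        rw [map_mul, map_mul, Module.End.mul_apply, hu', hu, mul_assoc]
      add_mem' := fun {u u'} hu hu' y => by
        rw [map_add, map_add, LinearMap.add_apply, hu', hu, add_mul, tmul_add]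
      algebraMap_mem' := fun r y => by
        rw [AlgHom.commutes, AlgHom.commutes, Module.algebraMap_end_apply, ← Algebra.smul_def,
          tmul_smul] }
  have hL (i j : Fin 2) : OqGL2.L q i j ∈ S := fun y => by rw [homD_L, rep_D_one_tmul]
  have hdet : qdet q (OqGL2.L q) ∈ S :=
    S.sub_mem (S.mul_mem (hL _ _) (hL _ _)) (S.smul_mem (S.mul_mem (hL _ _) (hL _ _)) _)
  have hS : S = ⊤ := by
    refine OqGL2.subalgebra_eq_top S hL fun y => ?_
    have h := hdet (OqGL2.detInv q * y)
    rw [← mul_assoc, OqGL2.mul_detInv, one_mul] at h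
    rw [← h, ← Module.End.mul_apply, ← map_mul, ← map_mul, OqGL2.detInv_mul, map_one, map_one,
      Module.End.one_apply]
  have hu : u ∈ S := hS ▸ Algebra.mem_top
  exact hu y

/-- The vector 1 ⊗ 1 serves as a vacuum: D fills the second factor, then X the first. So acting on
it is a left inverse of `mulMap`, whence injectivity. -/
theorem rep_mulMap (hq : q ≠ 0) (t : RepSpace q) :
    rep hq (mulMap hq t) (1 ⊗ₜ 1) = t := by
  induction t using TensorProduct.induction_on with
  | zero => simp
  | add t t' h h' => rw [map_add, map_add, LinearMap.add_apply, h, h']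
  | tmul x y =>
    rw [mulMap_tmul, map_mul, Module.End.mul_apply, rep_homD_one_tmul, rep_homX, repX_tmul,
      mul_one, mul_one]

/-- The triangular decomposition of `D_q(GL₂)`. -/
noncomputable def mulEquiv (hq : q ≠ 0) : OqGL2 q ⊗[ℂ] OqGL2 q ≃ₗ[ℂ] DqGL2 q :=
  LinearEquiv.ofBijective (mulMap hq)
    ⟨(Function.LeftInverse.injective (g := fun w => rep hq w (1 ⊗ₜ 1)) (rep_mulMap hq)),
      mulMap_surjective hq⟩

theorem mulEquiv_tmul (hq : q ≠ 0) (x y : OqGL2 q) :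
    mulEquiv hq (x ⊗ₜ y) = homX hq x * homD hq y := rfl

theorem mulEquiv_symm_mul (hq : q ≠ 0) (x y : OqGL2 q) :
    (mulEquiv hq).symm (homX hq x * homD hq y) = x ⊗ₜ y := by
  rw [← mulEquiv_tmul, LinearEquiv.symm_apply_apply]

/-- If left multiplication by `u` is injective on `O_q(GL₂)`, then so is left multiplication by its
image under `homX`. -/
theorem eq_zero_of_homX_mul (hq : q ≠ 0) {u : OqGL2 q} (hu : ∀ y, u * y = 0 → y = 0)
    {w : DqGL2 q} (h : homX hq u * w = 0) : w = 0 := by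
  obtain ⟨t, rfl⟩ := (mulEquiv hq).surjective w
  have h1 : (LinearMap.mulLeft ℂ u).rTensor (OqGL2 q) t = 0 := by
    apply (mulEquiv hq).injective
    rw [map_zero, ← h]
    clear h
    induction t using TensorProduct.induction_on with
    | zero => simp
    | add t t' h h' => rw [map_add, map_add, h, h', map_add, mul_add]
    | tmul x y =>
      rw [LinearMap.rTensor_tmul, LinearMap.mulLeft_apply, mulEquiv_tmul, mulEquiv_tmul, map_mul,
        mul_assoc]
  have h2 : Function.Injective ((LinearMap.mulLeft ℂ u).rTensor (OqGL2 q)) :=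
    Module.Flat.rTensor_preserves_injective_linearMap _
      ((injective_iff_map_eq_zero _).mpr fun y hy => hu y hy)
  rw [(injective_iff_map_eq_zero _).mp h2 t h1, map_zero]

/-- If right multiplication by `u` is injective on `O_q(GL₂)`, then so is right multiplication by
its image under `homD`. -/
theorem eq_zero_of_mul_homD (hq : q ≠ 0) {u : OqGL2 q} (hu : ∀ y, y * u = 0 → y = 0)
    {w : DqGL2 q} (h : w * homD hq u = 0) : w = 0 := by
  obtain ⟨t, rfl⟩ := (mulEquiv hq).surjective w
  have h1 : (LinearMap.mulRight ℂ u).lTensor (OqGL2 q) t = 0 := by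
    apply (mulEquiv hq).injective
    rw [map_zero, ← h]
    clear h
    induction t using TensorProduct.induction_on with
    | zero => simp
    | add t t' h h' => rw [map_add, map_add, h, h', map_add, add_mul]
    | tmul x y =>
      rw [LinearMap.lTensor_tmul, LinearMap.mulRight_apply, mulEquiv_tmul, mulEquiv_tmul, map_mul,
        mul_assoc]
  have h2 : Function.Injective ((LinearMap.mulRight ℂ u).lTensor (OqGL2 q)) :=
    Module.Flat.lTensor_preserves_injective_linearMap _
      ((injective_iff_map_eq_zero _).mpr fun y hy => hu y hy)
  rw [(injective_iff_map_eq_zero _).mp h2 t h1, map_zero]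

end DqGL2

end Triangular

/-! ### Powers of the cross matrices -/

section CrossPowers
variable {A : Type*} [Ring A] [Algebra ℂ A] {s : ℂ} {a b c d : A}

set_option linter.unusedSimpArgs false
set_option linter.unnecessarySeqFocus false

/-- What matters here and in the next two formulas is that every off-diagonal coefficient vanishes
when s to the exponent is 1. -/
theorem ReaRel.crossMatD_pow (h : ReaRel s a b c d) (hs : s ≠ 0) (n : ℕ) :
    crossMatD s b d ^ (n + 1) =
      !![d ^ (n + 1), 0, (1 - s ^ (n + 1)) • (b * d ^ n), 0;
        0, (s⁻¹ ^ (n + 1)) • d ^ (n + 1), 0, (s⁻¹ ^ (n + 1) - 1) • (b * d ^ n);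
        0, 0, d ^ (n + 1), 0;
        0, 0, 0, (s⁻¹ ^ (n + 1)) • d ^ (n + 1)] := by
  induction n with
  | zero => simp [crossMatD]
  | succ n ih =>
    have h1 : d * d ^ n = d ^ (n + 1) := (pow_succ' d n).symm
    have h2 : d * d ^ (n + 1) = d ^ (n + 2) := (pow_succ' d (n + 1)).symm
    rw [pow_succ', ih]
    ext i j
    rw [mul_apply_fin_four]
    fin_cases i <;> fin_cases j <;> simp [crossMatD, -smul_eq_mul] <;>
      (try simp only [mul_smul_comm, smul_mul_assoc, mul_assoc, h.db', h1, h2]) <;>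
      match_scalars <;> field_simp <;> ring

theorem ReaRel.crossMatB_pow (h : ReaRel s a b c d) (hs : s ≠ 0) (n : ℕ) :
    crossMatB s b d ^ (n + 1) =
      !![(s⁻¹ ^ (n + 1)) • b ^ (n + 1), (s⁻¹ * s⁻¹ ^ (n + 1) - s⁻¹) • (b ^ n * d), 0,
          ((1 - s⁻¹) * (1 - s⁻¹ ^ (n + 1))) • b ^ (n + 1);
        0, (s⁻¹ ^ (n + 1)) • b ^ (n + 1), 0, 0;
        0, 0, b ^ (n + 1), (s⁻¹ * s⁻¹ * (1 - s ^ (n + 1))) • (b ^ n * d);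
        0, 0, 0, b ^ (n + 1)] := by
  induction n with
  | zero =>
    ext i j
    fin_cases i <;> fin_cases j <;> simp [crossMatB, -smul_eq_mul] <;>
      match_scalars <;> field_simp <;> ring
  | succ n ih =>
    have h1 (x : A) : b ^ n * (b * x) = b ^ (n + 1) * x := by rw [pow_succ, mul_assoc]
    have h2 : b ^ (n + 1) * b = b ^ (n + 2) := (pow_succ b (n + 1)).symm
    rw [pow_succ, ih]
    ext i j
    rw [mul_apply_fin_four]
    fin_cases i <;> fin_cases j <;> simp [crossMatB, -smul_eq_mul] <;>
      (try simp only [mul_smul_comm, smul_mul_assoc, mul_assoc, h.db, h1, h2]) <;>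
      match_scalars <;> field_simp <;> ring

/-- The exponent starts at 2 since one entry contains terms with two fewer factors c than the
exponent; this is the place where ℓ > 1 is needed. -/
theorem ReaRel.crossMatC_pow (h : ReaRel s a b c d) (hs : s ≠ 0) (n : ℕ) :
    crossMatC s a b c d ^ (n + 2) =
      !![c ^ (n + 2), 0, (s⁻¹ * s ^ (n + 2) - s⁻¹) • (d * c ^ (n + 1)) +
            (s⁻¹ ^ (n + 2) - 1) • (a * c ^ (n + 1)), 0;
        (s⁻¹ * (1 - s ^ (n + 2))) • (d * c ^ (n + 1)), c ^ (n + 2),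
          ((s - 1) * (1 - s⁻¹ ^ (n + 2))) • (b * c ^ (n + 1)) +
            (s⁻¹ ^ (n + 2) + s⁻¹ * s ^ (n + 2) - 1 - s⁻¹) • (a * (d * c ^ n)) +
            (s⁻¹ * s⁻¹ * (s ^ (n + 2) - 1) + s⁻¹ * s⁻¹ * s⁻¹ * s ^ (n + 2) * (1 - s ^ (n + 2))) •
              (d * (d * c ^ n)),
          (s⁻¹ * s ^ (n + 2) - s⁻¹) • (d * c ^ (n + 1)) +
            (s⁻¹ ^ (n + 2) - 1) • (a * c ^ (n + 1));
        0, 0, s⁻¹ ^ (n + 2) • c ^ (n + 2), 0;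
        0, 0, (s⁻¹ ^ (n + 2) - 1) • (d * c ^ (n + 1)), s⁻¹ ^ (n + 2) • c ^ (n + 2)] := by
  induction n with
  | zero =>
    rw [zero_add, pow_two (crossMatC s a b c d)]
    ext i j
    rw [mul_apply_fin_four]
    fin_cases i <;> fin_cases j <;> simp [crossMatC, -smul_eq_mul] <;>
      (try simp only [mul_add, add_mul, mul_sub, sub_mul, smul_add, smul_sub, mul_smul_comm,
        smul_mul_assoc, mul_assoc, pow_two, h.db, h.da, h.cd, h.ca, h.cb]) <;>
      match_scalars <;> field_simp <;> ring
  | succ n ih =>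
    have h1 : c * c ^ n = c ^ (n + 1) := (pow_succ' c n).symm
    have h2 : c * c ^ (n + 1) = c ^ (n + 2) := (pow_succ' c (n + 1)).symm
    have h3 : c * c ^ (n + 2) = c ^ (n + 3) := (pow_succ' c (n + 2)).symm
    rw [pow_succ', ih]
    ext i j
    rw [mul_apply_fin_four]
    fin_cases i <;> fin_cases j <;> simp [crossMatC, -smul_eq_mul] <;>
      (try simp only [mul_add, add_mul, mul_sub, sub_mul, smul_add, smul_sub, mul_smul_comm,
        smul_mul_assoc, mul_assoc, h.db', h.da', h.cd', h.ca', h.cb', h1, h2, h3]) <;>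
      match_scalars <;> field_simp <;> ring

end CrossPowers

/-! ### Exchange of X and D in the opposite algebra -/

section Opposite
open MulOpposite
variable {R : Type*} [Ring R] [Algebra ℂ R] {s : ℂ} {a b c d A B C E : R}

theorem ReaRel.op (h : ReaRel s a b c d) : ReaRel s (op a) (op c) (op b) (op d) := by
  constructor <;> apply unop_injective <;>
    simp only [unop_mul, unop_op, unop_smul, unop_add, unop_sub, h.db, h.cd, h.da, h.ba, h.ca, h.cb,
      add_sub_cancel_right, sub_add_cancel]

/-- Reversing products and transposing both matrices turns the cross relations into themselves with
X and D interchanged. Results on powers of entries of X thus apply to powers of entries of D. -/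
theorem CrossRel.op (h : CrossRel s a b c d A B C E) :
    CrossRel s (op A) (op C) (op B) (op E) (op a) (op c) (op b) (op d) := by
  constructor <;> apply unop_injective <;>
    simp only [unop_mul, unop_op, unop_smul, unop_add, unop_sub]
  exacts [h.Ed, h.Cd, h.Bd.trans (by simp), h.Ad, h.Eb, h.Bb, h.Cb, h.Ab, h.Cc, h.Ec, h.Ac.trans (by abel),
    h.Bc.trans (by abel), h.Ca, h.Ea, h.Ba.trans (by abel), h.Aa]

end Opposite

/-! ### Centrality of the Frobenius matrices in D_q(GL₂) -/

section FrobeniusCross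

namespace OqGL2
variable {q : ℂ} {ℓ : ℕ} (hℓ : 1 < ℓ) (hodd : Odd ℓ) (hs : IsPrimitiveRoot (q ^ 2) ℓ) (hq : q ≠ 0)
include hℓ hs hq

theorem crossHom_d_pow : crossHom hq (L q 1 1 ^ ℓ) = Matrix.diagonal fun _ => L q 1 1 ^ ℓ := by
  obtain ⟨n, rfl⟩ := Nat.exists_eq_add_of_le' hℓ.le
  have h1 := hs.pow_eq_one
  have h2 := hs.inv.pow_eq_one
  rw [map_pow, crossHom_d, (reaRel hq).crossMatD_pow (pow_ne_zero 2 hq), h1, h2]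
  ext i j
  fin_cases i <;> fin_cases j <;> simp

theorem crossHom_b_pow : crossHom hq (L q 0 1 ^ ℓ) = Matrix.diagonal fun _ => L q 0 1 ^ ℓ := by
  obtain ⟨n, rfl⟩ := Nat.exists_eq_add_of_le' hℓ.le
  have h1 := hs.pow_eq_one
  have h2 := hs.inv.pow_eq_one
  rw [map_pow, crossHom_b, (reaRel hq).crossMatB_pow (pow_ne_zero 2 hq), h1, h2]
  ext i j
  fin_cases i <;> fin_cases j <;> simp

theorem crossHom_c_pow : crossHom hq (L q 1 0 ^ ℓ) = Matrix.diagonal fun _ => L q 1 0 ^ ℓ := by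
  obtain ⟨n, rfl⟩ := Nat.exists_eq_add_of_le' hℓ
  have h1 := hs.pow_eq_one
  have h2 := hs.inv.pow_eq_one
  rw [map_pow, crossHom_c, (reaRel hq).crossMatC_pow (pow_ne_zero 2 hq), h1, h2]
  ext i j
  fin_cases i <;> fin_cases j <;> simp

variable {R : Type} [Ring R] [Algebra ℂ R]

omit hℓ hs in
theorem commute_of_crossHom_eq_diagonal {u : OqGL2 q} (hu : crossHom hq u =
    Matrix.diagonal fun _ => u) (g : OqGL2 q →ₐ[ℂ] R) {A B C E : R}
    (h : CrossRel (q ^ 2) (g (L q 0 0)) (g (L q 0 1)) (g (L q 1 0)) (g (L q 1 1)) A B C E)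
    (i : Fin 4) : Commute (![A, B, C, E] i) (g u) := by
  have h1 := mul_hom_eq_sum hq g h u i
  rw [hu, Finset.sum_eq_single i] at h1
  · rwa [Matrix.diagonal_apply_eq] at h1
  · intro k _ hk
    rw [Matrix.diagonal_apply_ne _ hk.symm, map_zero, zero_mul]
  · simp

end OqGL2

namespace DqGL2
open MulOpposite
variable {q : ℂ} {ℓ : ℕ}

theorem exists_homOp (hq : q ≠ 0) : ∃ f : OqGL2 q →ₐ[ℂ] (DqGL2 q)ᵐᵒᵖ,
    ∀ i j, f (OqGL2.L q i j) = op (D q j i) := by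
  have hu : IsUnit (op (D q 0 0) * op (D q 1 1) - q ^ 2 • (op (D q 1 0) * op (D q 0 1))) := by
    have h1 : op (D q 0 0) * op (D q 1 1) - q ^ 2 • (op (D q 1 0) * op (D q 0 1)) =
        op (qdet q (D q)) := by
      -- Reversal turns the leading term into ∂₂₂∂₁₁, and `da` restores the order of the
      -- determinant.
      rw [← op_mul, ← op_mul, (reaRel_D hq).da, ← op_smul, ← op_sub]
      rfl
    rw [h1]
    exact (isUnit_qdet_D hq).op
  obtain ⟨f, h1, h2, h3, h4⟩ := OqGL2.exists_lift hq (reaRel_D hq).op hu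
  refine ⟨f, fun i j => ?_⟩
  fin_cases i <;> fin_cases j
  exacts [h1, h2, h3, h4]

theorem mem_center_of_commute {y : DqGL2 q} (hX : ∀ i j, Commute y (X q i j))
    (hD : ∀ i j, Commute y (D q i j)) : y ∈ Subalgebra.center ℂ (DqGL2 q) := by
  apply LocAt.mem_center
  have hS : (Subalgebra.centralizer ℂ {y}).comap (LocAt.of _) = (⊤ : Subalgebra ℂ (DqPlus q)) := by
    apply DqPlus.subalgebra_eq_top
    · intro i j
      rw [Subalgebra.mem_comap, Subalgebra.mem_centralizer_iff]
      rintro _ rfl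
      exact hX i j
    · intro i j
      rw [Subalgebra.mem_comap, Subalgebra.mem_centralizer_iff]
      rintro _ rfl
      exact hD i j
  intro a
  have ha : a ∈ (Subalgebra.centralizer ℂ {y}).comap (LocAt.of _) := hS ▸ Algebra.mem_top
  exact (Subalgebra.mem_centralizer_iff ℂ).mp ((Subalgebra.mem_comap _ _ _).mp ha) y rfl

variable (hℓ : 1 < ℓ) (hodd : Odd ℓ) (hs : IsPrimitiveRoot (q ^ 2) ℓ) (hq : q ≠ 0)

theorem commute_D_homX {u : OqGL2 q} (hu : OqGL2.crossHom hq u = Matrix.diagonal fun _ => u)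
    (i j : Fin 2) : Commute (D q i j) (homX hq u) := by
  have h := OqGL2.commute_of_crossHom_eq_diagonal hq hu (homX hq)
    (by simpa only [homX_L] using crossRel hq)
  fin_cases i <;> fin_cases j
  exacts [h 0, h 1, h 2, h 3]

/-- The indices are swapped in the hypothesis because the homomorphism to the opposite algebra sends
L to the transpose of D. -/
theorem commute_X_D_pow {k l : Fin 2}
    (hu : OqGL2.crossHom hq (OqGL2.L q l k ^ ℓ) = Matrix.diagonal fun _ => OqGL2.L q l k ^ ℓ)
    (i j : Fin 2) : Commute (X q i j) (D q k l ^ ℓ) := by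
  obtain ⟨g, hg⟩ := exists_homOp hq
  have h := OqGL2.commute_of_crossHom_eq_diagonal hq hu g
    (by simpa only [hg] using (crossRel hq).op)
  rw [map_pow, hg, ← op_pow] at h
  fin_cases i <;> fin_cases j
  exacts [commute_op.mp (h 0), commute_op.mp (h 2), commute_op.mp (h 1), commute_op.mp (h 3)]

theorem commute_homX (u : OqGL2 q) (hu : u ∈ Subalgebra.center ℂ (OqGL2 q)) (i j : Fin 2) :
    Commute (homX hq u) (X q i j) := by
  rw [← homX_L hq]
  exact Commute.map (Subalgebra.mem_center_iff.mp hu _).symm (homX hq)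

theorem commute_homD (u : OqGL2 q) (hu : u ∈ Subalgebra.center ℂ (OqGL2 q)) (i j : Fin 2) :
    Commute (homD hq u) (D q i j) := by
  rw [← homD_L hq]
  exact Commute.map (Subalgebra.mem_center_iff.mp hu _).symm (homD hq)

include hs hq in
theorem commute_D_qdet_X_pow (i j : Fin 2) : Commute (D q i j) (qdet q (X q) ^ ℓ) := by
  rw [← homX_qdet hq, ← map_pow]
  refine commute_D_homX hq ?_ i j
  rw [map_pow, OqGL2.crossHom_qdet, Matrix.diagonal_pow]
  congr 1
  ext i
  rw [Pi.pow_apply, smul_pow, hs.inv.pow_eq_one, one_smul]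

include hs hq in
theorem commute_X_qdet_D_pow (i j : Fin 2) : Commute (X q i j) (qdet q (D q) ^ ℓ) := by
  have h (n : ℕ) : qdet q (D q) ^ n * X q i j =
      (q ^ 2)⁻¹ ^ n • (X q i j * qdet q (D q) ^ n) := by
    induction n with
    | zero => simp
    | succ n ih =>
      rw [pow_succ', mul_assoc, ih, mul_smul_comm, ← mul_assoc, qdet_D_mul_X hq, smul_mul_assoc,
        smul_smul, ← pow_succ, mul_assoc, ← pow_succ']
  have h1 := h ℓ
  rw [hs.inv.pow_eq_one, one_smul] at h1
  exact h1.symm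

include hs hq in
theorem eq_zero_of_X_pow_mul {y : DqGL2 q} (h : X q 1 1 ^ ℓ * y = 0) : y = 0 := by
  refine eq_zero_of_homX_mul hq (u := OqGL2.L q 1 1 ^ ℓ)
    (fun y hy => OqGL2.eq_zero_of_d_pow_mul hs hq hy) ?_
  rwa [map_pow, homX_L]

include hs hodd hq in
theorem eq_zero_of_mul_D_pow {y : DqGL2 q} (h : y * D q 1 1 ^ ℓ = 0) : y = 0 := by
  refine eq_zero_of_mul_homD hq (u := OqGL2.L q 1 1 ^ ℓ) (fun y hy => ?_) ?_
  · have hd : OqGL2.L q 1 1 ^ ℓ ∈ Subalgebra.center ℂ (OqGL2 q) :=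
      OqGL2.frobMat_mem_center hodd hs hq 1 1
    refine OqGL2.eq_zero_of_d_pow_mul hs hq ?_
    rw [← Subalgebra.mem_center_iff.mp hd y, hy]
  · rwa [map_pow, homD_L]

include hs hodd hq in
theorem qdet_X_pow : qdet q (X q) ^ ℓ =
    homX hq (OqGL2.corner q ℓ) * X q 1 1 ^ ℓ - X q 0 1 ^ ℓ * X q 1 0 ^ ℓ := by
  simp only [← homX_qdet hq, ← homX_L hq, ← map_pow, ← map_mul, ← map_sub,
    (OqGL2.isFrobCorner_corner hodd hs hq).2]

include hs hodd hq in
theorem qdet_D_pow : qdet q (D q) ^ ℓ =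
    homD hq (OqGL2.corner q ℓ) * D q 1 1 ^ ℓ - D q 0 1 ^ ℓ * D q 1 0 ^ ℓ := by
  simp only [← homD_qdet hq, ← homD_L hq, ← map_pow, ← map_mul, ← map_sub,
    (OqGL2.isFrobCorner_corner hodd hs hq).2]

include hℓ hs hodd hq in
-- The cross matrix of the corner v is never computed. By the determinant identity v x₂₂^ℓ =
-- det_q(X)^ℓ + x₁₂^ℓ x₂₁^ℓ commutes with D, so does x₂₂^ℓ, and x₂₂^ℓ cancels on the left.
theorem homX_frobMat_mem_center (i j : Fin 2) :
    homX hq (frobMat ℓ (OqGL2.L q) (OqGL2.corner q ℓ) i j) ∈ Subalgebra.center ℂ (DqGL2 q) := by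
  have hb (k l : Fin 2) : Commute (D q k l) (homX hq (OqGL2.L q 0 1 ^ ℓ)) :=
    commute_D_homX hq (OqGL2.crossHom_b_pow hℓ hs hq) k l
  have hc (k l : Fin 2) : Commute (D q k l) (homX hq (OqGL2.L q 1 0 ^ ℓ)) :=
    commute_D_homX hq (OqGL2.crossHom_c_pow hℓ hs hq) k l
  have hd (k l : Fin 2) : Commute (D q k l) (homX hq (OqGL2.L q 1 1 ^ ℓ)) :=
    commute_D_homX hq (OqGL2.crossHom_d_pow hℓ hs hq) k l
  refine mem_center_of_commute
    (commute_homX hq _ (OqGL2.frobMat_mem_center hodd hs hq i j)) fun k l => ?_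
  fin_cases i <;> fin_cases j
  · have hdet : homX hq (OqGL2.corner q ℓ) * X q 1 1 ^ ℓ =
        qdet q (X q) ^ ℓ + homX hq (OqGL2.L q 0 1 ^ ℓ) * homX hq (OqGL2.L q 1 0 ^ ℓ) := by
      rw [qdet_X_pow hodd hs hq]
      simp [homX_L]
    have hcomm : Commute (D q k l) (homX hq (OqGL2.corner q ℓ) * X q 1 1 ^ ℓ) := by
      rw [hdet]
      exact (commute_D_qdet_X_pow hs hq k l).add_right ((hb k l).mul_right (hc k l))
    have hdd := hd k l
    rw [map_pow, homX_L] at hdd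
    have hdv : Commute (homX hq (OqGL2.corner q ℓ)) (X q 1 1 ^ ℓ) :=
      (commute_homX hq _ (OqGL2.corner_mem_center hs hq) 1 1).pow_right ℓ
    have h0 : X q 1 1 ^ ℓ * (homX hq (OqGL2.corner q ℓ) * D q k l -
        D q k l * homX hq (OqGL2.corner q ℓ)) = 0 := by
      rw [mul_sub, ← mul_assoc, ← mul_assoc, ← hdv.eq, ← hcomm.eq, hdv.eq, ← mul_assoc, hdd.eq,
        sub_self]
    exact sub_eq_zero.mp (eq_zero_of_X_pow_mul hs hq h0)
  exacts [(hb k l).symm, (hc k l).symm, (hd k l).symm]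

include hℓ hs hodd hq in
-- The same argument as for X, with ∂₂₂^ℓ cancelled on the right, since D is the right factor of the
-- triangular decomposition.
theorem homD_frobMat_mem_center (i j : Fin 2) :
    homD hq (frobMat ℓ (OqGL2.L q) (OqGL2.corner q ℓ) i j) ∈ Subalgebra.center ℂ (DqGL2 q) := by
  have hb (k l : Fin 2) : Commute (X q k l) (D q 0 1 ^ ℓ) :=
    commute_X_D_pow hq (OqGL2.crossHom_c_pow hℓ hs hq) k l
  have hc (k l : Fin 2) : Commute (X q k l) (D q 1 0 ^ ℓ) :=
    commute_X_D_pow hq (OqGL2.crossHom_b_pow hℓ hs hq) k l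
  have hd (k l : Fin 2) : Commute (X q k l) (D q 1 1 ^ ℓ) :=
    commute_X_D_pow hq (OqGL2.crossHom_d_pow hℓ hs hq) k l
  refine mem_center_of_commute (fun k l => ?_)
    (commute_homD hq _ (OqGL2.frobMat_mem_center hodd hs hq i j))
  fin_cases i <;> fin_cases j
  · have hdet : homD hq (OqGL2.corner q ℓ) * D q 1 1 ^ ℓ =
        qdet q (D q) ^ ℓ + D q 0 1 ^ ℓ * D q 1 0 ^ ℓ := by
      rw [qdet_D_pow hodd hs hq]
      simp
    have hcomm : Commute (X q k l) (homD hq (OqGL2.corner q ℓ) * D q 1 1 ^ ℓ) := by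
      rw [hdet]
      exact (commute_X_qdet_D_pow hs hq k l).add_right ((hb k l).mul_right (hc k l))
    have h0 : (homD hq (OqGL2.corner q ℓ) * X q k l - X q k l * homD hq (OqGL2.corner q ℓ)) *
        D q 1 1 ^ ℓ = 0 := by
      rw [sub_mul, mul_assoc, mul_assoc, (hd k l).eq, ← mul_assoc, hcomm.eq, sub_self]
    exact sub_eq_zero.mp (eq_zero_of_mul_D_pow hodd hs hq h0)
  · exact (map_pow (homD hq) _ _).trans (congrArg (· ^ ℓ) (homD_L hq 0 1)) ▸ (hb k l).symm
  · exact (map_pow (homD hq) _ _).trans (congrArg (· ^ ℓ) (homD_L hq 1 0)) ▸ (hc k l).symm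
  · exact (map_pow (homD hq) _ _).trans (congrArg (· ^ ℓ) (homD_L hq 1 1)) ▸ (hd k l).symm

end DqGL2

end FrobeniusCross

/-! ### The Frobenius center of D_q(GL₂) -/

section MainDq
open MvPolynomial TensorProduct

theorem span_rename_mul_rename {σ τ R : Type*} [CommRing R] :
    Submodule.span R {f : MvPolynomial (σ ⊕ τ) R | ∃ g h, f = rename Sum.inl g * rename Sum.inr h} =
      ⊤ := by
  rw [eq_top_iff]
  rintro f -
  induction f using MvPolynomial.induction_on with
  | C r => exact Submodule.subset_span ⟨C r, 1, by simp⟩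
  | add f f' h h' => exact add_mem h h'
  | mul_X f i h =>
    induction h using Submodule.span_induction with
    | mem f hf =>
      obtain ⟨g, h, rfl⟩ := hf
      refine Submodule.subset_span ?_
      cases i with
      | inl i => exact ⟨g * X i, h, by rw [map_mul, rename_X]; ring⟩
      | inr i => exact ⟨g, h * X i, by rw [map_mul, rename_X]; ring⟩
    | zero => rw [zero_mul]; exact zero_mem _
    | add f f' _ _ h h' => rw [add_mul]; exact add_mem h h'
    | smul r f _ h => rw [smul_mul_assoc]; exact Submodule.smul_mem _ r h

/-- A polynomial that vanishes at the pairs of invertible matrices with nonzero second columns is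
zero. -/
theorem eq_zero_of_eval_elim_eq_zero {f : MvPolynomial ((Fin 2 × Fin 2) ⊕ (Fin 2 × Fin 2)) ℂ}
    (h : ∀ x y : Fin 2 × Fin 2 → ℂ, x (0, 1) ≠ 0 → x (1, 1) ≠ 0 → eval x detPoly ≠ 0 →
      y (0, 1) ≠ 0 → y (1, 1) ≠ 0 → eval y detPoly ≠ 0 → eval (Sum.elim x y) f = 0) : f = 0 := by
  let p : MvPolynomial (Fin 2 × Fin 2) ℂ := X (0, 1) * X (1, 1) * detPoly
  have hp : p ≠ 0 := mul_ne_zero (mul_ne_zero (X_ne_zero _) (X_ne_zero _)) detPoly_ne_zero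
  have h0 : f * (rename Sum.inl p * rename Sum.inr p) = 0 := by
    refine MvPolynomial.funext fun z => ?_
    obtain ⟨x, y, rfl⟩ : ∃ x y, z = Sum.elim x y := ⟨_, _, (Sum.elim_comp_inl_inr z).symm⟩
    rw [map_mul, map_mul, eval_rename, eval_rename, Sum.elim_comp_inl, Sum.elim_comp_inr, map_zero]
    by_cases hx : eval x p = 0
    · rw [hx, zero_mul, mul_zero]
    by_cases hy : eval y p = 0
    · rw [hy, mul_zero, mul_zero]
    simp only [p, map_mul, eval_X, mul_eq_zero, not_or] at hx hy
    rw [h x y hx.1.1 hx.1.2 hx.2 hy.1.1 hy.1.2 hy.2, zero_mul]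
  refine (mul_eq_zero.mp h0).resolve_right (mul_ne_zero ?_ ?_)
  · exact (map_ne_zero_iff _ (rename_injective _ Sum.inl_injective)).mpr hp
  · exact (map_ne_zero_iff _ (rename_injective _ Sum.inr_injective)).mpr hp

namespace DqGL2
variable {q : ℂ} {ℓ : ℕ} (hℓ : 1 < ℓ) (hodd : Odd ℓ) (hs : IsPrimitiveRoot (q ^ 2) ℓ) (hq : q ≠ 0)

/-- The entries of the two Frobenius matrices, as central elements of `D_q(GL₂)`. -/
noncomputable def frobEntry : (Fin 2 × Fin 2) ⊕ (Fin 2 × Fin 2) → Subalgebra.center ℂ (DqGL2 q) :=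
  Sum.elim (fun p => ⟨_, homX_frobMat_mem_center hℓ hodd hs hq p.1 p.2⟩)
    (fun p => ⟨_, homD_frobMat_mem_center hℓ hodd hs hq p.1 p.2⟩)

theorem homX_frobMat (i j : Fin 2) :
    homX hq (frobMat ℓ (OqGL2.L q) (OqGL2.corner q ℓ) i j) =
      frobMat ℓ (X q) (homX hq (OqGL2.corner q ℓ)) i j := by
  fin_cases i <;> fin_cases j <;> simp [frobMat, homX_L]

theorem homD_frobMat (i j : Fin 2) :
    homD hq (frobMat ℓ (OqGL2.L q) (OqGL2.corner q ℓ) i j) =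
      frobMat ℓ (D q) (homD hq (OqGL2.corner q ℓ)) i j := by
  fin_cases i <;> fin_cases j <;> simp [frobMat, homD_L]

theorem coe_aeval_rename_inl (f : MvPolynomial (Fin 2 × Fin 2) ℂ) :
    ((aeval (frobEntry hℓ hodd hs hq) (rename Sum.inl f) : Subalgebra.center ℂ (DqGL2 q)) :
      DqGL2 q) = homX hq (aeval (OqGL2.frobEntry hodd hs hq) f :
        Subalgebra.center ℂ (OqGL2 q)) := by
  rw [aeval_rename]
  exact coe_aeval_eq_map (homX hq) _ _ (fun _ => rfl) f

theorem coe_aeval_rename_inr (f : MvPolynomial (Fin 2 × Fin 2) ℂ) :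
    ((aeval (frobEntry hℓ hodd hs hq) (rename Sum.inr f) : Subalgebra.center ℂ (DqGL2 q)) :
      DqGL2 q) = homD hq (aeval (OqGL2.frobEntry hodd hs hq) f :
        Subalgebra.center ℂ (OqGL2 q)) := by
  rw [aeval_rename]
  exact coe_aeval_eq_map (homD hq) _ _ (fun _ => rfl) f

theorem aeval_injective : Function.Injective (aeval (R := ℂ) (frobEntry hℓ hodd hs hq)) := by
  rw [injective_iff_map_eq_zero]
  intro f hf
  refine eq_zero_of_eval_elim_eq_zero fun x y hx1 hx2 hx3 hy1 hy2 hy3 => ?_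
  obtain ⟨φ, hφ⟩ := OqGL2.exists_functional hodd hs hq hx1 hx2 hx3
  obtain ⟨ψ, hψ⟩ := OqGL2.exists_functional hodd hs hq hy1 hy2 hy3
  -- The tensor product of the two central characters, carried over by the triangular decomposition;
  -- on central polynomials it evaluates at the pair (x, y).
  let χ : DqGL2 q →ₗ[ℂ] ℂ := LinearMap.mul' ℂ ℂ ∘ₗ
    TensorProduct.map (φ ∘ₗ (OqBB.of q).toLinearMap) (ψ ∘ₗ (OqBB.of q).toLinearMap) ∘ₗ
      (mulEquiv hq).symm.toLinearMap
  have key : χ ∘ₗ (Subalgebra.center ℂ (DqGL2 q)).val.toLinearMap ∘ₗ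
      (aeval (frobEntry hℓ hodd hs hq)).toLinearMap =
        (aeval (R := ℂ) (Sum.elim x y)).toLinearMap := by
    refine LinearMap.ext_on span_rename_mul_rename ?_
    rintro _ ⟨g, h, rfl⟩
    have h1 : χ (aeval (frobEntry hℓ hodd hs hq) (rename Sum.inl g * rename Sum.inr h) :
        Subalgebra.center ℂ (DqGL2 q)) = eval x g * eval y h := by
      rw [map_mul, MulMemClass.coe_mul, coe_aeval_rename_inl, coe_aeval_rename_inr, ← hφ, ← hψ]
      exact congrArg _ (congrArg _ (mulEquiv_symm_mul hq _ _))
    refine h1.trans ?_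
    rw [AlgHom.toLinearMap_apply, map_mul, aeval_rename, aeval_rename, Sum.elim_comp_inl,
      Sum.elim_comp_inr, ← coe_aeval_eq_eval x, ← coe_aeval_eq_eval y]
    rfl
  have h1 := LinearMap.congr_fun key f
  simp only [LinearMap.comp_apply, AlgHom.toLinearMap_apply, hf, map_zero] at h1
  rw [← coe_aeval_eq_eval]
  exact h1.symm

include hodd hs hq in
theorem qdet_mul_qdet_pow :
    (qdet q (X q) * qdet q (D q)) ^ ℓ = qdet q (X q) ^ ℓ * qdet q (D q) ^ ℓ := by
  set κ : ℂ := (q ^ 2)⁻¹ * (q ^ 2)⁻¹ with hκ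
  have h1 (n : ℕ) : qdet q (D q) * qdet q (X q) ^ n = κ ^ n • (qdet q (X q) ^ n * qdet q (D q)) := by
    induction n with
    | zero => simp
    | succ n ih =>
      rw [pow_succ', ← mul_assoc, qdet_D_mul_qdet_X hq, smul_mul_assoc, mul_assoc, ih,
        mul_smul_comm, smul_smul, ← mul_assoc, ← hκ, pow_succ' κ]
  have h2 (n : ℕ) : (qdet q (X q) * qdet q (D q)) ^ n =
      κ ^ n.choose 2 • (qdet q (X q) ^ n * qdet q (D q) ^ n) := by
    induction n with
    | zero => simp
    | succ n ih =>
      rw [pow_succ', ih, mul_smul_comm, mul_assoc, ← mul_assoc (qdet q (D q)), h1, smul_mul_assoc,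
        mul_smul_comm, smul_smul, ← pow_add, Nat.choose_succ_succ' n 1, Nat.choose_one_right,
        add_comm n, mul_assoc, ← pow_succ' (qdet q (D q)), ← mul_assoc,
        ← pow_succ' (qdet q (X q))]
  obtain ⟨k, hk⟩ := hodd
  -- For odd ℓ = 2k + 1 the number of transpositions is a multiple of ℓ, so the accumulated power of
  -- κ is 1.
  have h3 : ℓ.choose 2 = ℓ * k := by
    rw [Nat.choose_two_right, hk, Nat.add_sub_cancel, mul_left_comm, Nat.mul_div_cancel_left _ two_pos]
  have h4 : κ ^ ℓ = 1 := by rw [hκ, mul_pow, hs.inv.pow_eq_one, one_mul]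
  rw [h2, h3, pow_mul, h4, one_pow, one_smul]

theorem coe_aeval_detPoly_mul_detPoly :
    ((aeval (frobEntry hℓ hodd hs hq) (rename Sum.inl detPoly * rename Sum.inr detPoly) :
      Subalgebra.center ℂ (DqGL2 q)) : DqGL2 q) = (qdet q (X q) * qdet q (D q)) ^ ℓ := by
  rw [map_mul, MulMemClass.coe_mul, coe_aeval_rename_inl, coe_aeval_rename_inr,
    OqGL2.coe_aeval_detPoly, map_pow, map_pow, homX_qdet, homD_qdet, qdet_mul_qdet_pow hodd hs hq]

theorem qdet_mul_qdet_pow_mul_detInv_pow :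
    (qdet q (X q) * qdet q (D q)) ^ ℓ * detInv q ^ ℓ = 1 := by
  have hc : Commute (qdet q (X q) * qdet q (D q)) (detInv q) := mul_detInv.trans detInv_mul.symm
  rw [← hc.mul_pow, mul_detInv, one_pow]

include hℓ hodd hs hq in
theorem detInv_pow_mem_center : detInv q ^ ℓ ∈ Subalgebra.center ℂ (DqGL2 q) := by
  rw [Subalgebra.mem_center_iff]
  have h1 := (aeval (frobEntry hℓ hodd hs hq) (rename Sum.inl detPoly * rename Sum.inr detPoly)).2
  rw [coe_aeval_detPoly_mul_detPoly] at h1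
  have hc : Commute ((qdet q (X q) * qdet q (D q)) ^ ℓ) (detInv q ^ ℓ) :=
    Commute.pow_pow (mul_detInv.trans detInv_mul.symm) ℓ ℓ
  let u : (DqGL2 q)ˣ := ⟨(qdet q (X q) * qdet q (D q)) ^ ℓ, detInv q ^ ℓ,
    qdet_mul_qdet_pow_mul_detInv_pow, hc.eq.symm.trans qdet_mul_qdet_pow_mul_detInv_pow⟩
  exact fun w => Commute.units_inv_right (u := u) (Subalgebra.mem_center_iff.mp h1 w)

theorem ell_eq_adjoin :
    DqEll q ℓ (homX hq (OqGL2.corner q ℓ)) (homD hq (OqGL2.corner q ℓ)) = Algebra.adjoin ℂ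
      (Set.range (fun p => (frobEntry hℓ hodd hs hq p : DqGL2 q)) ∪ {detInv q ^ ℓ}) := by
  have h : (fun p => (frobEntry hℓ hodd hs hq p : DqGL2 q)) =
      Sum.elim (fun p => frobMat ℓ (X q) (homX hq (OqGL2.corner q ℓ)) p.1 p.2)
        (fun p => frobMat ℓ (D q) (homD hq (OqGL2.corner q ℓ)) p.1 p.2) := by
    ext (p | p)
    · exact homX_frobMat hq p.1 p.2
    · exact homD_frobMat hq p.1 p.2
  rw [h, Set.Sum.elim_range]
  rfl

/-- The Frobenius center of `D_q(GL₂)`. -/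
theorem exists_frobenius_center (hℓ : 1 < ℓ) (hodd : Odd ℓ) (hs : IsPrimitiveRoot (q ^ 2) ℓ)
    (hq : q ≠ 0) : ∃ v w : DqGL2 q,
      (IsFrobCorner q ℓ (X q) v ∧ ∀ v', IsFrobCorner q ℓ (X q) v' → v' = v) ∧
      (IsFrobCorner q ℓ (D q) w ∧ ∀ w', IsFrobCorner q ℓ (D q) w' → w' = w) ∧
      DqEll q ℓ v w ≤ Subalgebra.center ℂ (DqGL2 q) ∧
      (∃ Θ : regularFunctions glglCoord ≃ₐ[ℂ] DqEll q ℓ v w,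
        (∀ i j, (Θ (coordFn glglCoord (Sum.inl (i, j))) : DqGL2 q) = frobMat ℓ (X q) v i j) ∧
        (∀ i j, (Θ (coordFn glglCoord (Sum.inr (i, j))) : DqGL2 q) = frobMat ℓ (D q) w i j)) := by
  have hv : homX hq (OqGL2.corner q ℓ) ∈ Subalgebra.center ℂ (DqGL2 q) :=
    homX_frobMat_mem_center hℓ hodd hs hq 0 0
  have hw : homD hq (OqGL2.corner q ℓ) ∈ Subalgebra.center ℂ (DqGL2 q) :=
    homD_frobMat_mem_center hℓ hodd hs hq 0 0
  have hu := detInv_pow_mem_center hℓ hodd hs hq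
  obtain ⟨⟨Θ, hΘ⟩, -⟩ := exists_regularFunctions_algEquiv exists_glglCoord_eq
    eval_glglCoord_ne_zero (frobEntry hℓ hodd hs hq) ⟨detInv q ^ ℓ, hu⟩
    (Subtype.ext (by
      rw [MulMemClass.coe_mul, coe_aeval_detPoly_mul_detPoly]
      exact qdet_mul_qdet_pow_mul_detInv_pow))
    (aeval_injective hℓ hodd hs hq) _ (ell_eq_adjoin hℓ hodd hs hq)
  refine ⟨homX hq (OqGL2.corner q ℓ), homD hq (OqGL2.corner q ℓ),
    ⟨⟨hv, qdet_X_pow hodd hs hq⟩, fun v' hv' => ?_⟩,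
    ⟨⟨hw, qdet_D_pow hodd hs hq⟩, fun w' hw' => ?_⟩, ?_, Θ, fun i j => ?_, fun i j => ?_⟩
  · have h1 : v' * X q 1 1 ^ ℓ = homX hq (OqGL2.corner q ℓ) * X q 1 1 ^ ℓ :=
      sub_left_injective (hv'.2.symm.trans (qdet_X_pow hodd hs hq))
    rw [← sub_eq_zero]
    refine eq_zero_of_X_pow_mul hs hq ?_
    rw [mul_sub, Subalgebra.mem_center_iff.mp hv'.1, Subalgebra.mem_center_iff.mp hv, h1, sub_self]
  · have h1 : w' * D q 1 1 ^ ℓ = homD hq (OqGL2.corner q ℓ) * D q 1 1 ^ ℓ :=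
      sub_left_injective (hw'.2.symm.trans (qdet_D_pow hodd hs hq))
    rw [← sub_eq_zero]
    refine eq_zero_of_mul_D_pow hodd hs hq ?_
    rw [sub_mul, h1, sub_self]
  · rw [ell_eq_adjoin hℓ hodd hs hq, Algebra.adjoin_le_iff]
    rintro _ (⟨p, rfl⟩ | h)
    · exact (frobEntry hℓ hodd hs hq p).2
    · rwa [Set.mem_singleton_iff.mp h]
  · exact (hΘ _).trans (homX_frobMat hq i j)
  · exact (hΘ _).trans (homD_frobMat hq i j)

end DqGL2

end MainDq

theorem mainTheorem3 (ℓ : ℕ) (hℓ : 1 < ℓ) (hodd : Odd ℓ) (q : ℂ) (hq : IsPrimitiveRoot q ℓ) :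
    (∃ z : OqGL2 q,
      (IsFrobCorner q ℓ (OqGL2.L q) z ∧ ∀ z', IsFrobCorner q ℓ (OqGL2.L q) z' → z' = z) ∧
      OqEll q ℓ z ≤ Subalgebra.center ℂ (OqGL2 q) ∧
      (∃ Φ : regularFunctions glCoord ≃ₐ[ℂ] OqEll q ℓ z,
        ∀ i j, (Φ (coordFn glCoord (i, j)) : OqGL2 q) = frobMat ℓ (OqGL2.L q) z i j) ∧
      Set.InjOn (OqBB.of q) (OqEll q ℓ z) ∧
      OqEllBB q ℓ z ≤ Subalgebra.center ℂ (OqBB q) ∧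
      (∃ Ψ : regularFunctions bbCoord ≃ₐ[ℂ] OqEllBB q ℓ z,
        ∀ i j, (Ψ (coordFn bbCoord (i, j)) : OqBB q) =
          OqBB.of q (frobMat ℓ (OqGL2.L q) z i j))) ∧
    (∃ v w : DqGL2 q,
      (IsFrobCorner q ℓ (DqGL2.X q) v ∧ ∀ v', IsFrobCorner q ℓ (DqGL2.X q) v' → v' = v) ∧
      (IsFrobCorner q ℓ (DqGL2.D q) w ∧ ∀ w', IsFrobCorner q ℓ (DqGL2.D q) w' → w' = w) ∧
      DqEll q ℓ v w ≤ Subalgebra.center ℂ (DqGL2 q) ∧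
      (∃ Θ : regularFunctions glglCoord ≃ₐ[ℂ] DqEll q ℓ v w,
        (∀ i j, (Θ (coordFn glglCoord (Sum.inl (i, j))) : DqGL2 q) =
          frobMat ℓ (DqGL2.X q) v i j) ∧
        (∀ i j, (Θ (coordFn glglCoord (Sum.inr (i, j))) : DqGL2 q) =
          frobMat ℓ (DqGL2.D q) w i j))) := by
  have hq0 : q ≠ 0 := hq.ne_zero hodd.pos.ne'
  -- Everything above depends on q² as a primitive ℓ-th root of unity, which is where 2 must be
  -- prime to ℓ.
  have hs : IsPrimitiveRoot (q ^ 2) ℓ := hq.pow_of_coprime 2 hodd.coprime_two_left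
  exact ⟨OqGL2.exists_frobenius_center hodd hs hq0,
    DqGL2.exists_frobenius_center hℓ hodd hs hq0⟩
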